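/- \textbf{Setting.} Let $\pi:E\to M$ be a smooth real vector bundle of finite rank over a finite-dimensional (Hausdorff) smooth manifold, with a Lie algebroid structure: a smooth bundle map $\rho:E\to TM$ (the anchor) and a real Lie bracket $[\cdot,\cdot]$ on $\Gamma(E)$ with $[\xi,f\eta]=f[\xi,\eta]+(\rho(\xi)f)\eta$. Its prolongation is the vector bundle $\pounds^\pi E=\{(e,z)\in E\times TE:\rho(e)=\pi_*(z)\}$ over $E$, with projection $(e,z)\mapsto u$ for $z\in T_uE$. It is a Lie algebroid with anchor $\rho_\pounds(e,z)=z$ and with the following bracket $[\![\cdot,\cdot]\!]$. Regard sections of $\pounds^\pi E$ as pairs $(\sigma,Z)$, where $Z$ is a vector field on $E$ and $\sigma$ is a section of the pullback bundle $\pi^*E\to E$. Let $(e_\alpha)$ be a local frame of $E$, $\widehat{e_\alpha}=e_\alpha\circ\pi$, $\sigma=\sigma^\alpha\widehat{e_\alpha}$ and $\tau=\tau^\alpha\widehat{e_\alpha}$. Then $$[\![(\sigma,Z),(\tau,W)]\!]=\bigl(\sigma^\alpha\tau^\beta\,\widehat{[e_\alpha,e_\beta]}+Z(\tau^\alpha)\widehat{e_\alpha}-W(\sigma^\alpha)\widehat{e_\alpha},\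 [Z,W]\bigr).$$ All sections are smooth on their whole domains. \textbf{Lifts.} For $v\in E_{\pi(u)}$ let $v^\vee_u=\frac{d}{dt}\big|_{0}(u+tv)\in T_uE$. Put $i(u,v)=(0,v^\vee_u)$, $j(e,z)=(u,e)$ for $z\in T_uE$, $J=i\circ j$, and $C(u)=(0,u^\vee_u)$. For $\eta\in\Gamma(E)$ let $\widehat\eta=\eta\circ\pi\in\Gamma(\pi^*E)$ and $\eta^V=i\,\widehat\eta$. Let $\eta^C(u)=(\eta(\pi(u)),\eta^c(u))$, where $\eta^c$ is the unique vector field on $E$ that is $\pi$-projectable on $\rho(\eta)$ and satisfies $\eta^c(\widehat\theta)=\widehat{\mathcal L_\eta\theta}$ for all $\theta\in\Gamma(E^*)$. Here $\widehat\theta(u)=\theta_{\pi(u)}(u)$ and $(\mathcal L_\eta\theta)(\xi)=\rho(\eta)(\theta(\xi))-\theta([\eta,\xi])$. A section $\widetilde\xi$ of $\pounds^\pi E$ is projectable if its $E$-component is $X\circ\pi$ for some $X\in\Gamma(E)$. \textbf{Sprays.} A spray is a section $S$ of $\pounds^\pi E$ with $J(S)=C$ and $[\![C,S]\!]=S$.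 Its Berwald connection is the $C^\infty(E)$-linear map $\mathcal H:\Gamma(\pi^*E)\to\Gamma(\pounds^\pi E)$ with $\mathcal H\widehat\eta=\frac12(\eta^C+[\![\eta^V,S]\!])$ for all $\eta\in\Gamma(E)$. It satisfies $j\circ\mathcal H=\mathrm{id}$. Put $\mathcal V=i^{-1}\circ(\mathrm{id}-\mathcal H\circ j)$ and $\nabla^v_{\sigma}\tau=j[\![i\sigma,\mathcal H\tau]\!]$ for $\sigma,\tau\in\Gamma(\pi^*E)$. For a tensor field $T:\Gamma(\pi^*E)^k\to\Gamma(\pi^*E)$ put $$\nabla^vT(\sigma,\tau_1,\dots,\tau_k)=\nabla^v_\sigma\bigl(T(\tau_1,\dots,\tau_k)\bigr)-\sum_{r=1}^kT(\tau_1,\dots,\nabla^v_\sigma\tau_r,\dots,\tau_k).$$ The Jacobi endomorphism $K$, the fundamental affine curvature $R$ and the affine curvature $H$ of $S$ are $$K(\sigma)=\mathcal V[\![S,\mathcal H\sigma]\!],\qquad R(\sigma,\tau)=\tfrac13\bigl(\nabla^vK(\tau,\sigma)-\nabla^vK(\sigma,\tau)\bigr),\qquad H(\sigma,\tau)\vartheta=\nabla^vR(\vartheta,\sigma,\tau).$$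 \textbf{Collineations.} For a projectable section $\widetilde\xi$ let $\widetilde{\mathcal L}_{\widetilde\xi}\sigma=i^{-1}[\![\widetilde\xi,i\sigma]\!]$ for $\sigma\in\Gamma(\pi^*E)$, and $$(\widetilde{\mathcal L}_{\widetilde\xi}T)(\tau_1,\dots,\tau_k)=\widetilde{\mathcal L}_{\widetilde\xi}\bigl(T(\tau_1,\dots,\tau_k)\bigr)-\sum_{r=1}^kT(\tau_1,\dots,\widetilde{\mathcal L}_{\widetilde\xi}\tau_r,\dots,\tau_k).$$ A curvature collineation of $T$ is a projectable section $\widetilde\xi$ with $\widetilde{\mathcal L}_{\widetilde\xi}T=0$. \textbf{Theorem.} Let $S$ be a spray on $\pounds^\pi E$ and let $\eta\in\Gamma(E)$ be a Lie symmetry of $S$, i.e. $[\![S,\eta^C]\!]=0$. Then $\eta^C$ is a curvature collineation of $K$, of $R$ and of $H$: it is a projectable section of $\pounds^\pi E$, and $$\widetilde{\mathcal L}_{\eta^C}K=0,\qquad\widetilde{\mathcal L}_{\eta^C}R=0,\qquad\widetilde{\mathcal L}_{\eta^C}H=0.$$ -/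

import Mathlib

open Bundle Set Filter
open scoped Manifold Topology ContDiff Bundle

noncomputable section

section Algebroid

variable {EM : Type*} [NormedAddCommGroup EM] [NormedSpace ℝ EM]
  {M : Type*} [TopologicalSpace M] [ChartedSpace EM M] [IsManifold 𝓘(ℝ, EM) ∞ M]
  {F : Type*} [NormedAddCommGroup F] [NormedSpace ℝ F]
  {E : M → Type*} [TopologicalSpace (TotalSpace F E)]
  [∀ x, AddCommGroup (E x)] [∀ x, Module ℝ (E x)] [∀ x, TopologicalSpace (E x)]
  [FiberBundle F E] [VectorBundle ℝ F E] [ContMDiffVectorBundle ∞ F E 𝓘(ℝ, EM)]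

/-- The product of a smooth function and a smooth section. -/
def smulSection (f : C^∞⟮𝓘(ℝ, EM), M; 𝓘(ℝ, ℝ), ℝ⟯) (s : Cₛ^∞⟮𝓘(ℝ, EM); F, E⟯) :
    Cₛ^∞⟮𝓘(ℝ, EM); F, E⟯ :=
  ⟨fun x => f x • s x, f.contMDiff.smul_section s.contMDiff⟩

variable (EM F E) in
/-- A Lie algebroid structure on a smooth vector bundle `E → M`: a smooth bundle map
`ρ : E → TM` (the anchor) and a real Lie bracket on the smooth sections of `E` with
`[ξ, f η] = f [ξ, η] + (ρ(ξ) f) η`. -/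
structure LieAlgebroid where
  /-- The anchor. -/
  anchor : ∀ x : M, E x →ₗ[ℝ] TangentSpace 𝓘(ℝ, EM) x
  contMDiff_anchor : ContMDiff (𝓘(ℝ, EM).prod 𝓘(ℝ, F)) 𝓘(ℝ, EM).tangent ∞
    (fun v : TotalSpace F E => (⟨v.proj, anchor v.proj v.snd⟩ : TangentBundle 𝓘(ℝ, EM) M))
  /-- The Lie bracket of smooth sections. -/
  bracket : Cₛ^∞⟮𝓘(ℝ, EM); F, E⟯ →ₗ[ℝ] Cₛ^∞⟮𝓘(ℝ, EM); F, E⟯ →ₗ[ℝ] Cₛ^∞⟮𝓘(ℝ, EM); F, E⟯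
  bracket_self : ∀ ξ, bracket ξ ξ = 0
  jacobi : ∀ ξ η ζ, bracket ξ (bracket η ζ) = bracket (bracket ξ η) ζ + bracket η (bracket ξ ζ)
  leibniz : ∀ (ξ η : Cₛ^∞⟮𝓘(ℝ, EM); F, E⟯) (f : C^∞⟮𝓘(ℝ, EM), M; 𝓘(ℝ, ℝ), ℝ⟯) (x : M),
    bracket ξ (smulSection f η) x =
      f x • bracket ξ η x +
        mvfderiv 𝓘(ℝ, EM) f x (anchor x (ξ x)) • η x

/-- Every vector of `E` extends to a global smooth section which near the base point is
constant in the preferred trivialization around that point. -/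
theorem exists_section_eventuallyEq_extend [FiniteDimensional ℝ EM] [T2Space M] {x : M} (v : E x) :
    ∃ s : Cₛ^∞⟮𝓘(ℝ, EM); F, E⟯, ∀ᶠ y in 𝓝 x, s y = FiberBundle.extend F v y := by
  obtain ⟨U, hU, hs⟩ := FiberBundle.exists_contMDiffOn_extend (k := ∞) 𝓘(ℝ, EM) F v
  obtain ⟨V, hVU, hVo, hxV⟩ := mem_nhds_iff.1 hU
  obtain ⟨χ, -, hχ⟩ := (SmoothBumpFunction.nhds_basis_tsupport (I := 𝓘(ℝ, EM)) x).mem_iff.1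
    (hVo.mem_nhds hxV)
  refine ⟨⟨(χ : M → ℝ) • FiberBundle.extend F v, ContMDiffOn.smul_section_of_tsupport
    χ.contMDiff.contMDiffOn hVo hχ (hs.mono hVU)⟩, ?_⟩
  filter_upwards [χ.eventuallyEq_one] with y hy
  simp [hy]

/-- A global smooth section through `v` which is constant near the base point in the preferred
trivialization around that point. -/
def sectionThrough [FiniteDimensional ℝ EM] [T2Space M] {x : M} (v : E x) :
    Cₛ^∞⟮𝓘(ℝ, EM); F, E⟯ :=
  (exists_section_eventuallyEq_extend v).choose

theorem sectionThrough_apply_self [FiniteDimensional ℝ EM] [T2Space M] {x : M} (v : E x) :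
    (sectionThrough v : Cₛ^∞⟮𝓘(ℝ, EM); F, E⟯) x = v := by
  have h : (sectionThrough v : Cₛ^∞⟮𝓘(ℝ, EM); F, E⟯) x = FiberBundle.extend F v x :=
    ((exists_section_eventuallyEq_extend (EM := EM) (F := F) v).choose_spec).self_of_nhds
  rw [h, FiberBundle.extend_apply_self]

variable (F E) in
/-- Sections, not necessarily smooth, of the pullback bundle `π^*E → E`, that is, maps
`σ : E → E` with `π ∘ σ = π`. -/
abbrev PullbackSection := ∀ u : TotalSpace F E, E u.proj

variable (EM F E) in
/-- Sections, not necessarily smooth, of the bundle `π^*E ⊕ TE` over `E`, which contains the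
prolongation `£^πE` as a subbundle. -/
abbrev AmbientSection :=
  ∀ u : TotalSpace F E, E u.proj × TangentSpace (𝓘(ℝ, EM).prod 𝓘(ℝ, F)) u

variable (EM) in
/-- Smoothness of a section of `π^*E → E`. -/
def IsSmoothPullbackSection (σ : PullbackSection F E) : Prop :=
  ContMDiff (𝓘(ℝ, EM).prod 𝓘(ℝ, F)) (𝓘(ℝ, EM).prod 𝓘(ℝ, F)) ∞
    (fun u : TotalSpace F E => (⟨u.proj, σ u⟩ : TotalSpace F E))

variable (EM) in
/-- The canonical isomorphism `E_{π(u)} → T_u(E_{π(u)}) ⊆ T_u E`,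
`v ↦ d/dt (u + t v)` at `t = 0`. -/
def vertLift (u : TotalSpace F E) (v : E u.proj) :
    TangentSpace (𝓘(ℝ, EM).prod 𝓘(ℝ, F)) u :=
  (mfderiv 𝓘(ℝ, ℝ) (𝓘(ℝ, EM).prod 𝓘(ℝ, F))
    (fun t : ℝ => (⟨u.proj, u.snd + t • v⟩ : TotalSpace F E)) 0 (1 : ℝ) : EM × F)

/-- The derivative at `u`, in the direction `z`, of the components of a section `σ` of `π^*E`
in the preferred trivialization of `E` around `π(u)`: if `σ = σ^α ê_α` for the local frame
`e_α` given by this trivialization, the result is `z(σ^α) e_α(π(u))`. -/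
def componentDeriv (σ : PullbackSection F E) (u : TotalSpace F E)
    (z : TangentSpace (𝓘(ℝ, EM).prod 𝓘(ℝ, F)) u) : E u.proj :=
  (trivializationAt F E u.proj).symm u.proj
    (mvfderiv (𝓘(ℝ, EM).prod 𝓘(ℝ, F))
      (fun w : TotalSpace F E => (trivializationAt F E u.proj ⟨w.proj, σ w⟩).2) u z)

/-- The inverse of `vertLift` on vertical vectors: the fibre components of `z` in the preferred
trivialization around `π(u)`. -/
def vertLiftInv (u : TotalSpace F E) (z : TangentSpace (𝓘(ℝ, EM).prod 𝓘(ℝ, F)) u) : E u.proj :=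
  componentDeriv (fun w => w.snd) u z

/-- The map `i : π^*E → £^πE`, `i(u, v) = (0, v^∨_u)`, on sections. -/
def iMap (σ : PullbackSection F E) : AmbientSection EM F E := fun u => (0, vertLift EM u (σ u))

/-- The map `j : £^πE → π^*E` on sections. -/
def jMap (ζ : AmbientSection EM F E) : PullbackSection F E := fun u => (ζ u).1

/-- The inverse of `i` on vertical sections. -/
def iInv (ζ : AmbientSection EM F E) : PullbackSection F E := fun u => vertLiftInv u (ζ u).2

/-- The vertical endomorphism `J = i ∘ j`. -/
def vertEndo (ζ : AmbientSection EM F E) : AmbientSection EM F E := iMap (jMap ζ)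

variable (EM F E) in
/-- The Liouville section `C = i ∘ δ`, `δ(u) = (u, u)`. -/
def liouville : AmbientSection EM F E := iMap (fun u => u.snd)

/-- The vertical lift `η^V` of a section of `E`. -/
def verticalLift (η : Cₛ^∞⟮𝓘(ℝ, EM); F, E⟯) : AmbientSection EM F E :=
  fun u => (0, vertLift EM u (η u.proj))

/-- The image `s_*(w)` in `T_u E` of a tangent vector `w` at `π(u)` under a section `s` of `E`
through `u`. -/
def pushforwardThrough (s : Cₛ^∞⟮𝓘(ℝ, EM); F, E⟯) (u : TotalSpace F E) (_hs : s u.proj = u.snd)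
    (w : TangentSpace 𝓘(ℝ, EM) u.proj) : TangentSpace (𝓘(ℝ, EM).prod 𝓘(ℝ, F)) u :=
  (mfderiv 𝓘(ℝ, EM) (𝓘(ℝ, EM).prod 𝓘(ℝ, F)) (fun y : M => (⟨y, s y⟩ : TotalSpace F E)) u.proj w :
    EM × F)

namespace LieAlgebroid

/-- The fibre at `u` of the prolongation `£^πE`: the pairs `(e, z)` in `E_{π(u)} × T_u E` with
`ρ(e) = π_*(z)`. -/
def prolongation (A : LieAlgebroid EM F E) (u : TotalSpace F E) :
    Set (E u.proj × TangentSpace (𝓘(ℝ, EM).prod 𝓘(ℝ, F)) u) :=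
  {p | A.anchor u.proj p.1 =
    mfderiv (𝓘(ℝ, EM).prod 𝓘(ℝ, F)) 𝓘(ℝ, EM) (TotalSpace.proj : TotalSpace F E → M) u p.2}

/-- `ζ` is a smooth section of the prolongation `£^πE → E`. -/
structure IsProlongationSection (A : LieAlgebroid EM F E) (ζ : AmbientSection EM F E) : Prop where
  mem_prolongation : ∀ u, ζ u ∈ A.prolongation u
  smooth_fst : IsSmoothPullbackSection EM (fun u => (ζ u).1)
  smooth_snd : ContMDiff (𝓘(ℝ, EM).prod 𝓘(ℝ, F)) (𝓘(ℝ, EM).prod 𝓘(ℝ, F)).tangent ∞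
    (fun u => (⟨u, (ζ u).2⟩ : TangentBundle (𝓘(ℝ, EM).prod 𝓘(ℝ, F)) (TotalSpace F E)))

/-- `ζ` is a projectable section of the prolongation: its first component is `X ∘ π` for a
smooth section `X` of `E`. -/
def IsProjectable (A : LieAlgebroid EM F E) (ζ : AmbientSection EM F E) : Prop :=
  A.IsProlongationSection ζ ∧ ∃ X : Cₛ^∞⟮𝓘(ℝ, EM); F, E⟯, ∀ u, (ζ u).1 = X u.proj

variable [FiniteDimensional ℝ EM] [T2Space M]

/-- The Lie algebroid bracket `⟦ξ, ζ⟧` of sections of the prolongation, whose anchor is the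
second projection. The second component is the Lie bracket of vector fields on `E`. For the
first one, let `e_α` be the local frame of `E` constant in the preferred trivialization around
`π(u)`, and write the first components as `ξ^α ê_α` and `ζ^α ê_α`; the value at `u` is
`ξ^α ζ^β [e_α, e_β] + ξ₂(ζ^α) e_α - ζ₂(ξ^α) e_α`. -/
def prolongBracket (A : LieAlgebroid EM F E) (ξ ζ : AmbientSection EM F E) :
    AmbientSection EM F E := fun u =>
  (A.bracket (sectionThrough (ξ u).1) (sectionThrough (ζ u).1) u.proj
      + componentDeriv (fun w => (ζ w).1) u (ξ u).2
      - componentDeriv (fun w => (ξ w).1) u (ζ u).2,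
    VectorField.mlieBracket (𝓘(ℝ, EM).prod 𝓘(ℝ, F)) (fun w => (ξ w).2) (fun w => (ζ w).2) u)

/-- The complete lift `η^c`, a vector field on `E`:
`η^c(u) = s_*(ρ(η)) + [s, η]^∨_u` for any section `s` of `E` through `u`. This is the vector field
which is `π`-projectable on `ρ(η)` and satisfies `η^c(θ̂) = (L_η θ)^` for all sections `θ` of the
dual bundle, where `θ̂(u) = θ_{π(u)}(u)`. -/
def completeLiftField (A : LieAlgebroid EM F E) (η : Cₛ^∞⟮𝓘(ℝ, EM); F, E⟯)
    (u : TotalSpace F E) : TangentSpace (𝓘(ℝ, EM).prod 𝓘(ℝ, F)) u :=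
  pushforwardThrough (sectionThrough u.snd) u (sectionThrough_apply_self u.snd)
      (A.anchor u.proj (η u.proj))
    + vertLift EM u (A.bracket (sectionThrough u.snd) η u.proj)

/-- The complete lift `η^C(u) = (η(π(u)), η^c(u))` to the prolongation. -/
def completeLift (A : LieAlgebroid EM F E) (η : Cₛ^∞⟮𝓘(ℝ, EM); F, E⟯) :
    AmbientSection EM F E :=
  fun u => (η u.proj, A.completeLiftField η u)

/-- A spray: a smooth section `S` of the prolongation with `J S = C` and `⟦C, S⟧ = S`. -/
structure IsSpray (A : LieAlgebroid EM F E) (S : AmbientSection EM F E) : Prop where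
  isSection : A.IsProlongationSection S
  semispray : vertEndo S = liouville EM F E
  homogeneous : A.prolongBracket (liouville EM F E) S = S

/-- A Lie symmetry of `S`: a section `η` of `E` with `⟦S, η^C⟧ = 0`. -/
def IsLieSymmetry (A : LieAlgebroid EM F E) (S : AmbientSection EM F E)
    (η : Cₛ^∞⟮𝓘(ℝ, EM); F, E⟯) : Prop :=
  A.prolongBracket S (A.completeLift η) = 0

/-- The Berwald connection of `S`: the `C^∞(E)`-linear map `ℋ` from sections of `π^*E` to sections
of the prolongation with `ℋ η̂ = (1/2) (η^C + ⟦η^V, S⟧)` for all sections `η` of `E`. By linearity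
`(ℋ σ)(u)` is `(ℋ η̂)(u)` for any section `η` of `E` through `σ(u)`. -/
def berwald (A : LieAlgebroid EM F E) (S : AmbientSection EM F E) (σ : PullbackSection F E) :
    AmbientSection EM F E := fun u =>
  (1 / 2 : ℝ) • (A.completeLift (sectionThrough (σ u)) u
    + A.prolongBracket (verticalLift (sectionThrough (σ u))) S u)

/-- The vertical map `𝒱 = i⁻¹ ∘ (1 - h)` of the Berwald connection, where `h = ℋ ∘ j`. -/
def vertMap (A : LieAlgebroid EM F E) (S : AmbientSection EM F E) (ζ : AmbientSection EM F E) :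
    PullbackSection F E :=
  iInv (ζ - A.berwald S (jMap ζ))

/-- The vertical derivative `∇^v_σ τ = j ⟦i σ, ℋ τ⟧`. -/
def vertDeriv (A : LieAlgebroid EM F E) (S : AmbientSection EM F E) (σ τ : PullbackSection F E) :
    PullbackSection F E :=
  jMap (A.prolongBracket (iMap σ) (A.berwald S τ))

/-- The vertical differential of a tensor field of type `(1, k)` on `π^*E`:
`(∇^v T)(σ, τ₁, …, τ_k) = ∇^v_σ (T(τ₁, …, τ_k)) - ∑ T(τ₁, …, ∇^v_σ τ_i, …, τ_k)`. -/
def vertDifferential (A : LieAlgebroid EM F E) (S : AmbientSection EM F E) {k : ℕ}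
    (T : (Fin k → PullbackSection F E) → PullbackSection F E)
    (a : Fin (k + 1) → PullbackSection F E) : PullbackSection F E :=
  A.vertDeriv S (a 0) (T (Fin.tail a))
    - ∑ i, T (Function.update (Fin.tail a) i (A.vertDeriv S (a 0) (Fin.tail a i)))

/-- The Jacobi endomorphism `K(σ) = 𝒱 ⟦S, ℋ σ⟧`. -/
def jacobiEndomorphism (A : LieAlgebroid EM F E) (S : AmbientSection EM F E)
    (a : Fin 1 → PullbackSection F E) : PullbackSection F E :=
  A.vertMap S (A.prolongBracket S (A.berwald S (a 0)))

/-- The fundamental affine curvature `R(σ, τ) = (1/3) (∇^v K(τ, σ) - ∇^v K(σ, τ))`. -/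
def fundamentalAffineCurvature (A : LieAlgebroid EM F E) (S : AmbientSection EM F E)
    (a : Fin 2 → PullbackSection F E) : PullbackSection F E :=
  (1 / 3 : ℝ) • (A.vertDifferential S (A.jacobiEndomorphism S) ![a 1, a 0]
    - A.vertDifferential S (A.jacobiEndomorphism S) ![a 0, a 1])

/-- The affine curvature `H(σ, τ) ϑ = ∇^v R(ϑ, σ, τ)`. -/
def affineCurvature (A : LieAlgebroid EM F E) (S : AmbientSection EM F E)
    (a : Fin 3 → PullbackSection F E) : PullbackSection F E :=
  A.vertDifferential S (A.fundamentalAffineCurvature S) ![a 2, a 0, a 1]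

/-- The Lie derivation along `π` with respect to a projectable section `ξ`, on sections of `π^*E`:
`i⁻¹ ⟦ξ, i σ⟧`. -/
def lieDeriv (A : LieAlgebroid EM F E) (ξ : AmbientSection EM F E) (σ : PullbackSection F E) :
    PullbackSection F E :=
  iInv (A.prolongBracket ξ (iMap σ))

/-- The Lie derivation along `π` of a tensor field of type `(1, k)` on `π^*E`. -/
def lieDerivTensor (A : LieAlgebroid EM F E) (ξ : AmbientSection EM F E) {k : ℕ}
    (T : (Fin k → PullbackSection F E) → PullbackSection F E)
    (a : Fin k → PullbackSection F E) : PullbackSection F E :=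
  A.lieDeriv ξ (T a) - ∑ i, T (Function.update a i (A.lieDeriv ξ (a i)))

/-- `ξ` is a curvature collineation of the tensor field `T` of type `(1, k)` on `π^*E`: it is a
projectable section of the prolongation, and the Lie derivation along `ξ` kills `T`. -/
def IsCurvatureCollineation (A : LieAlgebroid EM F E) (ξ : AmbientSection EM F E) {k : ℕ}
    (T : (Fin k → PullbackSection F E) → PullbackSection F E) : Prop :=
  A.IsProjectable ξ ∧
    ∀ a : Fin k → PullbackSection F E, (∀ i, IsSmoothPullbackSection EM (a i)) →
      A.lieDerivTensor ξ T a = 0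

end LieAlgebroid

end Algebroid

end

/-!
A Lie symmetry `η` of the spray `S` preserves every ingredient from which the curvatures of `S` are
built, and it acts on all of them by the Leibniz rule; so it annihilates the curvatures.

The action is the bracket with the complete lift `η^C`. On sections of `π^*E` it is expressed by
`LieAlgebroid.lieAlong`, the Lie derivative which maps `f (ξ ∘ π)` to
`f ([η, ξ] ∘ π) + η^c(f) (ξ ∘ π)`; `lieDeriv_completeLift` identifies it with the derivative
`σ ↦ i⁻¹ ⟦η^C, i σ⟧`. Four facts about `η^C` hold for every section `η`:

* the bracket with `η^C` commutes with `j` (`prolongBracket_completeLift_fst`) and with `i`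
  (`prolongBracket_completeLift_iMap`);
* it is a derivation of the bracket of the prolongation
  (`prolongBracket_completeLift_prolongBracket`);
* complete lifts are closed under the bracket, `⟦η^C, ξ^C⟧ = [η, ξ]^C`
  (`prolongBracket_completeLift_completeLift`);
* consequently `⟦η^C, ξ^V⟧ = [η, ξ]^V` (`prolongBracket_completeLift_verticalLift`).

If moreover `⟦η^C, S⟧ = 0`, then `η^C` maps `ξ^C + ⟦ξ^V, S⟧` to `[η, ξ]^C + ⟦[η, ξ]^V, S⟧`, that is,
it commutes with the Berwald connection (`prolongBracket_completeLift_berwald`). This uses that the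
connection is tensorial (`berwaldLift_eq_zero`), hence given near each point by
`ℋ (∑ fᵢ (sᵢ ∘ π)) = ∑ fᵢ ℋ (sᵢ ∘ π)`. Therefore `η` commutes with the vertical map `𝒱`
(`lieAlong_vertMap`) and obeys the Leibniz rule for the vertical derivative `∇^v`
(`lieAlong_vertDeriv`).

The conclusion is then formal. Multi-additive operators on which `η` acts by the Leibniz rule
(`LieAlgebroid.IsInvariant`) are closed under differences, multiples, permutations of the arguments
and the vertical differential. The Jacobi endomorphism is such an operator, and the two affine
curvatures arise from it by these operations.

The facts about `η^C` are local and are computed in a `LocalFrame`: finitely many global sections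
`sᵢ` which form a frame over an open set, with globally defined smooth coefficient functions. A
tangent vector of the total space is determined by its projection to the base and by the derivatives
of the fibre coordinates `yᵢ` along it, and the complete lift is governed by the identity
`∑ yᵢ [η, sᵢ] + ∑ η^c(yᵢ) sᵢ = 0` (`completeLiftField_coord`).
-/

/-! ### Vector fields as derivations -/

section VectorFields

open VectorField

variable {E' : Type*} [NormedAddCommGroup E'] [NormedSpace ℝ E']
  {H : Type*} [TopologicalSpace H] {I : ModelWithCorners ℝ E' H}
  {N : Type*} [TopologicalSpace N] [ChartedSpace H N] [IsManifold I ∞ N]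
  {G : Type*} [NormedAddCommGroup G] [NormedSpace ℝ G]

omit [IsManifold I ∞ N] in
theorem Filter.EventuallyEq.mvfderiv_eq {f g : N → G} {x : N} (h : f =ᶠ[𝓝 x] g) :
    mvfderiv I f x = mvfderiv I g x := by
  ext z
  change mfderiv I 𝓘(ℝ, G) f x z = mfderiv I 𝓘(ℝ, G) g x z
  rw [h.mfderiv_eq]
  rfl

theorem ContMDiffAt.mvfderiv_apply {f : N → G} {V : Π x : N, TangentSpace I x} {x : N}
    (hf : ContMDiff I 𝓘(ℝ, G) ∞ f) (hV : CMDiffAt ∞ (T% V) x) :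
    ContMDiffAt I 𝓘(ℝ, G) ∞ (fun y => mvfderiv I f y (V y)) x := by
  have h1 : ContMDiff I.tangent 𝓘(ℝ, G).tangent ∞ (tangentMap I 𝓘(ℝ, G) f) :=
    hf.contMDiff_tangentMap (m := ∞) (by simp)
  exact ((contMDiff_snd_tangentBundle_modelSpace G 𝓘(ℝ, G)).contMDiffAt (n := ∞)).comp x
    (h1.contMDiffAt.comp x hV)

theorem ContMDiff.mvfderiv_apply {f : N → G} {V : Π x : N, TangentSpace I x}
    (hf : ContMDiff I 𝓘(ℝ, G) ∞ f) (hV : CMDiff ∞ (T% V)) :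
    ContMDiff I 𝓘(ℝ, G) ∞ (fun y => mvfderiv I f y (V y)) :=
  fun x => ContMDiffAt.mvfderiv_apply hf (hV x)

theorem ContMDiffAt.mdiffAt_vectorField {V : Π x : N, TangentSpace I x} {x : N}
    (hV : CMDiffAt ∞ (T% V) x) : MDiffAt (T% V) x :=
  hV.mdifferentiableAt (by simp)

theorem ContMDiff.mdiffAt_vectorField {V : Π x : N, TangentSpace I x}
    (hV : CMDiff ∞ (T% V)) (x : N) : MDiffAt (T% V) x :=
  (hV x).mdifferentiableAt (by simp)

omit [IsManifold I ∞ N] in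
theorem ContMDiffAt.eventually_mdifferentiableAt [IsManifold I 1 N]
    {E₂ : Type*} [NormedAddCommGroup E₂] [NormedSpace ℝ E₂]
    {H₂ : Type*} [TopologicalSpace H₂] {I₂ : ModelWithCorners ℝ E₂ H₂}
    {N₂ : Type*} [TopologicalSpace N₂] [ChartedSpace H₂ N₂] [IsManifold I₂ 1 N₂]
    {f : N → N₂} {x : N}
    (hf : ContMDiffAt I I₂ ∞ f x) : ∀ᶠ y in 𝓝 x, MDifferentiableAt I I₂ f y := by
  have h : ContMDiffAt I I₂ 1 f x := hf.of_le (by simp)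
  filter_upwards [(contMDiffAt_iff_contMDiffAt_nhds (by simp)).1 h] with y hy
  exact hy.mdifferentiableAt (by simp)

/-- The Lie bracket of vector fields acts on functions as the commutator. Comparing the Jacobi
identities for `V, W, U` and for `V, W, f U` leaves exactly this identity times `U`, and `U` can
be chosen not to vanish at the given point. -/
theorem mvfderiv_mlieBracket [CompleteSpace E'] {V W : Π x : N, TangentSpace I x} {f : N → ℝ}
    (hV : CMDiff ∞ (T% V)) (hW : CMDiff ∞ (T% W)) (hf : ContMDiff I 𝓘(ℝ, ℝ) ∞ f) (x : N) :
    mvfderiv I f x (mlieBracket I V W x) =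
      mvfderiv I (fun y => mvfderiv I f y (W y)) x (V x)
        - mvfderiv I (fun y => mvfderiv I f y (V y)) x (W x) := by
  have : IsManifold I (minSmoothness ℝ 3) N := by
    rw [minSmoothness_of_isRCLikeNormedField]
    exact IsManifold.of_le (n := ∞) (WithTop.coe_le_coe.2 le_top)
  have : IsManifold I (minSmoothness ℝ 2) N := by
    rw [minSmoothness_of_isRCLikeNormedField]
    exact IsManifold.of_le (n := ∞) (WithTop.coe_le_coe.2 le_top)
  have : IsManifold I (((⊤ : ℕ∞) : ℕ∞ω) + 1) N := by
    exact IsManifold.of_le (n := ∞) (by simp)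
  -- a vector field `U` with `U x ≠ 0` exists only if the tangent space is nonzero
  by_cases hT : ∀ z : TangentSpace I x, z = 0
  · rw [hT (mlieBracket I V W x), hT (V x), hT (W x)]; simp
  push Not at hT
  obtain ⟨z, hz⟩ := hT
  set U : Π x : N, TangentSpace I x := FiberBundle.extend E' z with hUdef
  have hUx : U x = z := FiberBundle.extend_apply_self E' z
  have hU : CMDiffAt ∞ (T% U) x := FiberBundle.contMDiffAt_extend I E' z
  have hle : minSmoothness ℝ 2 ≤ ((⊤ : ℕ∞) : ℕ∞ω) := by
    rw [minSmoothness_of_isRCLikeNormedField]; exact WithTop.coe_le_coe.2 le_top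
  have hfU : CMDiffAt ∞ (T% (f • U)) x := (hf x).smul_section hU
  have J1 := leibniz_identity_mlieBracket_apply ((hV x).of_le hle) ((hW x).of_le hle)
    (hfU.of_le hle)
  have J2 := leibniz_identity_mlieBracket_apply ((hV x).of_le hle) ((hW x).of_le hle)
    (hU.of_le hle)
  have hfd : ∀ y, MDiffAt f y := fun y => (hf y).mdifferentiableAt (by simp)
  have hUe : ∀ᶠ y in 𝓝 x, MDiffAt (T% U) y := hU.eventually_mdifferentiableAt
  have key : ∀ Y : Π x : N, TangentSpace I x, mlieBracket I Y (f • U) =ᶠ[𝓝 x]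
      (fun y => mvfderiv I f y (Y y)) • U + f • mlieBracket I Y U := by
    intro Y
    filter_upwards [hUe] with y hy
    exact mlieBracket_smul_right (hfd y) hy
  have hbr : ∀ Y : Π x : N, TangentSpace I x, CMDiff ∞ (T% Y) →
      CMDiffAt ∞ (T% (mlieBracket I Y U)) x := fun Y hY =>
    ContMDiffAt.mlieBracket_vectorField (n := ⊤) (m := ⊤) (hY x) hU
      (by rw [minSmoothness_of_isRCLikeNormedField]; simp)
  have expand : ∀ X Y : Π x : N, TangentSpace I x, CMDiff ∞ (T% Y) →
      mlieBracket I X (mlieBracket I Y (f • U)) x =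
        (mvfderiv I (fun y => mvfderiv I f y (Y y)) x (X x) • U x
          + mvfderiv I f x (Y x) • mlieBracket I X U x)
        + (mvfderiv I f x (X x) • mlieBracket I Y U x
          + f x • mlieBracket I X (mlieBracket I Y U) x) := by
    intro X Y hY
    have hYf := ContMDiffAt.mvfderiv_apply hf (hY x)
    rw [(EventuallyEq.refl _ X).mlieBracket_vectorField_eq (key Y),
      mlieBracket_add_right, mlieBracket_smul_right, mlieBracket_smul_right]
    · exact hfd x
    · exact (hbr Y hY).mdiffAt_vectorField
    · exact hYf.mdifferentiableAt (by simp)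
    · exact hU.mdiffAt_vectorField
    · exact (hYf.smul_section hU).mdiffAt_vectorField
    · exact ((hf x).smul_section (hbr Y hY)).mdiffAt_vectorField
  rw [expand V W hW, expand W V hV, mlieBracket_smul_right (hfd x) hU.mdiffAt_vectorField, J2] at J1
  have h3 : (mvfderiv I f x (mlieBracket I V W x)
      - (mvfderiv I (fun y => mvfderiv I f y (W y)) x (V x)
        - mvfderiv I (fun y => mvfderiv I f y (V y)) x (W x))) • U x = 0 := by
    rw [smul_add] at J1
    rw [sub_smul, sub_smul]
    rw [← sub_eq_zero] at J1
    rw [← neg_eq_zero, ← J1]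
    abel
  rw [hUx] at h3
  exact sub_eq_zero.1 ((smul_eq_zero.1 h3).resolve_right hz)

end VectorFields

section Detection

variable {EM : Type*} [NormedAddCommGroup EM] [NormedSpace ℝ EM] [FiniteDimensional ℝ EM]
  {M : Type*} [TopologicalSpace M] [T2Space M] [ChartedSpace EM M] [IsManifold 𝓘(ℝ, EM) ∞ M]

/-- Global smooth functions separate the tangent vectors at a point. -/
theorem tangentSpace_ext_mvfderiv {x : M} {z z' : TangentSpace 𝓘(ℝ, EM) x}
    (h : ∀ f : C^∞⟮𝓘(ℝ, EM), M; 𝓘(ℝ, ℝ), ℝ⟯, mvfderiv 𝓘(ℝ, EM) f x z = mvfderiv 𝓘(ℝ, EM) f x z') :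
    z = z' := by
  have hinj : Function.Injective (mfderiv 𝓘(ℝ, EM) 𝓘(ℝ, EM) (extChartAt 𝓘(ℝ, EM) x) x) :=
    (isInvertible_mfderiv_extChartAt (I := 𝓘(ℝ, EM)) (mem_extChartAt_source x)).injective
  apply hinj
  change mvfderiv 𝓘(ℝ, EM) (extChartAt 𝓘(ℝ, EM) x) x z
    = mvfderiv 𝓘(ℝ, EM) (extChartAt 𝓘(ℝ, EM) x) x z'
  obtain ⟨χ⟩ : Nonempty (SmoothBumpFunction 𝓘(ℝ, EM) x) := inferInstance
  have hg : ContMDiff 𝓘(ℝ, EM) 𝓘(ℝ, EM) ∞ (fun y => χ y • extChartAt 𝓘(ℝ, EM) x y) :=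
    χ.contMDiff_smul (contMDiffOn_extChartAt)
  have heq : (extChartAt 𝓘(ℝ, EM) x : M → EM) =ᶠ[𝓝 x]
      (fun y => χ y • extChartAt 𝓘(ℝ, EM) x y) := by
    filter_upwards [χ.eventuallyEq_one] with y hy
    simp [hy]
  have hd : mvfderiv 𝓘(ℝ, EM) (extChartAt 𝓘(ℝ, EM) x) x
      = mvfderiv 𝓘(ℝ, EM) (fun y => χ y • extChartAt 𝓘(ℝ, EM) x y) x := by
    exact heq.mvfderiv_eq
  rw [hd]
  refine (Module.finBasis ℝ EM).ext_elem fun i => ?_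
  let ℓ : EM →L[ℝ] ℝ := LinearMap.toContinuousLinearMap ((Module.finBasis ℝ EM).coord i)
  have := h ⟨_, ℓ.contDiff.contMDiff.comp hg⟩
  have hc : ∀ w, mvfderiv 𝓘(ℝ, EM) (ℓ ∘ fun y => χ y • extChartAt 𝓘(ℝ, EM) x y) x w
      = ℓ (mvfderiv 𝓘(ℝ, EM) (fun y => χ y • extChartAt 𝓘(ℝ, EM) x y) x w) := by
    intro w
    rw [mvfderiv, ContinuousLinearMap.comp_apply, mfderiv_comp x
      (ℓ.contMDiff (n := 1) _|>.mdifferentiableAt (by simp)) ((hg x).mdifferentiableAt (by simp))]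
    rw [mfderiv_eq_fderiv, ℓ.fderiv]
    rfl
  rw [ContMDiffMap.coeFn_mk, hc, hc] at this
  exact this

end Detection

/-! ### Sections of the pullback bundle -/

section PullbackSections

set_option linter.unusedSectionVars false

variable {EM : Type*} [NormedAddCommGroup EM] [NormedSpace ℝ EM]
  {M : Type*} [TopologicalSpace M] [ChartedSpace EM M] [IsManifold 𝓘(ℝ, EM) ∞ M]
  {F : Type*} [NormedAddCommGroup F] [NormedSpace ℝ F]
  {E : M → Type*} [TopologicalSpace (TotalSpace F E)]
  [∀ x, AddCommGroup (E x)] [∀ x, Module ℝ (E x)] [∀ x, TopologicalSpace (E x)]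
  [FiberBundle F E] [VectorBundle ℝ F E] [ContMDiffVectorBundle ∞ F E 𝓘(ℝ, EM)]

local notation "𝓑" => 𝓘(ℝ, EM)
local notation "𝓣" => ModelWithCorners.prod 𝓘(ℝ, EM) 𝓘(ℝ, F)

theorem trivializationAt_snd_add {x₀ x : M} (hx : x ∈ (trivializationAt F E x₀).baseSet)
    (v w : E x) : (trivializationAt F E x₀ ⟨x, v + w⟩).2
      = (trivializationAt F E x₀ ⟨x, v⟩).2 + (trivializationAt F E x₀ ⟨x, w⟩).2 :=
  ((trivializationAt F E x₀).linear ℝ hx).map_add v w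

theorem trivializationAt_snd_smul {x₀ x : M} (hx : x ∈ (trivializationAt F E x₀).baseSet)
    (c : ℝ) (v : E x) : (trivializationAt F E x₀ ⟨x, c • v⟩).2
      = c • (trivializationAt F E x₀ ⟨x, v⟩).2 :=
  ((trivializationAt F E x₀).linear ℝ hx).map_smul c v

theorem trivializationAt_symm_add {x₀ x : M} (hx : x ∈ (trivializationAt F E x₀).baseSet)
    (a b : F) : (trivializationAt F E x₀).symm x (a + b)
      = (trivializationAt F E x₀).symm x a + (trivializationAt F E x₀).symm x b := by
  rw [← Trivialization.coe_symmₗ (R := ℝ) _ hx, map_add]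

theorem trivializationAt_symm_smul {x₀ x : M} (hx : x ∈ (trivializationAt F E x₀).baseSet)
    (c : ℝ) (a : F) : (trivializationAt F E x₀).symm x (c • a)
      = c • (trivializationAt F E x₀).symm x a := by
  rw [← Trivialization.coe_symmₗ (R := ℝ) _ hx, map_smul]

theorem eventually_proj_mem_baseSet (u : TotalSpace F E) :
    ∀ᶠ w in 𝓝 u, w.proj ∈ (trivializationAt F E u.proj).baseSet :=
  (FiberBundle.continuous_proj F E).continuousAt.eventually
    ((trivializationAt F E u.proj).open_baseSet.mem_nhds (mem_baseSet_trivializationAt F E u.proj))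

theorem isSmoothPullbackSection_iff {σ : PullbackSection F E} :
    IsSmoothPullbackSection EM σ ↔ ∀ u : TotalSpace F E,
      ContMDiffAt 𝓣 𝓘(ℝ, F) ∞
        (fun w : TotalSpace F E => (trivializationAt F E u.proj ⟨w.proj, σ w⟩).2) u := by
  refine forall_congr' fun u => ?_
  rw [Bundle.contMDiffAt_totalSpace]
  exact and_iff_right (Bundle.contMDiffAt_proj E)

theorem IsSmoothPullbackSection.contMDiffAt_snd {σ : PullbackSection F E}
    (hσ : IsSmoothPullbackSection EM σ) {x₀ : M} {u : TotalSpace F E}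
    (hu : u.proj ∈ (trivializationAt F E x₀).baseSet) :
    ContMDiffAt 𝓣 𝓘(ℝ, F) ∞
      (fun w : TotalSpace F E => (trivializationAt F E x₀ ⟨w.proj, σ w⟩).2) u := by
  have hmem : (⟨u.proj, σ u⟩ : TotalSpace F E) ∈ (trivializationAt F E x₀).source :=
    (trivializationAt F E x₀).mem_source.2 hu
  have h := ((trivializationAt F E x₀).contMDiffOn (n := ∞) (IB := 𝓑)).contMDiffAt
    ((trivializationAt F E x₀).open_source.mem_nhds hmem)
  exact (h.comp u (hσ u)).snd

theorem IsSmoothPullbackSection.mdifferentiableAt_snd {σ : PullbackSection F E}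
    (hσ : IsSmoothPullbackSection EM σ) (u : TotalSpace F E) :
    MDifferentiableAt 𝓣 𝓘(ℝ, F)
      (fun w : TotalSpace F E => (trivializationAt F E u.proj ⟨w.proj, σ w⟩).2) u :=
  (isSmoothPullbackSection_iff.1 hσ u).mdifferentiableAt (by simp)

theorem isSmoothPullbackSection_snd :
    IsSmoothPullbackSection EM (fun u : TotalSpace F E => u.snd) :=
  contMDiff_id

theorem isSmoothPullbackSection_comp_proj (s : Cₛ^∞⟮𝓑; F, E⟯) :
    IsSmoothPullbackSection EM (fun u : TotalSpace F E => s u.proj) :=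
  s.contMDiff.comp (Bundle.contMDiff_proj E)

theorem isSmoothPullbackSection_of_eventuallyEq {σ : PullbackSection F E}
    (h : ∀ u, ∃ τ, IsSmoothPullbackSection EM τ ∧ ∀ᶠ w in 𝓝 u, σ w = τ w) :
    IsSmoothPullbackSection EM σ := by
  intro u
  obtain ⟨τ, hτ, he⟩ := h u
  exact (hτ u).congr_of_eventuallyEq (he.mono fun w hw => by simp only [hw])

theorem IsSmoothPullbackSection.add {σ τ : PullbackSection F E}
    (hσ : IsSmoothPullbackSection EM σ) (hτ : IsSmoothPullbackSection EM τ) :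
    IsSmoothPullbackSection EM (σ + τ) := by
  refine isSmoothPullbackSection_iff.2 fun u => ?_
  refine ((isSmoothPullbackSection_iff.1 hσ u).add
    (isSmoothPullbackSection_iff.1 hτ u)).congr_of_eventuallyEq ?_
  filter_upwards [eventually_proj_mem_baseSet u] with w hw
  exact trivializationAt_snd_add hw _ _

theorem IsSmoothPullbackSection.smul {f : TotalSpace F E → ℝ} {σ : PullbackSection F E}
    (hf : ContMDiff 𝓣 𝓘(ℝ, ℝ) ∞ f) (hσ : IsSmoothPullbackSection EM σ) :
    IsSmoothPullbackSection EM (fun w => f w • σ w) := by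
  refine isSmoothPullbackSection_iff.2 fun u => ?_
  refine ((hf u).smul (isSmoothPullbackSection_iff.1 hσ u)).congr_of_eventuallyEq ?_
  filter_upwards [eventually_proj_mem_baseSet u] with w hw
  exact trivializationAt_snd_smul hw _ _

theorem IsSmoothPullbackSection.const_smul (c : ℝ) {σ : PullbackSection F E}
    (hσ : IsSmoothPullbackSection EM σ) : IsSmoothPullbackSection EM (c • σ) :=
  IsSmoothPullbackSection.smul contMDiff_const hσ

theorem IsSmoothPullbackSection.sub {σ τ : PullbackSection F E}
    (hσ : IsSmoothPullbackSection EM σ) (hτ : IsSmoothPullbackSection EM τ) :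
    IsSmoothPullbackSection EM (σ - τ) := by
  have := hσ.add (hτ.const_smul (-1))
  rwa [neg_one_smul, ← sub_eq_add_neg] at this

theorem isSmoothPullbackSection_zero :
    IsSmoothPullbackSection EM (0 : PullbackSection F E) :=
  isSmoothPullbackSection_comp_proj (0 : Cₛ^∞⟮𝓑; F, E⟯)

theorem isSmoothPullbackSection_sum {ι : Type*} (t : Finset ι) {σ : ι → PullbackSection F E}
    (hσ : ∀ i ∈ t, IsSmoothPullbackSection EM (σ i)) :
    IsSmoothPullbackSection EM (∑ i ∈ t, σ i) :=
  Finset.sum_induction _ (IsSmoothPullbackSection EM) (fun _ _ => .add)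
    isSmoothPullbackSection_zero hσ

theorem isSmoothPullbackSection_sum_smul {ι : Type*} [Fintype ι]
    {f : ι → TotalSpace F E → ℝ} (hf : ∀ i, ContMDiff 𝓣 𝓘(ℝ, ℝ) ∞ (f i))
    (s : ι → Cₛ^∞⟮𝓑; F, E⟯) :
    IsSmoothPullbackSection EM (fun w : TotalSpace F E => ∑ i, f i w • s i w.proj) := by
  have := isSmoothPullbackSection_sum Finset.univ (σ := fun i w => f i w • s i w.proj)
    fun i _ => (isSmoothPullbackSection_comp_proj (s i)).smul (hf i)
  convert this using 1
  ext w
  simp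

/-! ### Differentiation of components -/

section ComponentDeriv

variable {u : TotalSpace F E} {σ τ : PullbackSection F E}

theorem componentDeriv_add_right (z z' : TangentSpace 𝓣 u) :
    componentDeriv (EM := EM) σ u (z + z')
      = componentDeriv (EM := EM) σ u z + componentDeriv (EM := EM) σ u z' := by
  rw [componentDeriv, map_add, trivializationAt_symm_add (mem_baseSet_trivializationAt F E u.proj)]
  rfl

theorem componentDeriv_smul_right (c : ℝ) (z : TangentSpace 𝓣 u) :
    componentDeriv (EM := EM) σ u (c • z) = c • componentDeriv (EM := EM) σ u z := by
  rw [componentDeriv, map_smul,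
    trivializationAt_symm_smul (mem_baseSet_trivializationAt F E u.proj)]
  rfl

theorem componentDeriv_zero_right : componentDeriv (EM := EM) σ u (0 : TangentSpace 𝓣 u) = 0 := by
  simpa using componentDeriv_smul_right (σ := σ) 0 (0 : TangentSpace 𝓣 u)

theorem componentDeriv_congr {z : TangentSpace 𝓣 u} (h : ∀ᶠ w in 𝓝 u, σ w = τ w) :
    componentDeriv (EM := EM) σ u z = componentDeriv (EM := EM) τ u z := by
  unfold componentDeriv
  rw [Filter.EventuallyEq.mvfderiv_eq (I := 𝓣) (g := fun w : TotalSpace F E =>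
    (trivializationAt F E u.proj ⟨w.proj, τ w⟩).2) (h.mono fun w hw => by simp only [hw])]

theorem componentDeriv_add {z : TangentSpace 𝓣 u} (hσ : IsSmoothPullbackSection EM σ)
    (hτ : IsSmoothPullbackSection EM τ) :
    componentDeriv (EM := EM) (fun w => σ w + τ w) u z
      = componentDeriv (EM := EM) σ u z + componentDeriv (EM := EM) τ u z := by
  unfold componentDeriv
  rw [← trivializationAt_symm_add (mem_baseSet_trivializationAt F E u.proj),
    ← _root_.add_apply,
    ← mvfderiv_add (hσ.mdifferentiableAt_snd u) (hτ.mdifferentiableAt_snd u)]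
  rw [Filter.EventuallyEq.mvfderiv_eq (I := 𝓣) (g := (fun w : TotalSpace F E =>
    (trivializationAt F E u.proj ⟨w.proj, σ w⟩).2) +
      fun w : TotalSpace F E => (trivializationAt F E u.proj ⟨w.proj, τ w⟩).2)]
  filter_upwards [eventually_proj_mem_baseSet u] with w hw
  exact trivializationAt_snd_add hw _ _

theorem componentDeriv_smul {f : TotalSpace F E → ℝ} {z : TangentSpace 𝓣 u}
    (hf : MDifferentiableAt 𝓣 𝓘(ℝ, ℝ) f u) (hσ : IsSmoothPullbackSection EM σ) :
    componentDeriv (EM := EM) (fun w => f w • σ w) u z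
      = mvfderiv 𝓣 f u z • σ u + f u • componentDeriv (EM := EM) σ u z := by
  unfold componentDeriv
  rw [Filter.EventuallyEq.mvfderiv_eq (I := 𝓣) (g := f • (fun w : TotalSpace F E =>
    (trivializationAt F E u.proj ⟨w.proj, σ w⟩).2)), mvfderiv_smul hf (hσ.mdifferentiableAt_snd u),
    ← trivializationAt_symm_smul (mem_baseSet_trivializationAt F E u.proj)]
  · simp only [_root_.add_apply, _root_.smul_apply,
      ContinuousLinearMap.smulRight_apply]
    rw [trivializationAt_symm_add (mem_baseSet_trivializationAt F E u.proj), add_comm]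
    congr 1
    rw [trivializationAt_symm_smul (mem_baseSet_trivializationAt F E u.proj)]
    congr 1
    exact (trivializationAt F E u.proj).symm_apply_apply_mk
      (mem_baseSet_trivializationAt F E u.proj) _
  · filter_upwards [eventually_proj_mem_baseSet u] with w hw
    exact trivializationAt_snd_smul hw _ _

theorem componentDeriv_zero (u : TotalSpace F E) (z : TangentSpace 𝓣 u) :
    componentDeriv (EM := EM) (fun w : TotalSpace F E => (0 : E w.proj)) u z = 0 := by
  have h := componentDeriv_smul (u := u) (z := z) (f := fun _ => 0) (σ := 0)
    mdifferentiableAt_const isSmoothPullbackSection_zero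
  simpa using h

theorem componentDeriv_sum {z : TangentSpace 𝓣 u} {ι : Type*} (t : Finset ι)
    {σ : ι → PullbackSection F E}
    (hσ : ∀ i, IsSmoothPullbackSection EM (σ i)) :
    componentDeriv (EM := EM) (fun w => ∑ i ∈ t, σ i w) u z
      = ∑ i ∈ t, componentDeriv (EM := EM) (σ i) u z := by
  classical
  induction t using Finset.induction_on with
  | empty => simpa using componentDeriv_zero u z
  | insert a t ha ih =>
    simp only [Finset.sum_insert ha]
    rw [← ih, ← componentDeriv_add (hσ a)]
    have := isSmoothPullbackSection_sum t (fun i _ => hσ i)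
    convert this using 1
    ext w
    simp

end ComponentDeriv

/-- The derivative at `x`, in the direction `w`, of the components of a section of `E` in the
preferred trivialization around `x`. -/
noncomputable def baseDeriv (s : Cₛ^∞⟮𝓑; F, E⟯) (x : M) (w : TangentSpace 𝓑 x) : E x :=
  (trivializationAt F E x).symm x
    (mvfderiv 𝓑 (fun y : M => (trivializationAt F E x ⟨y, s y⟩).2) x w)

theorem contMDiffAt_trivializationAt_section (s : Cₛ^∞⟮𝓑; F, E⟯) (x : M) :
    ContMDiffAt 𝓑 𝓘(ℝ, F) ∞ (fun y : M => (trivializationAt F E x ⟨y, s y⟩).2) x :=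
  ((Bundle.contMDiffAt_totalSpace).1 (s.contMDiff x)).2

theorem componentDeriv_comp_proj (s : Cₛ^∞⟮𝓑; F, E⟯) (u : TotalSpace F E)
    (z : TangentSpace 𝓣 u) :
    componentDeriv (fun w : TotalSpace F E => s w.proj) u z
      = baseDeriv s u.proj (mfderiv 𝓣 𝓑 (TotalSpace.proj : TotalSpace F E → M) u z) := by
  unfold componentDeriv baseDeriv
  congr 1
  exact mfderiv_comp_apply u (g := fun y : M => (trivializationAt F E u.proj ⟨y, s y⟩).2)
    ((contMDiffAt_trivializationAt_section s u.proj).mdifferentiableAt (by simp))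
    ((Bundle.contMDiff_proj (n := ∞) E u).mdifferentiableAt (by simp)) z

/-- The derivative of the components of `∑ fᵢ sᵢ ∘ π`, for any sections `sᵢ` of `E`. -/
theorem componentDeriv_sum_smul {ι : Type*} [Fintype ι] {u : TotalSpace F E}
    {σ : PullbackSection F E} {f : ι → TotalSpace F E → ℝ}
    (hf : ∀ i, ContMDiff 𝓣 𝓘(ℝ, ℝ) ∞ (f i)) {s : ι → Cₛ^∞⟮𝓑; F, E⟯}
    (hσ : ∀ᶠ w in 𝓝 u, σ w = ∑ i, f i w • s i w.proj) (z : TangentSpace 𝓣 u) :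
    componentDeriv σ u z = ∑ i, mvfderiv 𝓣 (f i) u z • s i u.proj
      + ∑ i, f i u • baseDeriv (s i) u.proj
          (mfderiv 𝓣 𝓑 (TotalSpace.proj : TotalSpace F E → M) u z) := by
  rw [componentDeriv_congr hσ, componentDeriv_sum Finset.univ
    (σ := fun i w => f i w • s i w.proj)
    (fun i => (isSmoothPullbackSection_comp_proj (s i)).smul (hf i)), ← Finset.sum_add_distrib]
  refine Finset.sum_congr rfl fun i _ => ?_
  rw [componentDeriv_smul ((hf i u).mdifferentiableAt (by simp))
    (isSmoothPullbackSection_comp_proj (s i)), componentDeriv_comp_proj]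

theorem baseDeriv_add_right (s : Cₛ^∞⟮𝓑; F, E⟯) {x : M} (w w' : TangentSpace 𝓑 x) :
    baseDeriv s x (w + w') = baseDeriv s x w + baseDeriv s x w' := by
  rw [baseDeriv, map_add, trivializationAt_symm_add (mem_baseSet_trivializationAt F E x)]
  rfl

theorem baseDeriv_smul_right (s : Cₛ^∞⟮𝓑; F, E⟯) {x : M} (c : ℝ) (w : TangentSpace 𝓑 x) :
    baseDeriv s x (c • w) = c • baseDeriv s x w := by
  rw [baseDeriv, map_smul, trivializationAt_symm_smul (mem_baseSet_trivializationAt F E x)]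
  rfl

/-- `baseDeriv s x`, as a linear map. -/
noncomputable def baseDerivₗ (s : Cₛ^∞⟮𝓑; F, E⟯) (x : M) : TangentSpace 𝓑 x →ₗ[ℝ] E x where
  toFun := baseDeriv s x
  map_add' := baseDeriv_add_right s
  map_smul' := baseDeriv_smul_right s

/-- The section `sectionThrough v` has constant components near the base point. -/
theorem baseDeriv_sectionThrough [FiniteDimensional ℝ EM] [T2Space M] {x : M} (v : E x)
    (w : TangentSpace 𝓑 x) :
    baseDeriv (sectionThrough v : Cₛ^∞⟮𝓑; F, E⟯) x w = 0 := by
  unfold baseDeriv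
  have h := (exists_section_eventuallyEq_extend (EM := EM) (F := F) v).choose_spec
  rw [Filter.EventuallyEq.mvfderiv_eq (g := fun _ : M => (trivializationAt F E x ⟨x, v⟩).2),
    mvfderiv_const]
  · simpa using trivializationAt_symm_smul (mem_baseSet_trivializationAt F E x) 0 0
  · filter_upwards [h, (trivializationAt F E x).open_baseSet.mem_nhds
      (mem_baseSet_trivializationAt F E x)] with y hy hyb
    rw [show (sectionThrough v : Cₛ^∞⟮𝓑; F, E⟯) y = FiberBundle.extend F v y from hy,
      FiberBundle.extend, Trivialization.apply_mk_symm _ hyb]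

end PullbackSections

/-! ### Tangent vectors of the total space -/

section TotalSpaceTangent

set_option linter.unusedSectionVars false

variable {EM : Type*} [NormedAddCommGroup EM] [NormedSpace ℝ EM]
  {M : Type*} [TopologicalSpace M] [ChartedSpace EM M] [IsManifold 𝓘(ℝ, EM) ∞ M]
  {F : Type*} [NormedAddCommGroup F] [NormedSpace ℝ F]
  {E : M → Type*} [TopologicalSpace (TotalSpace F E)]
  [∀ x, AddCommGroup (E x)] [∀ x, Module ℝ (E x)] [∀ x, TopologicalSpace (E x)]
  [FiberBundle F E] [VectorBundle ℝ F E] [ContMDiffVectorBundle ∞ F E 𝓘(ℝ, EM)]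

local notation "𝓑" => 𝓘(ℝ, EM)
local notation "𝓣" => ModelWithCorners.prod 𝓘(ℝ, EM) 𝓘(ℝ, F)

/-- The differential of the bundle projection. -/
noncomputable abbrev projDeriv (u : TotalSpace F E) :
    TangentSpace 𝓣 u →L[ℝ] TangentSpace 𝓑 u.proj :=
  mfderiv 𝓣 𝓑 (TotalSpace.proj : TotalSpace F E → M) u

theorem contMDiff_fibreLine (u : TotalSpace F E) (v : E u.proj) :
    ContMDiff 𝓘(ℝ, ℝ) 𝓣 ∞ (fun t : ℝ => (⟨u.proj, u.snd + t • v⟩ : TotalSpace F E)) := by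
  intro t
  rw [Bundle.contMDiffAt_totalSpace]
  refine ⟨contMDiffAt_const, ?_⟩
  have hx := mem_baseSet_trivializationAt F E u.proj
  have : (fun t : ℝ => (trivializationAt F E u.proj ⟨u.proj, u.snd + t • v⟩).2)
      = fun t => (trivializationAt F E u.proj ⟨u.proj, u.snd⟩).2
        + t • (trivializationAt F E u.proj ⟨u.proj, v⟩).2 := by
    ext t
    rw [trivializationAt_snd_add hx, trivializationAt_snd_smul hx]
  change ContMDiffAt _ _ _ (fun t : ℝ => (trivializationAt F E u.proj ⟨u.proj, u.snd + t • v⟩).2) t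
  rw [this]
  exact (contMDiff_const.add (contMDiff_id.smul contMDiff_const)).contMDiffAt

theorem fibreLine_zero (u : TotalSpace F E) (v : E u.proj) :
    (⟨u.proj, u.snd + (0 : ℝ) • v⟩ : TotalSpace F E) = u := by
  rw [zero_smul, add_zero]

theorem projDeriv_vertLift (u : TotalSpace F E) (v : E u.proj) :
    projDeriv u (vertLift EM u v) = 0 := by
  have h := mfderiv_comp_apply_of_eq (I := 𝓘(ℝ, ℝ)) (I' := 𝓣) (I'' := 𝓑) (0 : ℝ) (y := u)
    (g := (TotalSpace.proj : TotalSpace F E → M))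
    (f := fun t : ℝ => (⟨u.proj, u.snd + t • v⟩ : TotalSpace F E))
    ((Bundle.contMDiff_proj (n := ∞) E u).mdifferentiableAt (by simp))
    ((contMDiff_fibreLine u v 0).mdifferentiableAt (by simp)) (fibreLine_zero u v) (1 : ℝ)
  refine Eq.trans h.symm ?_
  have : (TotalSpace.proj : TotalSpace F E → M) ∘
      (fun t : ℝ => (⟨u.proj, u.snd + t • v⟩ : TotalSpace F E)) = fun _ => u.proj := rfl
  rw [this, mfderiv_const]
  rfl

theorem vertLiftInv_vertLift (u : TotalSpace F E) (v : E u.proj) :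
    vertLiftInv u (vertLift EM u v) = v := by
  have hx := mem_baseSet_trivializationAt F E u.proj
  have h := mfderiv_comp_apply_of_eq (I := 𝓘(ℝ, ℝ)) (I' := 𝓣) (I'' := 𝓘(ℝ, F)) (0 : ℝ) (y := u)
    (g := fun w : TotalSpace F E => (trivializationAt F E u.proj ⟨w.proj, w.snd⟩).2)
    (f := fun t : ℝ => (⟨u.proj, u.snd + t • v⟩ : TotalSpace F E))
    ((isSmoothPullbackSection_snd (EM := EM)).mdifferentiableAt_snd u)
    ((contMDiff_fibreLine u v 0).mdifferentiableAt (by simp)) (fibreLine_zero u v) (1 : ℝ)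
  unfold vertLiftInv componentDeriv
  have h2 : mvfderiv 𝓣 (fun w : TotalSpace F E => (trivializationAt F E u.proj ⟨w.proj, w.snd⟩).2) u
      (vertLift EM u v) = (trivializationAt F E u.proj ⟨u.proj, v⟩).2 := by
    refine Eq.trans h.symm ?_
    have : (fun w : TotalSpace F E => (trivializationAt F E u.proj ⟨w.proj, w.snd⟩).2) ∘
        (fun t : ℝ => (⟨u.proj, u.snd + t • v⟩ : TotalSpace F E))
        = fun t => (trivializationAt F E u.proj ⟨u.proj, u.snd⟩).2
          + t • (trivializationAt F E u.proj ⟨u.proj, v⟩).2 := by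
      ext t
      simp only [Function.comp_apply]
      rw [trivializationAt_snd_add hx, trivializationAt_snd_smul hx]
    rw [this, mfderiv_eq_fderiv]
    have hd : HasDerivAt (fun t : ℝ => (trivializationAt F E u.proj ⟨u.proj, u.snd⟩).2
          + t • (trivializationAt F E u.proj ⟨u.proj, v⟩).2)
        ((1 : ℝ) • (trivializationAt F E u.proj ⟨u.proj, v⟩).2) 0 :=
      ((hasDerivAt_id (0 : ℝ)).smul_const _).const_add _
    have := hd.hasFDerivAt.fderiv
    rw [this, one_smul]
    exact one_smul ℝ _
  rw [h2]
  exact (trivializationAt F E u.proj).symm_apply_apply_mk hx v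

theorem mfderiv_trivializationAt {x₀ : M} {u : TotalSpace F E}
    (hu : u.proj ∈ (trivializationAt F E x₀).baseSet) (z : TangentSpace 𝓣 u) :
    mfderiv 𝓣 𝓣 (trivializationAt F E x₀) u z
      = (projDeriv u z,
        mvfderiv 𝓣 (fun w : TotalSpace F E => (trivializationAt F E x₀ w).2) u z) := by
  have h1 : MDifferentiableAt 𝓣 𝓑 (TotalSpace.proj : TotalSpace F E → M) u :=
    (Bundle.contMDiff_proj (n := ∞) E u).mdifferentiableAt (by simp)
  have h2 : MDifferentiableAt 𝓣 𝓘(ℝ, F)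
      (fun w : TotalSpace F E => (trivializationAt F E x₀ w).2) u :=
    ((isSmoothPullbackSection_snd (EM := EM)).contMDiffAt_snd hu).mdifferentiableAt (by simp)
  have he : (trivializationAt F E x₀ : TotalSpace F E → M × F) =ᶠ[𝓝 u]
      fun w => (w.proj, (trivializationAt F E x₀ w).2) := by
    filter_upwards [(trivializationAt F E x₀).open_source.mem_nhds
      ((trivializationAt F E x₀).mem_source.2 hu)] with w hw
    exact ((trivializationAt F E x₀).mk_proj_snd hw).symm
  rw [he.mfderiv_eq, mfderiv_prodMk h1 h2]
  rfl

/-- A tangent vector of the total space is determined by its projection to the base and its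
vertical component. -/
theorem totalSpace_tangent_ext {u : TotalSpace F E} {z z' : TangentSpace 𝓣 u}
    (h₁ : projDeriv u z = projDeriv u z') (h₂ : vertLiftInv u z = vertLiftInv u z') : z = z' := by
  have hx := mem_baseSet_trivializationAt F E u.proj
  have : IsManifold 𝓑 1 M := IsManifold.of_le (n := ∞) (by simp)
  have : ContMDiffVectorBundle 1 F E 𝓑 := ContMDiffVectorBundle.of_le (n := ∞) (by simp)
  have hinj := ((trivializationAt F E u.proj).mdifferentiable (I := 𝓑)
    (F := F) (Z := E)).mfderiv_injective ((trivializationAt F E u.proj).mem_source.2 hx)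
  apply hinj
  change mfderiv 𝓣 𝓣 (trivializationAt F E u.proj) u z
    = mfderiv 𝓣 𝓣 (trivializationAt F E u.proj) u z'
  rw [mfderiv_trivializationAt hx, mfderiv_trivializationAt hx, h₁]
  congr 1
  have h3 := congrArg (fun v => (trivializationAt F E u.proj ⟨u.proj, v⟩).2) h₂
  simp only [vertLiftInv, componentDeriv] at h3
  rwa [Trivialization.apply_mk_symm _ hx, Trivialization.apply_mk_symm _ hx] at h3

theorem vertLift_vertLiftInv {u : TotalSpace F E} {z : TangentSpace 𝓣 u}
    (hz : projDeriv u z = 0) : vertLift EM u (vertLiftInv u z) = z :=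
  totalSpace_tangent_ext (by rw [hz, projDeriv_vertLift]) (vertLiftInv_vertLift _ _)

theorem vertLiftInv_add {u : TotalSpace F E} (z z' : TangentSpace 𝓣 u) :
    vertLiftInv u (z + z') = vertLiftInv u z + vertLiftInv u z' :=
  componentDeriv_add_right z z'

theorem vertLiftInv_smul {u : TotalSpace F E} (c : ℝ) (z : TangentSpace 𝓣 u) :
    vertLiftInv u (c • z) = c • vertLiftInv u z :=
  componentDeriv_smul_right c z

theorem vertLift_add (u : TotalSpace F E) (v w : E u.proj) :
    vertLift EM u (v + w) = vertLift EM u v + vertLift EM u w := by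
  refine totalSpace_tangent_ext ?_ ?_
  · rw [map_add]; simp only [projDeriv_vertLift, add_zero]
  · simp only [vertLiftInv_add, vertLiftInv_vertLift]

theorem vertLift_smul (u : TotalSpace F E) (c : ℝ) (v : E u.proj) :
    vertLift EM u (c • v) = c • vertLift EM u v := by
  refine totalSpace_tangent_ext ?_ ?_
  · rw [map_smul]; simp only [projDeriv_vertLift, smul_zero]
  · simp only [vertLiftInv_smul, vertLiftInv_vertLift]

theorem vertLift_injective {u : TotalSpace F E} {v w : E u.proj}
    (h : vertLift EM u v = vertLift EM u w) : v = w := by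
  rw [← vertLiftInv_vertLift (EM := EM) u v, h, vertLiftInv_vertLift]

theorem projDeriv_pushforwardThrough (s : Cₛ^∞⟮𝓑; F, E⟯) (u : TotalSpace F E)
    (hs : s u.proj = u.snd) (w : TangentSpace 𝓑 u.proj) :
    projDeriv u (pushforwardThrough s u hs w) = w := by
  have h := mfderiv_comp_apply_of_eq (I := 𝓑) (I' := 𝓣) (I'' := 𝓑) u.proj (y := u)
    (g := (TotalSpace.proj : TotalSpace F E → M))
    (f := fun y : M => (⟨y, s y⟩ : TotalSpace F E))
    ((Bundle.contMDiff_proj (n := ∞) E u).mdifferentiableAt (by simp))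
    ((s.contMDiff u.proj).mdifferentiableAt (by simp)) (by rw [hs]) w
  refine Eq.trans h.symm ?_
  have : (TotalSpace.proj : TotalSpace F E → M) ∘
      (fun y : M => (⟨y, s y⟩ : TotalSpace F E)) = id := rfl
  rw [this, mfderiv_id]
  rfl

theorem vertLiftInv_pushforwardThrough (s : Cₛ^∞⟮𝓑; F, E⟯) (u : TotalSpace F E)
    (hs : s u.proj = u.snd) (w : TangentSpace 𝓑 u.proj) :
    vertLiftInv u (pushforwardThrough s u hs w) = baseDeriv s u.proj w := by
  have h := mfderiv_comp_apply_of_eq (I := 𝓑) (I' := 𝓣) (I'' := 𝓘(ℝ, F)) u.proj (y := u)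
    (g := fun w : TotalSpace F E => (trivializationAt F E u.proj ⟨w.proj, w.snd⟩).2)
    (f := fun y : M => (⟨y, s y⟩ : TotalSpace F E))
    ((isSmoothPullbackSection_snd (EM := EM)).mdifferentiableAt_snd u)
    ((s.contMDiff u.proj).mdifferentiableAt (by simp)) (by rw [hs]) w
  unfold vertLiftInv componentDeriv baseDeriv
  congr 1
  exact h.symm

/-- A vector field on the total space is smooth as soon as its projection to the base and its
fibre components in the preferred trivializations are. -/
theorem contMDiff_totalSpace_vectorField {Z : Π u : TotalSpace F E, TangentSpace 𝓣 u}
    (h₁ : ContMDiff 𝓣 (𝓑).tangent ∞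
      (fun u : TotalSpace F E => (⟨u.proj, projDeriv u (Z u)⟩ : TangentBundle 𝓑 M)))
    (h₂ : ∀ u₀ : TotalSpace F E, ContMDiffAt 𝓣 𝓘(ℝ, F) ∞ (fun u : TotalSpace F E =>
      mvfderiv 𝓣 (fun w : TotalSpace F E => (trivializationAt F E u₀.proj w).2) u (Z u)) u₀) :
    ContMDiff 𝓣 (𝓣).tangent ∞
      (fun u => (⟨u, Z u⟩ : TangentBundle 𝓣 (TotalSpace F E))) := by
  intro u₀
  have : IsManifold 𝓑 1 M := IsManifold.of_le (n := ∞) (by simp)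
  have : ContMDiffVectorBundle 1 F E 𝓑 := ContMDiffVectorBundle.of_le (n := ∞) (by simp)
  have hx := mem_baseSet_trivializationAt F E u₀.proj
  set e := trivializationAt F E u₀.proj with he
  have hsrc : u₀ ∈ e.source := e.mem_source.2 hx
  have hmem : ∀ᶠ u in 𝓝 u₀, u ∈ e.source := e.open_source.mem_nhds hsrc
  have hc : ContMDiffAt 𝓣 𝓘(ℝ, F).tangent ∞ (fun u : TotalSpace F E =>
      (⟨(e u).2, mvfderiv 𝓣 (fun w : TotalSpace F E => (e w).2) u (Z u)⟩ :
        TangentBundle 𝓘(ℝ, F) F)) u₀ := by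
    rw [Bundle.contMDiffAt_totalSpace]
    refine ⟨(isSmoothPullbackSection_snd (EM := EM)).contMDiffAt_snd hx, ?_⟩
    simpa using h₂ u₀
  have hprod := (contMDiff_equivTangentBundleProd_symm (n := ∞) (I := 𝓑) (I' := 𝓘(ℝ, F)) (M := M)
    (M' := F)).contMDiffAt.comp u₀ ((h₁ u₀).prodMk hc)
  have hsymm : ContMDiffOn (𝓣).tangent (𝓣).tangent ∞
      (tangentMapWithin 𝓣 𝓣 e.toOpenPartialHomeomorph.symm e.target)
      (π (EM × F) (TangentSpace 𝓣 : M × F → Type _) ⁻¹' e.target) :=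
    (Trivialization.contMDiffOn_symm (n := ∞) (IB := 𝓑) e).contMDiffOn_tangentMapWithin (m := ∞)
      (by simp) (e.open_target.uniqueMDiffOn)
  have hopen : IsOpen (π (EM × F) (TangentSpace 𝓣 : M × F → Type _) ⁻¹' e.target) :=
    e.open_target.preimage (FiberBundle.continuous_proj _ _)
  have hsu : (u₀.proj, (e u₀).2) ∈ e.target := by
    rw [e.mk_proj_snd hsrc]
    exact e.map_source hsrc
  refine ((hsymm.contMDiffAt (hopen.mem_nhds hsu)).comp u₀ hprod).congr_of_eventuallyEq ?_
  filter_upwards [hmem] with u hu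
  -- the derivative of the identity `e.symm ∘ e` near `u`
  have hut : e u ∈ e.target := e.map_source hu
  have hd := e.mdifferentiable (I := 𝓑) (F := F) (Z := E)
  have h4 := ContinuousLinearMap.ext_iff.1 (hd.symm_comp_deriv hu) (Z u)
  have h5 := mfderiv_trivializationAt (x₀ := u₀.proj) (e.mem_source.1 hu) (Z u)
  have h6 : ∀ p : M × F, p = e u →
      (⟨u, Z u⟩ : TangentBundle 𝓣 (TotalSpace F E)) = ⟨e.toOpenPartialHomeomorph.symm p,
        (mfderivWithin 𝓣 𝓣 e.toOpenPartialHomeomorph.symm e.target p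
          (mfderiv 𝓣 𝓣 e u (Z u) : EM × F) : EM × F)⟩ := by
    rintro _ rfl
    rw [mfderivWithin_of_isOpen e.open_target hut]
    have h7 : ∀ (a b : TotalSpace F E) (y y' : EM × F), a = b → y = y' →
        (⟨a, y⟩ : TangentBundle 𝓣 (TotalSpace F E)) = ⟨b, y'⟩ := by
      rintro a _ y _ rfl rfl; rfl
    exact h7 _ _ _ _ (e.toOpenPartialHomeomorph.left_inv hu).symm h4.symm
  rw [h6 (u.proj, (e u).2) (e.mk_proj_snd hu), h5]
  rfl

end TotalSpaceTangent

/-! ### Local frames -/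

section LocalFrames

set_option linter.unusedSectionVars false

variable {EM : Type*} [NormedAddCommGroup EM] [NormedSpace ℝ EM]
  {M : Type*} [TopologicalSpace M] [ChartedSpace EM M] [IsManifold 𝓘(ℝ, EM) ∞ M]
  {F : Type*} [NormedAddCommGroup F] [NormedSpace ℝ F]
  {E : M → Type*} [TopologicalSpace (TotalSpace F E)]
  [∀ x, AddCommGroup (E x)] [∀ x, Module ℝ (E x)] [∀ x, TopologicalSpace (E x)]
  [FiberBundle F E] [VectorBundle ℝ F E] [ContMDiffVectorBundle ∞ F E 𝓘(ℝ, EM)]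

local notation "𝓑" => 𝓘(ℝ, EM)
local notation "𝓣" => ModelWithCorners.prod 𝓘(ℝ, EM) 𝓘(ℝ, F)

/-- A finite family of global smooth sections of `E` which, on an open neighbourhood `U` of `x₀`,
is the frame given by the preferred trivialization around `x₀` and a basis of the model fibre,
together with a cutoff function which is `1` on `U`. With the cutoff, the coefficients of sections
in the frame become globally defined smooth functions. -/
structure LocalFrame (EM : Type*) [NormedAddCommGroup EM] [NormedSpace ℝ EM]
    {M : Type*} [TopologicalSpace M] [ChartedSpace EM M]
    (F : Type*) [NormedAddCommGroup F] [NormedSpace ℝ F]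
    (E : M → Type*) [TopologicalSpace (TotalSpace F E)]
    [∀ x, AddCommGroup (E x)] [∀ x, Module ℝ (E x)] [∀ x, TopologicalSpace (E x)]
    [FiberBundle F E] (x₀ : M) where
  /-- The sections of the frame. -/
  s : Fin (Module.finrank ℝ F) → Cₛ^∞⟮𝓘(ℝ, EM); F, E⟯
  /-- The neighbourhood on which they form a frame. -/
  U : Set M
  isOpen_U : IsOpen U
  mem_U : x₀ ∈ U
  /-- The basis of the model fibre. -/
  b : Module.Basis (Fin (Module.finrank ℝ F)) ℝ F
  U_subset : U ⊆ (trivializationAt F E x₀).baseSet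
  s_eq : ∀ y ∈ U, ∀ i, s i y = (trivializationAt F E x₀).symm y (b i)
  /-- The cutoff function. -/
  χ : M → ℝ
  contMDiff_χ : ContMDiff 𝓘(ℝ, EM) 𝓘(ℝ, ℝ) ∞ χ
  tsupport_χ : tsupport χ ⊆ (trivializationAt F E x₀).baseSet
  χ_eq_one : ∀ y ∈ U, χ y = 1

theorem exists_localFrame [FiniteDimensional ℝ EM] [T2Space M] [FiniteDimensional ℝ F] (x₀ : M) :
    Nonempty (LocalFrame EM F E x₀) := by
  have hx := mem_baseSet_trivializationAt F E x₀
  obtain ⟨χ, -, hχ⟩ := (SmoothBumpFunction.nhds_basis_tsupport (I := 𝓘(ℝ, EM)) x₀).mem_iff.1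
    ((trivializationAt F E x₀).open_baseSet.mem_nhds hx)
  set b := Module.finBasis ℝ F
  set s : Fin (Module.finrank ℝ F) → Cₛ^∞⟮𝓘(ℝ, EM); F, E⟯ := fun i =>
    sectionThrough ((trivializationAt F E x₀).symm x₀ (b i)) with hs
  have h1 : ∀ᶠ y in 𝓝 x₀, (y ∈ (trivializationAt F E x₀).baseSet ∧ χ y = 1) ∧
      ∀ i, s i y = FiberBundle.extend F ((trivializationAt F E x₀).symm x₀ (b i)) y :=
    ((Filter.Eventually.and (p := fun y => y ∈ (trivializationAt F E x₀).baseSet)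
      ((trivializationAt F E x₀).open_baseSet.mem_nhds hx) χ.eventuallyEq_one)).and
      (eventually_all.2 fun i => (exists_section_eventuallyEq_extend (EM := EM) (F := F)
        ((trivializationAt F E x₀).symm x₀ (b i))).choose_spec)
  obtain ⟨U, hU, hUo, hxU⟩ := mem_nhds_iff.1 h1
  refine ⟨⟨s, U, hUo, hxU, b, fun y hy => (hU hy).1.1, fun y hy i => ?_, χ, χ.contMDiff, hχ,
    fun y hy => (hU hy).1.2⟩⟩
  rw [(hU hy).2 i, FiberBundle.extend, Trivialization.apply_mk_symm _ hx]

namespace LocalFrame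

variable {x₀ : M} (fr : LocalFrame EM F E x₀)

theorem eventually_mem {u : TotalSpace F E} (hu : u.proj ∈ fr.U) : ∀ᶠ w in 𝓝 u, w.proj ∈ fr.U :=
  (FiberBundle.continuous_proj F E).continuousAt.eventually (fr.isOpen_U.mem_nhds hu)

/-- The coefficients of a section of `π^*E` in a local frame, extended by the cutoff. -/
noncomputable def coeff (σ : PullbackSection F E) (i : Fin (Module.finrank ℝ F))
    (w : TotalSpace F E) : ℝ :=
  fr.χ w.proj * fr.b.repr (trivializationAt F E x₀ ⟨w.proj, σ w⟩).2 i

theorem sum_smul_eq {y : M} (hy : y ∈ fr.U) (c : Fin (Module.finrank ℝ F) → ℝ) :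
    ∑ i, c i • fr.s i y = (trivializationAt F E x₀).symm y (∑ i, c i • fr.b i) := by
  rw [← Trivialization.coe_symmₗ (R := ℝ) _ (fr.U_subset hy), map_sum]
  refine Finset.sum_congr rfl fun i _ => ?_
  rw [map_smul, fr.s_eq y hy, Trivialization.coe_symmₗ (R := ℝ) _ (fr.U_subset hy)]

theorem eq_sum (σ : PullbackSection F E) {w : TotalSpace F E} (hw : w.proj ∈ fr.U) :
    σ w = ∑ i, fr.coeff σ i w • fr.s i w.proj := by
  rw [fr.sum_smul_eq hw]
  simp only [coeff, fr.χ_eq_one _ hw, one_mul, fr.b.sum_repr]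
  exact ((trivializationAt F E x₀).symm_apply_apply_mk (fr.U_subset hw) _).symm

theorem eventually_eq_sum (σ : PullbackSection F E) {u : TotalSpace F E} (hu : u.proj ∈ fr.U) :
    ∀ᶠ w in 𝓝 u, σ w = ∑ i, fr.coeff σ i w • fr.s i w.proj :=
  (fr.eventually_mem hu).mono fun _ hw => fr.eq_sum σ hw

theorem coeff_unique {y : M} (hy : y ∈ fr.U) {c d : Fin (Module.finrank ℝ F) → ℝ}
    (h : ∑ i, c i • fr.s i y = ∑ i, d i • fr.s i y) : c = d := by
  rw [fr.sum_smul_eq hy, fr.sum_smul_eq hy] at h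
  have h2 := congrArg (fun v => (trivializationAt F E x₀ ⟨y, v⟩).2) h
  simp only [Trivialization.apply_mk_symm _ (fr.U_subset hy)] at h2
  ext i
  have h3 := congrArg (fun v => fr.b.repr v i) h2
  rwa [fr.b.repr_sum_self, fr.b.repr_sum_self] at h3

theorem eq_coeff {σ : PullbackSection F E} {w : TotalSpace F E} (hw : w.proj ∈ fr.U)
    {c : Fin (Module.finrank ℝ F) → ℝ} (h : σ w = ∑ i, c i • fr.s i w.proj)
    (i : Fin (Module.finrank ℝ F)) : c i = fr.coeff σ i w :=
  congrFun (fr.coeff_unique hw (h.symm.trans (fr.eq_sum σ hw))) i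

theorem contMDiff_coeff [FiniteDimensional ℝ F] {σ : PullbackSection F E}
    (hσ : IsSmoothPullbackSection EM σ) (i : Fin (Module.finrank ℝ F)) :
    ContMDiff 𝓣 𝓘(ℝ, ℝ) ∞ (fr.coeff σ i) := by
  intro u
  by_cases hu : u.proj ∈ (trivializationAt F E x₀).baseSet
  · have h1 := hσ.contMDiffAt_snd hu
    let ℓ : F →L[ℝ] ℝ := LinearMap.toContinuousLinearMap (fr.b.coord i)
    have h2 : ContMDiffAt 𝓣 𝓘(ℝ, ℝ) ∞
        (fun w : TotalSpace F E => ℓ (trivializationAt F E x₀ ⟨w.proj, σ w⟩).2) u :=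
      ℓ.contDiff.contMDiff.contMDiffAt.comp u h1
    exact ((fr.contMDiff_χ.comp (Bundle.contMDiff_proj E)).contMDiffAt).mul h2
  · have hχ : ∀ᶠ y in 𝓝 u.proj, fr.χ y = 0 :=
      notMem_tsupport_iff_eventuallyEq.1 fun h => hu (fr.tsupport_χ h)
    refine (contMDiffAt_const (c := (0 : ℝ))).congr_of_eventuallyEq ?_
    filter_upwards [(FiberBundle.continuous_proj F E).continuousAt.eventually hχ] with w hw
    rw [coeff, hw, zero_mul]

/-- The fibre coordinates of the total space given by a local frame. -/
noncomputable abbrev coord (i : Fin (Module.finrank ℝ F)) : TotalSpace F E → ℝ :=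
  fr.coeff (fun w => w.snd) i

theorem contMDiff_coord [FiniteDimensional ℝ F] (i : Fin (Module.finrank ℝ F)) :
    ContMDiff 𝓣 𝓘(ℝ, ℝ) ∞ (fr.coord i) :=
  fr.contMDiff_coeff isSmoothPullbackSection_snd i

theorem componentDeriv_eq [FiniteDimensional ℝ F] {σ : PullbackSection F E}
    (hσ : IsSmoothPullbackSection EM σ) {u : TotalSpace F E} (hu : u.proj ∈ fr.U)
    (z : TangentSpace 𝓣 u) :
    componentDeriv σ u z = ∑ i, mvfderiv 𝓣 (fr.coeff σ i) u z • fr.s i u.proj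
      + ∑ i, fr.coeff σ i u • baseDeriv (fr.s i) u.proj (projDeriv u z) :=
  componentDeriv_sum_smul (fr.contMDiff_coeff hσ) (fr.eventually_eq_sum σ hu) z

/-- On vertical tangent vectors, the derivatives of the fibre coordinates are the coefficients of
the vertical component. -/
theorem vertLiftInv_eq_of_vertical [FiniteDimensional ℝ F] {u : TotalSpace F E}
    (hu : u.proj ∈ fr.U) {z : TangentSpace 𝓣 u} (hz : projDeriv u z = 0) :
    vertLiftInv u z = ∑ i, mvfderiv 𝓣 (fr.coord i) u z • fr.s i u.proj := by
  rw [vertLiftInv, fr.componentDeriv_eq isSmoothPullbackSection_snd hu, hz]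
  rw [add_eq_left]
  refine Finset.sum_eq_zero fun i _ => ?_
  rw [show baseDeriv (fr.s i) u.proj 0 = 0 from (baseDerivₗ (fr.s i) u.proj).map_zero, smul_zero]

/-- The projection to the base and the derivatives of the fibre coordinates determine a tangent
vector of the total space. -/
theorem tangent_ext [FiniteDimensional ℝ F] {u : TotalSpace F E}
    (hu : u.proj ∈ fr.U) {z z' : TangentSpace 𝓣 u} (h₁ : projDeriv u z = projDeriv u z')
    (h₂ : ∀ i, mvfderiv 𝓣 (fr.coord i) u z = mvfderiv 𝓣 (fr.coord i) u z') : z = z' := by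
  refine totalSpace_tangent_ext h₁ ?_
  rw [vertLiftInv, vertLiftInv, fr.componentDeriv_eq isSmoothPullbackSection_snd hu,
    fr.componentDeriv_eq isSmoothPullbackSection_snd hu, h₁]
  simp only [h₂]

theorem mvfderiv_coord_vertLift [FiniteDimensional ℝ F] {u : TotalSpace F E}
    (hu : u.proj ∈ fr.U) (σ : PullbackSection F E) (i : Fin (Module.finrank ℝ F)) :
    mvfderiv 𝓣 (fr.coord i) u (vertLift EM u (σ u)) = fr.coeff σ i u := by
  refine fr.eq_coeff hu (c := fun i => mvfderiv 𝓣 (fr.coord i) u (vertLift EM u (σ u))) ?_ i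
  rw [← fr.vertLiftInv_eq_of_vertical hu (projDeriv_vertLift u _), vertLiftInv_vertLift]

end LocalFrame

/-- A vector field on the total space is smooth if its projection to the base and its derivatives
of fibre coordinates are. -/
theorem contMDiff_vectorField_of_coord [FiniteDimensional ℝ F]
    {Z : Π u : TotalSpace F E, TangentSpace 𝓣 u}
    (h₁ : ContMDiff 𝓣 (𝓑).tangent ∞
      (fun u : TotalSpace F E => (⟨u.proj, projDeriv u (Z u)⟩ : TangentBundle 𝓑 M)))
    (h₂ : ∀ u₀ : TotalSpace F E, ∃ fr : LocalFrame EM F E u₀.proj, ∀ i,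
      ContMDiffAt 𝓣 𝓘(ℝ, ℝ) ∞ (fun u => mvfderiv 𝓣 (fr.coord i) u (Z u)) u₀) :
    ContMDiff 𝓣 (𝓣).tangent ∞
      (fun u => (⟨u, Z u⟩ : TangentBundle 𝓣 (TotalSpace F E))) := by
  refine contMDiff_totalSpace_vectorField h₁ fun u₀ => ?_
  obtain ⟨fr, hfr⟩ := h₂ u₀
  have hsum : ContMDiffAt 𝓣 𝓘(ℝ, F) ∞
      (fun u => ∑ i, mvfderiv 𝓣 (fr.coord i) u (Z u) • fr.b i) u₀ :=
    contMDiffAt_finsetSum fun i _ => (hfr i).smul contMDiffAt_const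
  refine hsum.congr_of_eventuallyEq ?_
  filter_upwards [fr.eventually_mem fr.mem_U] with u hu
  have he : (fun w : TotalSpace F E => (trivializationAt F E u₀.proj w).2) =ᶠ[𝓝 u]
      fun w => ∑ i, fr.coord i w • fr.b i := by
    filter_upwards [fr.eventually_mem hu] with w hw
    simp only [LocalFrame.coord, LocalFrame.coeff, fr.χ_eq_one _ hw, one_mul, fr.b.sum_repr]
  rw [he.mvfderiv_eq]
  have hd : ∀ t : Finset (Fin (Module.finrank ℝ F)),
      MDifferentiableAt 𝓣 𝓘(ℝ, F) (fun w => ∑ i ∈ t, fr.coord i w • fr.b i) u ∧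
      mvfderiv 𝓣 (fun w => ∑ i ∈ t, fr.coord i w • fr.b i) u (Z u)
        = ∑ i ∈ t, mvfderiv 𝓣 (fr.coord i) u (Z u) • fr.b i := by
    classical
    intro t
    induction t using Finset.induction_on with
    | empty => simp [mdifferentiableAt_const, mvfderiv_const]
    | insert a t ha ih =>
      simp only [Finset.sum_insert ha]
      have h3 : MDifferentiableAt 𝓣 𝓘(ℝ, ℝ) (fr.coord a) u :=
        (fr.contMDiff_coord a u).mdifferentiableAt (by simp)
      have h4 : MDifferentiableAt 𝓣 𝓘(ℝ, F) (fr.coord a • fun _ : TotalSpace F E => fr.b a) u :=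
        h3.smul mdifferentiableAt_const
      refine ⟨h4.add ih.1, ?_⟩
      rw [← ih.2]
      refine Eq.trans (congrArg (fun L => L (Z u)) (mvfderiv_add h4 ih.1)) ?_
      rw [_root_.add_apply, mvfderiv_smul h3 mdifferentiableAt_const, mvfderiv_const]
      simp
  exact (hd Finset.univ).2

end LocalFrames

/-! ### The bracket of sections of the algebroid -/

section AlgebroidBracket

set_option linter.unusedSectionVars false

variable {EM : Type*} [NormedAddCommGroup EM] [NormedSpace ℝ EM]
  {M : Type*} [TopologicalSpace M] [ChartedSpace EM M] [IsManifold 𝓘(ℝ, EM) ∞ M]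
  {F : Type*} [NormedAddCommGroup F] [NormedSpace ℝ F]
  {E : M → Type*} [TopologicalSpace (TotalSpace F E)]
  [∀ x, AddCommGroup (E x)] [∀ x, Module ℝ (E x)] [∀ x, TopologicalSpace (E x)]
  [FiberBundle F E] [VectorBundle ℝ F E] [ContMDiffVectorBundle ∞ F E 𝓘(ℝ, EM)]

local notation "𝓑" => 𝓘(ℝ, EM)
local notation "𝓣" => ModelWithCorners.prod 𝓘(ℝ, EM) 𝓘(ℝ, F)

theorem mvfderiv_comp_proj {h : M → ℝ} (hh : ContMDiff 𝓑 𝓘(ℝ, ℝ) ∞ h) (u : TotalSpace F E)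
    (z : TangentSpace 𝓣 u) :
    mvfderiv 𝓣 (fun w : TotalSpace F E => h w.proj) u z = mvfderiv 𝓑 h u.proj (projDeriv u z) :=
  mfderiv_comp_apply u (g := h) ((hh u.proj).mdifferentiableAt (by simp))
    ((Bundle.contMDiff_proj (n := ∞) E u).mdifferentiableAt (by simp)) z

theorem contMDiff_comp_proj {h : M → ℝ} (hh : ContMDiff 𝓑 𝓘(ℝ, ℝ) ∞ h) :
    ContMDiff 𝓣 𝓘(ℝ, ℝ) ∞ (fun w : TotalSpace F E => h w.proj) :=
  hh.comp (Bundle.contMDiff_proj E)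

theorem baseDeriv_sum_smul {ι : Type*} [Fintype ι] {x : M} {r : Cₛ^∞⟮𝓑; F, E⟯}
    {h : ι → M → ℝ} (hh : ∀ i, ContMDiff 𝓑 𝓘(ℝ, ℝ) ∞ (h i)) {s : ι → Cₛ^∞⟮𝓑; F, E⟯}
    (hr : ∀ᶠ y in 𝓝 x, r y = ∑ i, h i y • s i y) (w : TangentSpace 𝓑 x) :
    baseDeriv r x w = ∑ i, mvfderiv 𝓑 (h i) x w • s i x + ∑ i, h i x • baseDeriv (s i) x w := by
  let u : TotalSpace F E := ⟨x, 0⟩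
  let z : TangentSpace 𝓣 u := pushforwardThrough (0 : Cₛ^∞⟮𝓑; F, E⟯) u rfl w
  have hz : projDeriv u z = w := projDeriv_pushforwardThrough _ u rfl w
  have hev : ∀ᶠ w in 𝓝 u, r w.proj = ∑ i, h i w.proj • s i w.proj :=
    ((FiberBundle.continuous_proj F E).continuousAt :
      Tendsto (TotalSpace.proj : TotalSpace F E → M) (𝓝 u) (𝓝 x)).eventually hr
  have h1 := componentDeriv_sum_smul (σ := fun w : TotalSpace F E => r w.proj)
    (fun i => contMDiff_comp_proj (hh i)) hev z
  rw [componentDeriv_comp_proj] at h1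
  simp only [mvfderiv_comp_proj (hh _)] at h1
  change baseDeriv r x (projDeriv u z) = ∑ i, mvfderiv 𝓑 (h i) x (projDeriv u z) • s i x
    + ∑ i, h i x • baseDeriv (s i) x (projDeriv u z) at h1
  rwa [hz] at h1

theorem smulSection_apply (f : C^∞⟮𝓑, M; 𝓘(ℝ, ℝ), ℝ⟯) (s : Cₛ^∞⟮𝓑; F, E⟯) (x : M) :
    smulSection f s x = f x • s x := rfl

theorem section_sum_apply {ι : Type*} (t : Finset ι) (s : ι → Cₛ^∞⟮𝓑; F, E⟯) (x : M) :
    (∑ i ∈ t, s i) x = ∑ i ∈ t, s i x := by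
  classical
  induction t using Finset.induction_on with
  | empty => rfl
  | insert a t ha ih => rw [Finset.sum_insert ha, Finset.sum_insert ha, ← ih]; rfl

section

variable [FiniteDimensional ℝ EM] [T2Space M]

theorem sectionThrough_eventuallyEq {x : M} (v : E x) :
    ∀ᶠ y in 𝓝 x, (sectionThrough v : Cₛ^∞⟮𝓑; F, E⟯) y
      = (trivializationAt F E x).symm y (trivializationAt F E x ⟨x, v⟩).2 :=
  (exists_section_eventuallyEq_extend (EM := EM) (F := F) v).choose_spec

theorem eventually_mem_baseSet (x : M) : ∀ᶠ y in 𝓝 x, y ∈ (trivializationAt F E x).baseSet :=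
  (trivializationAt F E x).open_baseSet.mem_nhds (mem_baseSet_trivializationAt F E x)

theorem sectionThrough_add_eventuallyEq {x : M} (v w : E x) :
    ∀ᶠ y in 𝓝 x, (sectionThrough (v + w) : Cₛ^∞⟮𝓑; F, E⟯) y
      = (sectionThrough v + sectionThrough w : Cₛ^∞⟮𝓑; F, E⟯) y := by
  filter_upwards [sectionThrough_eventuallyEq (EM := EM) (F := F) (v + w),
    sectionThrough_eventuallyEq (EM := EM) (F := F) v,
    sectionThrough_eventuallyEq (EM := EM) (F := F) w,
    eventually_mem_baseSet (F := F) (E := E) x] with y h1 h2 h3 hy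
  rw [h1, ContMDiffSection.coe_add, Pi.add_apply, h2, h3,
    trivializationAt_snd_add (mem_baseSet_trivializationAt F E x), trivializationAt_symm_add hy]

theorem sectionThrough_smul_eventuallyEq {x : M} (c : ℝ) (v : E x) :
    ∀ᶠ y in 𝓝 x, (sectionThrough (c • v) : Cₛ^∞⟮𝓑; F, E⟯) y
      = (c • sectionThrough v : Cₛ^∞⟮𝓑; F, E⟯) y := by
  filter_upwards [sectionThrough_eventuallyEq (EM := EM) (F := F) (c • v),
    sectionThrough_eventuallyEq (EM := EM) (F := F) v,
    eventually_mem_baseSet (F := F) (E := E) x] with y h1 h2 hy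
  rw [h1, ContMDiffSection.coe_smul, Pi.smul_apply, h2,
    trivializationAt_snd_smul (mem_baseSet_trivializationAt F E x), trivializationAt_symm_smul hy]

end

namespace LieAlgebroid

variable (A : LieAlgebroid EM F E)

theorem bracket_swap (ξ η : Cₛ^∞⟮𝓑; F, E⟯) : A.bracket ξ η = -A.bracket η ξ := by
  have h := A.bracket_self (ξ + η)
  simp only [map_add, LinearMap.add_apply, A.bracket_self, zero_add, add_zero] at h
  exact eq_neg_of_add_eq_zero_right h

theorem contMDiff_anchor_comp {σ : PullbackSection F E} (hσ : IsSmoothPullbackSection EM σ) :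
    ContMDiff 𝓣 (𝓑).tangent ∞
      (fun u : TotalSpace F E => (⟨u.proj, A.anchor u.proj (σ u)⟩ : TangentBundle 𝓑 M)) :=
  A.contMDiff_anchor.comp hσ

/-- The derivative `ρ(ξ) f` of a smooth function on the base along a section of the algebroid. -/
noncomputable def anchorDeriv (ξ : Cₛ^∞⟮𝓑; F, E⟯) (f : C^∞⟮𝓑, M; 𝓘(ℝ, ℝ), ℝ⟯) :
    C^∞⟮𝓑, M; 𝓘(ℝ, ℝ), ℝ⟯ :=
  ⟨fun x => mvfderiv 𝓑 f x (A.anchor x (ξ x)),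
    f.contMDiff.mvfderiv_apply (A.contMDiff_anchor.comp ξ.contMDiff)⟩

theorem anchorDeriv_apply (ξ : Cₛ^∞⟮𝓑; F, E⟯) (f : C^∞⟮𝓑, M; 𝓘(ℝ, ℝ), ℝ⟯) (x : M) :
    A.anchorDeriv ξ f x = mvfderiv 𝓑 f x (A.anchor x (ξ x)) := rfl

theorem bracket_smulSection (ξ η : Cₛ^∞⟮𝓑; F, E⟯) (f : C^∞⟮𝓑, M; 𝓘(ℝ, ℝ), ℝ⟯) :
    A.bracket ξ (smulSection f η)
      = smulSection f (A.bracket ξ η) + smulSection (A.anchorDeriv ξ f) η := by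
  ext x
  exact A.leibniz ξ η f x

variable [FiniteDimensional ℝ EM] [T2Space M]

/-- The anchor is a homomorphism of Lie brackets. As for vector fields, this is what remains of the
Jacobi identity for `ξ, η, f s` once that for `ξ, η, s` is subtracted. -/
theorem anchorDeriv_bracket (ξ η : Cₛ^∞⟮𝓑; F, E⟯) (f : C^∞⟮𝓑, M; 𝓘(ℝ, ℝ), ℝ⟯) (x : M) :
    A.anchorDeriv (A.bracket ξ η) f x
      = A.anchorDeriv ξ (A.anchorDeriv η f) x - A.anchorDeriv η (A.anchorDeriv ξ f) x := by
  -- over a zero fibre, all three derivatives are taken along the zero vector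
  by_cases hE : ∀ v : E x, v = 0
  · simp only [anchorDeriv_apply]
    rw [hE (A.bracket ξ η x), hE (ξ x), hE (η x)]; simp
  push Not at hE
  obtain ⟨v, hv⟩ := hE
  set s : Cₛ^∞⟮𝓑; F, E⟯ := sectionThrough v with hs
  have hsx : s x = v := sectionThrough_apply_self v
  have h1 := A.jacobi ξ η (smulSection f s)
  simp only [bracket_smulSection, map_add] at h1
  have h2 := congrArg (fun t : Cₛ^∞⟮𝓑; F, E⟯ => t x) (A.jacobi ξ η s)
  have h3 := congrArg (fun t : Cₛ^∞⟮𝓑; F, E⟯ => t x) h1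
  simp only [ContMDiffSection.coe_add, Pi.add_apply, smulSection_apply] at h2 h3
  rw [h2, hsx] at h3
  have h4 : (A.anchorDeriv (A.bracket ξ η) f x - (A.anchorDeriv ξ (A.anchorDeriv η f) x
      - A.anchorDeriv η (A.anchorDeriv ξ f) x)) • v = 0 := by
    rw [smul_add] at h3
    rw [sub_smul, sub_smul]
    rw [← sub_eq_zero] at h3
    rw [← neg_eq_zero, ← h3]
    abel
  exact sub_eq_zero.1 ((smul_eq_zero.1 h4).resolve_right hv)

/-- The bracket is a local operator. -/
theorem bracket_apply_eq_zero_of_eventually {t r : Cₛ^∞⟮𝓑; F, E⟯} {x : M}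
    (hr : ∀ᶠ y in 𝓝 x, r y = 0) : A.bracket t r x = 0 := by
  -- `r = (1 - χ) r` for a bump function `χ` supported where `r` vanishes
  obtain ⟨χ, -, hχ⟩ := (SmoothBumpFunction.nhds_basis_tsupport (I := 𝓑) x).mem_iff.1 hr
  let f : C^∞⟮𝓑, M; 𝓘(ℝ, ℝ), ℝ⟯ := ⟨fun y => 1 - χ y, contMDiff_const.sub χ.contMDiff⟩
  have hf : smulSection f r = r := by
    ext y
    rw [smulSection_apply]
    by_cases hy : y ∈ tsupport χ
    · rw [show r y = 0 from hχ hy, smul_zero]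
    · change (1 - χ y) • r y = r y
      rw [image_eq_zero_of_notMem_tsupport hy, sub_zero, one_smul]
  have hfx : f x = 0 := by
    change 1 - χ x = 0
    rw [χ.eq_one, sub_self]
  rw [← hf, A.leibniz, hfx, hr.self_of_nhds, zero_smul, smul_zero, add_zero]

theorem bracket_congr_right {t r r' : Cₛ^∞⟮𝓑; F, E⟯} {x : M}
    (hr : ∀ᶠ y in 𝓝 x, r y = r' y) : A.bracket t r x = A.bracket t r' x := by
  have h : A.bracket t (r - r') x = 0 := A.bracket_apply_eq_zero_of_eventually <| by
    filter_upwards [hr] with y hy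
    rw [ContMDiffSection.coe_sub, Pi.sub_apply, hy, sub_self]
  rwa [map_sub, ContMDiffSection.coe_sub, Pi.sub_apply, sub_eq_zero] at h

theorem bracket_congr_left {t r r' : Cₛ^∞⟮𝓑; F, E⟯} {x : M}
    (hr : ∀ᶠ y in 𝓝 x, r y = r' y) : A.bracket r t x = A.bracket r' t x := by
  rw [A.bracket_swap r, A.bracket_swap r', ContMDiffSection.coe_neg, ContMDiffSection.coe_neg,
    Pi.neg_apply, Pi.neg_apply, A.bracket_congr_right hr]

/-- The bracket at `x` of the sections through two vectors of `E_x` that are constant in the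
preferred trivialization: the structure functions of the algebroid in that trivialization. -/
noncomputable def constBracket (x : M) : E x →ₗ[ℝ] E x →ₗ[ℝ] E x :=
  LinearMap.mk₂ ℝ
    (fun v w => A.bracket (sectionThrough v) (sectionThrough w) x)
    (fun v v' w => by
      rw [A.bracket_congr_left (sectionThrough_add_eventuallyEq v v'), map_add,
        LinearMap.add_apply, ContMDiffSection.coe_add, Pi.add_apply])
    (fun c v w => by
      rw [A.bracket_congr_left (sectionThrough_smul_eventuallyEq c v), map_smul,
        LinearMap.smul_apply, ContMDiffSection.coe_smul, Pi.smul_apply])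
    (fun v w w' => by
      rw [A.bracket_congr_right (sectionThrough_add_eventuallyEq w w'), map_add,
        ContMDiffSection.coe_add, Pi.add_apply])
    (fun c v w => by
      rw [A.bracket_congr_right (sectionThrough_smul_eventuallyEq c w), map_smul,
        ContMDiffSection.coe_smul, Pi.smul_apply])

theorem constBracket_apply (x : M) (v w : E x) :
    A.constBracket x v w = A.bracket (sectionThrough v) (sectionThrough w) x := rfl

theorem constBracket_swap (x : M) (v w : E x) : A.constBracket x v w = -A.constBracket x w v := by
  rw [constBracket_apply, A.bracket_swap]
  rfl

variable [FiniteDimensional ℝ F]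

/-- The first-order dependence of the bracket on its second argument: a local frame expresses the
section in terms of sections with constant components. -/
theorem bracket_apply_right (t r : Cₛ^∞⟮𝓑; F, E⟯) (x : M) :
    A.bracket t r x = A.bracket t (sectionThrough (r x)) x
      + baseDeriv r x (A.anchor x (t x)) := by
  obtain ⟨fr⟩ := exists_localFrame (EM := EM) (F := F) (E := E) x
  let h : Fin (Module.finrank ℝ F) → C^∞⟮𝓑, M; 𝓘(ℝ, ℝ), ℝ⟯ := fun i =>
    ⟨fun y => fr.coeff (fun w => r w.proj) i ⟨y, 0⟩,
      (fr.contMDiff_coeff (isSmoothPullbackSection_comp_proj r) i).comp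
        (0 : Cₛ^∞⟮𝓑; F, E⟯).contMDiff⟩
  have hr : ∀ y ∈ fr.U, r y = ∑ i, h i y • fr.s i y := fun y hy =>
    fr.eq_sum (fun w => r w.proj) (w := ⟨y, 0⟩) hy
  have hrU : ∀ᶠ y in 𝓝 x, r y = ∑ i, h i y • fr.s i y :=
    Filter.eventually_of_mem (fr.isOpen_U.mem_nhds fr.mem_U) hr
  have h1 : A.bracket t r x = ∑ i, (h i x • A.bracket t (fr.s i) x
      + mvfderiv 𝓑 (h i) x (A.anchor x (t x)) • fr.s i x) := by
    rw [A.bracket_congr_right (r' := ∑ i, smulSection (h i) (fr.s i))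
      (hrU.mono fun y hy => by rw [hy, section_sum_apply]; rfl), map_sum, section_sum_apply]
    exact Finset.sum_congr rfl fun i _ => A.leibniz t (fr.s i) (h i) x
  have h2 : A.bracket t (sectionThrough (r x)) x = ∑ i, h i x • A.bracket t (fr.s i) x := by
    rw [A.bracket_congr_right (r' := ∑ i, h i x • fr.s i), map_sum, section_sum_apply]
    · exact Finset.sum_congr rfl fun i _ => by
        rw [map_smul, ContMDiffSection.coe_smul, Pi.smul_apply]
    · filter_upwards [sectionThrough_eventuallyEq (EM := EM) (F := F) (r x),
        fr.isOpen_U.mem_nhds fr.mem_U] with y hy hyU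
      rw [hy, section_sum_apply]
      simp only [ContMDiffSection.coe_smul, Pi.smul_apply]
      rw [fr.sum_smul_eq hyU, hr x fr.mem_U, fr.sum_smul_eq fr.mem_U,
        Trivialization.apply_mk_symm _ (fr.U_subset fr.mem_U)]
  have h3 : ∀ i, baseDeriv (fr.s i) x (A.anchor x (t x)) = 0 := by
    intro i
    have : (fun y : M => (trivializationAt F E x ⟨y, fr.s i y⟩).2) =ᶠ[𝓝 x] fun _ => fr.b i := by
      filter_upwards [fr.isOpen_U.mem_nhds fr.mem_U] with y hy
      rw [fr.s_eq y hy, Trivialization.apply_mk_symm _ (fr.U_subset hy)]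
    rw [baseDeriv, this.mvfderiv_eq, mvfderiv_const]
    simpa using trivializationAt_symm_smul (mem_baseSet_trivializationAt F E x) 0 0
  rw [h1, h2, baseDeriv_sum_smul (fun i => (h i).contMDiff) hrU, Finset.sum_add_distrib]
  simp only [h3, smul_zero, Finset.sum_const_zero, add_zero]

/-- The bracket in terms of the structure functions: `[ξ, η] = ξ^α η^β [e_α, e_β] + ρ(ξ)(η^α) e_α
- ρ(η)(ξ^α) e_α`. -/
theorem bracket_apply (ξ η : Cₛ^∞⟮𝓑; F, E⟯) (x : M) :
    A.bracket ξ η x = A.constBracket x (ξ x) (η x) + baseDeriv η x (A.anchor x (ξ x))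
      - baseDeriv ξ x (A.anchor x (η x)) := by
  have h := A.bracket_apply_right (sectionThrough (η x)) ξ x
  rw [sectionThrough_apply_self] at h
  rw [A.bracket_apply_right ξ η, A.bracket_swap ξ, ContMDiffSection.coe_neg, Pi.neg_apply, h,
    A.constBracket_swap, constBracket_apply]
  abel

end LieAlgebroid

end AlgebroidBracket

/-! ### The bracket of the prolongation -/

section ProlongationBracket

set_option linter.unusedSectionVars false

variable {EM : Type*} [NormedAddCommGroup EM] [NormedSpace ℝ EM]
  {M : Type*} [TopologicalSpace M] [ChartedSpace EM M] [IsManifold 𝓘(ℝ, EM) ∞ M]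
  {F : Type*} [NormedAddCommGroup F] [NormedSpace ℝ F]
  {E : M → Type*} [TopologicalSpace (TotalSpace F E)]
  [∀ x, AddCommGroup (E x)] [∀ x, Module ℝ (E x)] [∀ x, TopologicalSpace (E x)]
  [FiberBundle F E] [VectorBundle ℝ F E] [ContMDiffVectorBundle ∞ F E 𝓘(ℝ, EM)]
  [FiniteDimensional ℝ EM] [T2Space M] [FiniteDimensional ℝ F]

local notation "𝓑" => 𝓘(ℝ, EM)
local notation "𝓣" => ModelWithCorners.prod 𝓘(ℝ, EM) 𝓘(ℝ, F)

theorem ContMDiff.mlieBracket_infty {E' : Type*} [NormedAddCommGroup E'] [NormedSpace ℝ E']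
    [CompleteSpace E']
    {H : Type*} [TopologicalSpace H] {I : ModelWithCorners ℝ E' H}
    {N : Type*} [TopologicalSpace N] [ChartedSpace H N] [IsManifold I ∞ N]
    {V W : Π x : N, TangentSpace I x} (hV : CMDiff ∞ (T% V)) (hW : CMDiff ∞ (T% W)) :
    CMDiff ∞ (T% (VectorField.mlieBracket I V W)) := by
  have : IsManifold I (minSmoothness ℝ 2) N := by
    rw [minSmoothness_of_isRCLikeNormedField]
    exact IsManifold.of_le (n := ∞) (WithTop.coe_le_coe.2 le_top)
  have : IsManifold I (minSmoothness ℝ 3) N := by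
    rw [minSmoothness_of_isRCLikeNormedField]
    exact IsManifold.of_le (n := ∞) (WithTop.coe_le_coe.2 le_top)
  have : IsManifold I (((⊤ : ℕ∞) : ℕ∞ω) + 1) N := IsManifold.of_le (n := ∞) (by simp)
  exact fun x => ContMDiffAt.mlieBracket_vectorField (n := ⊤) (m := ⊤) (hV x) (hW x)
    (by rw [minSmoothness_of_isRCLikeNormedField]; simp)

theorem mvfderiv_sum_mul {ι : Type*} (t : Finset ι) {g k : ι → TotalSpace F E → ℝ}
    (hg : ∀ i, ContMDiff 𝓣 𝓘(ℝ, ℝ) ∞ (g i)) (hk : ∀ i, ContMDiff 𝓣 𝓘(ℝ, ℝ) ∞ (k i))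
    (u : TotalSpace F E) (z : TangentSpace 𝓣 u) :
    mvfderiv 𝓣 (fun w => ∑ i ∈ t, g i w * k i w) u z
      = ∑ i ∈ t, (mvfderiv 𝓣 (g i) u z * k i u + g i u * mvfderiv 𝓣 (k i) u z) := by
  classical
  induction t using Finset.induction_on with
  | empty => simp [mvfderiv_const]
  | insert a t ha ih =>
    simp only [Finset.sum_insert ha]
    rw [← ih]
    have h1 := (hg a u).mdifferentiableAt (by simp)
    have h2 := (hk a u).mdifferentiableAt (by simp)
    have h3 : MDifferentiableAt 𝓣 𝓘(ℝ, ℝ) (fun w => ∑ i ∈ t, g i w * k i w) u :=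
      (contMDiffAt_finsetSum (n := ∞)
        fun i _ => (hg i u).mul (hk i u)).mdifferentiableAt (by simp)
    refine Eq.trans (congrArg (fun L => L z) (mvfderiv_add (h1.mul h2) h3)) ?_
    rw [_root_.add_apply, mvfderiv_mul h1 h2]
    simp only [_root_.add_apply, _root_.smul_apply, smul_eq_mul]
    ring

namespace LieAlgebroid

variable {A : LieAlgebroid EM F E}

theorem prolongBracket_fst (A : LieAlgebroid EM F E) (ξ ζ : AmbientSection EM F E)
    (u : TotalSpace F E) :
    (A.prolongBracket ξ ζ u).1 = A.constBracket u.proj (ξ u).1 (ζ u).1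
      + componentDeriv (fun w => (ζ w).1) u (ξ u).2
      - componentDeriv (fun w => (ξ w).1) u (ζ u).2 := rfl

theorem prolongBracket_snd (A : LieAlgebroid EM F E) (ξ ζ : AmbientSection EM F E)
    (u : TotalSpace F E) :
    (A.prolongBracket ξ ζ u).2
      = VectorField.mlieBracket 𝓣 (fun w => (ξ w).2) (fun w => (ζ w).2) u := rfl

/-- The first component of the bracket of the prolongation, for first components expanded in any
two families of sections of `E`, which need not be frames. -/
theorem prolongBracket_fst_eq_sum {ι κ : Type*} [Fintype ι] [Fintype κ]
    {ξ ζ : AmbientSection EM F E} {u : TotalSpace F E}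
    (hξu : ξ u ∈ A.prolongation u) (hζu : ζ u ∈ A.prolongation u)
    {f : ι → TotalSpace F E → ℝ} (hf : ∀ i, ContMDiff 𝓣 𝓘(ℝ, ℝ) ∞ (f i))
    {s : ι → Cₛ^∞⟮𝓑; F, E⟯} (hξ : ∀ᶠ w in 𝓝 u, (ξ w).1 = ∑ i, f i w • s i w.proj)
    {g : κ → TotalSpace F E → ℝ} (hg : ∀ i, ContMDiff 𝓣 𝓘(ℝ, ℝ) ∞ (g i))
    {t : κ → Cₛ^∞⟮𝓑; F, E⟯} (hζ : ∀ᶠ w in 𝓝 u, (ζ w).1 = ∑ j, g j w • t j w.proj) :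
    (A.prolongBracket ξ ζ u).1
      = ∑ i, ∑ j, (f i u * g j u) • A.bracket (s i) (t j) u.proj
        + ∑ j, mvfderiv 𝓣 (g j) u (ξ u).2 • t j u.proj
        - ∑ i, mvfderiv 𝓣 (f i) u (ζ u).2 • s i u.proj := by
  have e1 : projDeriv u (ξ u).2 = ∑ i, f i u • A.anchor u.proj (s i u.proj) := by
    rw [← show A.anchor u.proj (ξ u).1 = projDeriv u (ξ u).2 from hξu, hξ.self_of_nhds, map_sum]
    simp only [map_smul]
  have e2 : projDeriv u (ζ u).2 = ∑ j, g j u • A.anchor u.proj (t j u.proj) := by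
    rw [← show A.anchor u.proj (ζ u).1 = projDeriv u (ζ u).2 from hζu, hζ.self_of_nhds, map_sum]
    simp only [map_smul]
  have b1 : ∀ j, baseDeriv (t j) u.proj (projDeriv u (ξ u).2)
      = ∑ i, f i u • baseDeriv (t j) u.proj (A.anchor u.proj (s i u.proj)) := by
    intro j
    rw [e1]
    change baseDerivₗ (t j) u.proj _ = _
    rw [map_sum]
    simp only [map_smul]
    rfl
  have b2 : ∀ i, baseDeriv (s i) u.proj (projDeriv u (ζ u).2)
      = ∑ j, g j u • baseDeriv (s i) u.proj (A.anchor u.proj (t j u.proj)) := by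
    intro i
    rw [e2]
    change baseDerivₗ (s i) u.proj _ = _
    rw [map_sum]
    simp only [map_smul]
    rfl
  rw [prolongBracket_fst, componentDeriv_sum_smul hf hξ, componentDeriv_sum_smul hg hζ,
    hξ.self_of_nhds, hζ.self_of_nhds]
  have c1 : A.constBracket u.proj (∑ i, f i u • s i u.proj) (∑ j, g j u • t j u.proj)
      = ∑ i, ∑ j, (f i u * g j u) • A.constBracket u.proj (s i u.proj) (t j u.proj) := by
    simp only [map_sum, map_smul, LinearMap.sum_apply, LinearMap.smul_apply, Finset.smul_sum,
      smul_smul]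
    rw [Finset.sum_comm]
    simp only [mul_comm]
  have c2 : ∑ j, g j u • baseDeriv (t j) u.proj (projDeriv u (ξ u).2)
      = ∑ i, ∑ j, (f i u * g j u) • baseDeriv (t j) u.proj (A.anchor u.proj (s i u.proj)) := by
    simp only [b1, Finset.smul_sum, smul_smul]
    rw [Finset.sum_comm]
    simp only [mul_comm]
  have c3 : ∑ i, f i u • baseDeriv (s i) u.proj (projDeriv u (ζ u).2)
      = ∑ i, ∑ j, (f i u * g j u) • baseDeriv (s i) u.proj (A.anchor u.proj (t j u.proj)) := by
    simp only [b2, Finset.smul_sum, smul_smul]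
  rw [c1]
  change _ + (_ + ∑ j, g j u • baseDeriv (t j) u.proj (projDeriv u (ξ u).2))
    - (_ + ∑ i, f i u • baseDeriv (s i) u.proj (projDeriv u (ζ u).2)) = _
  rw [c2, c3]
  simp only [A.bracket_apply (s _) (t _), smul_add, smul_sub, Finset.sum_add_distrib,
    Finset.sum_sub_distrib]
  abel

namespace IsProlongationSection

variable {ξ ζ : AmbientSection EM F E}

theorem projDeriv_snd (hξ : A.IsProlongationSection ξ) (u : TotalSpace F E) :
    projDeriv u (ξ u).2 = A.anchor u.proj (ξ u).1 :=
  (hξ.mem_prolongation u).symm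

theorem prolongBracket_fst_eq_frame (hξ : A.IsProlongationSection ξ)
    (hζ : A.IsProlongationSection ζ) {x₀ : M} (fr : LocalFrame EM F E x₀) {u : TotalSpace F E}
    (hu : u.proj ∈ fr.U) :
    (A.prolongBracket ξ ζ u).1
      = ∑ i, ∑ j, (fr.coeff (fun w => (ξ w).1) i u * fr.coeff (fun w => (ζ w).1) j u) •
          A.bracket (fr.s i) (fr.s j) u.proj
        + ∑ j, mvfderiv 𝓣 (fr.coeff (fun w => (ζ w).1) j) u (ξ u).2 • fr.s j u.proj
        - ∑ i, mvfderiv 𝓣 (fr.coeff (fun w => (ξ w).1) i) u (ζ u).2 • fr.s i u.proj :=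
  prolongBracket_fst_eq_sum (hξ.mem_prolongation u) (hζ.mem_prolongation u)
    (fr.contMDiff_coeff hξ.smooth_fst) (fr.eventually_eq_sum _ hu)
    (fr.contMDiff_coeff hζ.smooth_fst) (fr.eventually_eq_sum _ hu)

/-- The derivative of `f ∘ π` along a section of the prolongation. -/
theorem mvfderiv_comp_proj_eq_sum (hξ : A.IsProlongationSection ξ) {x₀ : M}
    (fr : LocalFrame EM F E x₀) {u : TotalSpace F E} (hu : u.proj ∈ fr.U)
    (f : C^∞⟮𝓑, M; 𝓘(ℝ, ℝ), ℝ⟯) :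
    mvfderiv 𝓣 (fun w : TotalSpace F E => f w.proj) u (ξ u).2
      = ∑ i, fr.coeff (fun w => (ξ w).1) i u * A.anchorDeriv (fr.s i) f u.proj := by
  rw [mvfderiv_comp_proj f.contMDiff, hξ.projDeriv_snd, fr.eq_sum (fun w => (ξ w).1) hu, map_sum,
    map_sum]
  simp only [map_smul, smul_eq_mul]
  rfl

/-- Sections of the prolongation are closed under the bracket. -/
theorem prolongBracket (hξ : A.IsProlongationSection ξ) (hζ : A.IsProlongationSection ζ) :
    A.IsProlongationSection (A.prolongBracket ξ ζ) where
  mem_prolongation u := by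
    obtain ⟨fr⟩ := exists_localFrame (EM := EM) (F := F) (E := E) u.proj
    have hu := fr.mem_U
    change A.anchor u.proj _ = projDeriv u _
    refine tangentSpace_ext_mvfderiv fun f => ?_
    rw [← mvfderiv_comp_proj f.contMDiff, prolongBracket_snd,
      mvfderiv_mlieBracket hξ.smooth_snd hζ.smooth_snd (contMDiff_comp_proj f.contMDiff)]
    have hexp : ∀ {ζ : AmbientSection EM F E}, A.IsProlongationSection ζ →
        (fun w : TotalSpace F E => mvfderiv 𝓣 (fun w : TotalSpace F E => f w.proj) w (ζ w).2)
          =ᶠ[𝓝 u] fun w => ∑ i, fr.coeff (fun w => (ζ w).1) i w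
            * A.anchorDeriv (fr.s i) f w.proj := fun hζ =>
      (fr.eventually_mem hu).mono fun w hw => hζ.mvfderiv_comp_proj_eq_sum fr hw f
    rw [(hexp hζ).mvfderiv_eq, (hexp hξ).mvfderiv_eq,
      mvfderiv_sum_mul _ (fr.contMDiff_coeff hζ.smooth_fst)
        (fun i => contMDiff_comp_proj (A.anchorDeriv (fr.s i) f).contMDiff),
      mvfderiv_sum_mul _ (fr.contMDiff_coeff hξ.smooth_fst)
        (fun i => contMDiff_comp_proj (A.anchorDeriv (fr.s i) f).contMDiff)]
    simp only [hξ.mvfderiv_comp_proj_eq_sum fr hu, hζ.mvfderiv_comp_proj_eq_sum fr hu]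
    rw [hξ.prolongBracket_fst_eq_frame hζ fr hu]
    simp only [map_add, map_sub, map_sum, map_smul, smul_eq_mul, ← anchorDeriv_apply,
      anchorDeriv_bracket, Finset.sum_add_distrib, mul_sub, Finset.sum_sub_distrib, Finset.mul_sum]
    have h1 : ∀ a b : Fin (Module.finrank ℝ F) → ℝ, ∀ c : Fin (Module.finrank ℝ F) →
        Fin (Module.finrank ℝ F) → ℝ,
        ∑ i, ∑ j, b i * (a j * c j i) = ∑ i, ∑ j, a i * b j * c i j := by
      intro a b c
      rw [Finset.sum_comm]
      refine Finset.sum_congr rfl fun i _ => Finset.sum_congr rfl fun j _ => by ring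
    have h2 : ∀ a b : Fin (Module.finrank ℝ F) → ℝ, ∀ c : Fin (Module.finrank ℝ F) →
        Fin (Module.finrank ℝ F) → ℝ,
        ∑ i, ∑ j, a i * (b j * c j i) = ∑ i, ∑ j, a i * b j * c j i := by
      intro a b c
      refine Finset.sum_congr rfl fun i _ => Finset.sum_congr rfl fun j _ => by ring
    rw [h1, h2]
    ring
  smooth_fst := by
    refine isSmoothPullbackSection_of_eventuallyEq fun u => ?_
    obtain ⟨fr⟩ := exists_localFrame (EM := EM) (F := F) (E := E) u.proj
    have hf := fr.contMDiff_coeff hξ.smooth_fst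
    have hg := fr.contMDiff_coeff hζ.smooth_fst
    have s1 := isSmoothPullbackSection_sum_smul
      (f := fun (p : Fin (Module.finrank ℝ F) × Fin (Module.finrank ℝ F)) w =>
        fr.coeff (fun w => (ξ w).1) p.1 w * fr.coeff (fun w => (ζ w).1) p.2 w)
      (fun p => (hf p.1).mul (hg p.2)) (fun p => A.bracket (fr.s p.1) (fr.s p.2))
    have s2 := isSmoothPullbackSection_sum_smul
      (fun j => (hg j).mvfderiv_apply hξ.smooth_snd) fr.s
    have s3 := isSmoothPullbackSection_sum_smul
      (fun j => (hf j).mvfderiv_apply hζ.smooth_snd) fr.s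
    refine ⟨_, (s1.add s2).sub s3, ?_⟩
    filter_upwards [fr.eventually_mem fr.mem_U] with w hw
    rw [hξ.prolongBracket_fst_eq_frame hζ fr hw]
    simp only [Pi.sub_apply, Pi.add_apply, Fintype.sum_prod_type]
  smooth_snd := hξ.smooth_snd.mlieBracket_infty hζ.smooth_snd

end IsProlongationSection

end LieAlgebroid

end ProlongationBracket

/-! ### Complete and vertical lifts -/

section Lifts

set_option linter.unusedSectionVars false

variable {EM : Type*} [NormedAddCommGroup EM] [NormedSpace ℝ EM]
  {M : Type*} [TopologicalSpace M] [ChartedSpace EM M] [IsManifold 𝓘(ℝ, EM) ∞ M]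
  {F : Type*} [NormedAddCommGroup F] [NormedSpace ℝ F]
  {E : M → Type*} [TopologicalSpace (TotalSpace F E)]
  [∀ x, AddCommGroup (E x)] [∀ x, Module ℝ (E x)] [∀ x, TopologicalSpace (E x)]
  [FiberBundle F E] [VectorBundle ℝ F E] [ContMDiffVectorBundle ∞ F E 𝓘(ℝ, EM)]
  [FiniteDimensional ℝ EM] [T2Space M] [FiniteDimensional ℝ F]

local notation "𝓑" => 𝓘(ℝ, EM)
local notation "𝓣" => ModelWithCorners.prod 𝓘(ℝ, EM) 𝓘(ℝ, F)

namespace LieAlgebroid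

variable {A : LieAlgebroid EM F E}

theorem isProlongationSection_iMap {σ : PullbackSection F E} (hσ : IsSmoothPullbackSection EM σ) :
    A.IsProlongationSection (iMap σ) where
  mem_prolongation u := by
    change A.anchor u.proj 0 = projDeriv u (vertLift EM u (σ u))
    rw [map_zero, projDeriv_vertLift]
  smooth_fst := isSmoothPullbackSection_zero
  smooth_snd := by
    refine contMDiff_vectorField_of_coord ?_ fun u₀ => ?_
    · have h := A.contMDiff_anchor_comp (isSmoothPullbackSection_zero (EM := EM) (F := F) (E := E))
      refine h.congr fun u => ?_
      change (⟨u.proj, projDeriv u (vertLift EM u (σ u))⟩ : TangentBundle 𝓑 M)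
        = ⟨u.proj, A.anchor u.proj 0⟩
      rw [map_zero, projDeriv_vertLift]
    · obtain ⟨fr⟩ := exists_localFrame (EM := EM) (F := F) (E := E) u₀.proj
      refine ⟨fr, fun i => (fr.contMDiff_coeff hσ i).contMDiffAt.congr_of_eventuallyEq ?_⟩
      filter_upwards [fr.eventually_mem fr.mem_U] with u hu
      exact fr.mvfderiv_coord_vertLift hu σ i

theorem projDeriv_completeLiftField (A : LieAlgebroid EM F E) (η : Cₛ^∞⟮𝓑; F, E⟯)
    (u : TotalSpace F E) :
    projDeriv u (A.completeLiftField η u) = A.anchor u.proj (η u.proj) := by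
  rw [completeLiftField, map_add]
  refine (congrArg₂ (· + ·) (projDeriv_pushforwardThrough _ u _ _)
    (projDeriv_vertLift u _)).trans (add_zero _)

theorem vertLiftInv_completeLiftField (A : LieAlgebroid EM F E) (η : Cₛ^∞⟮𝓑; F, E⟯)
    (u : TotalSpace F E) :
    vertLiftInv u (A.completeLiftField η u) = A.bracket (sectionThrough u.snd) η u.proj := by
  rw [completeLiftField, vertLiftInv_add, vertLiftInv_vertLift, vertLiftInv_pushforwardThrough,
    baseDeriv_sectionThrough, zero_add]

/-- The Lie derivative along `η` of a section of `π^*E`, written in terms of components: it maps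
`f (ξ ∘ π)` to `f ([η, ξ] ∘ π) + η^c(f) (ξ ∘ π)`. -/
noncomputable def lieAlong (A : LieAlgebroid EM F E) (η : Cₛ^∞⟮𝓑; F, E⟯)
    (σ : PullbackSection F E) : PullbackSection F E := fun u =>
  A.constBracket u.proj (η u.proj) (σ u) + componentDeriv σ u (A.completeLiftField η u)
    - baseDeriv η u.proj (A.anchor u.proj (σ u))

theorem lieAlong_comp_proj (η θ : Cₛ^∞⟮𝓑; F, E⟯) (u : TotalSpace F E) :
    A.lieAlong η (fun w => θ w.proj) u = A.bracket η θ u.proj := by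
  rw [lieAlong, componentDeriv_comp_proj, A.bracket_apply η θ]
  change _ + baseDeriv θ u.proj (projDeriv u _) - _ = _
  rw [projDeriv_completeLiftField]

theorem lieAlong_eq_sum {ι : Type*} [Fintype ι] (η : Cₛ^∞⟮𝓑; F, E⟯) {σ : PullbackSection F E}
    {u : TotalSpace F E} {f : ι → TotalSpace F E → ℝ}
    (hf : ∀ i, ContMDiff 𝓣 𝓘(ℝ, ℝ) ∞ (f i)) {s : ι → Cₛ^∞⟮𝓑; F, E⟯}
    (hσ : ∀ᶠ w in 𝓝 u, σ w = ∑ i, f i w • s i w.proj) :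
    A.lieAlong η σ u = ∑ i, f i u • A.bracket η (s i) u.proj
      + ∑ i, mvfderiv 𝓣 (f i) u (A.completeLiftField η u) • s i u.proj := by
  rw [lieAlong, componentDeriv_sum_smul hf hσ, hσ.self_of_nhds]
  change A.constBracket u.proj (η u.proj) _ + (_ + ∑ i, f i u • baseDeriv (s i) u.proj
    (projDeriv u (A.completeLiftField η u))) - baseDerivₗ η u.proj _ = _
  rw [projDeriv_completeLiftField]
  simp only [map_sum, map_smul, A.bracket_apply η, smul_add, smul_sub, Finset.sum_add_distrib,
    Finset.sum_sub_distrib]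
  change _ = _ + _ - ∑ i, f i u • baseDerivₗ η u.proj _ + _
  abel

/-- The tautological section of `π^*E` is invariant under every Lie derivative: this characterizes
the vertical part of the complete lift. -/
theorem lieAlong_snd (η : Cₛ^∞⟮𝓑; F, E⟯) (u : TotalSpace F E) :
    A.lieAlong η (fun w => w.snd) u = 0 := by
  rw [lieAlong]
  change _ + vertLiftInv u (A.completeLiftField η u) - _ = 0
  rw [vertLiftInv_completeLiftField, A.bracket_apply, sectionThrough_apply_self,
    baseDeriv_sectionThrough, sub_zero, A.constBracket_swap u.proj (η u.proj)]
  abel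

theorem lieAlong_zero (η : Cₛ^∞⟮𝓑; F, E⟯) : A.lieAlong η 0 = 0 := by
  ext u
  refine (A.lieAlong_comp_proj η 0 u).trans ?_
  rw [map_zero]
  rfl

/-- The derivatives of the fibre coordinates along a complete lift: with `yᵢ` the coordinates for
the frame `sᵢ`, `∑ yᵢ [η, sᵢ] + ∑ η^c(yᵢ) sᵢ = 0`. -/
theorem completeLiftField_coord (A : LieAlgebroid EM F E) (η : Cₛ^∞⟮𝓑; F, E⟯) {x₀ : M}
    (fr : LocalFrame EM F E x₀) {u : TotalSpace F E} (hu : u.proj ∈ fr.U) :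
    ∑ i, fr.coord i u • A.bracket η (fr.s i) u.proj
      + ∑ i, mvfderiv 𝓣 (fr.coord i) u (A.completeLiftField η u) • fr.s i u.proj = 0 := by
  rw [← A.lieAlong_eq_sum η fr.contMDiff_coord (fr.eventually_eq_sum _ hu), lieAlong_snd]

/-- The complete lift is a smooth section of the prolongation. -/
theorem isProlongationSection_completeLift (A : LieAlgebroid EM F E) (η : Cₛ^∞⟮𝓑; F, E⟯) :
    A.IsProlongationSection (A.completeLift η) where
  mem_prolongation u := (A.projDeriv_completeLiftField η u).symm
  smooth_fst := isSmoothPullbackSection_comp_proj η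
  smooth_snd := by
    refine contMDiff_vectorField_of_coord ?_ fun u₀ => ?_
    · refine (A.contMDiff_anchor_comp (isSmoothPullbackSection_comp_proj η)).congr fun u => ?_
      exact congrArg (fun z => (⟨u.proj, z⟩ : TangentBundle 𝓑 M))
        (A.projDeriv_completeLiftField η u)
    · obtain ⟨fr⟩ := exists_localFrame (EM := EM) (F := F) (E := E) u₀.proj
      have hτ := (isSmoothPullbackSection_sum_smul fr.contMDiff_coord
        (fun i => A.bracket η (fr.s i))).const_smul (-1)
      refine ⟨fr, fun i => (fr.contMDiff_coeff hτ i).contMDiffAt.congr_of_eventuallyEq ?_⟩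
      filter_upwards [fr.eventually_mem fr.mem_U] with u hu
      refine fr.eq_coeff hu
        (c := fun i => mvfderiv 𝓣 (fr.coord i) u (A.completeLiftField η u)) ?_ i
      rw [Pi.smul_apply, neg_one_smul]
      exact neg_eq_of_add_eq_zero_right (A.completeLiftField_coord η fr hu)

theorem isProjectable_completeLift (A : LieAlgebroid EM F E) (η : Cₛ^∞⟮𝓑; F, E⟯) :
    A.IsProjectable (A.completeLift η) :=
  ⟨A.isProlongationSection_completeLift η, η, fun _ => rfl⟩

theorem contMDiff_mvfderiv_completeLiftField (A : LieAlgebroid EM F E) (η : Cₛ^∞⟮𝓑; F, E⟯)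
    {f : TotalSpace F E → ℝ} (hf : ContMDiff 𝓣 𝓘(ℝ, ℝ) ∞ f) :
    ContMDiff 𝓣 𝓘(ℝ, ℝ) ∞ (fun u => mvfderiv 𝓣 f u (A.completeLiftField η u)) :=
  hf.mvfderiv_apply (A.isProlongationSection_completeLift η).smooth_snd

theorem isSmoothPullbackSection_lieAlong (A : LieAlgebroid EM F E) (η : Cₛ^∞⟮𝓑; F, E⟯)
    {σ : PullbackSection F E} (hσ : IsSmoothPullbackSection EM σ) :
    IsSmoothPullbackSection EM (A.lieAlong η σ) := by
  refine isSmoothPullbackSection_of_eventuallyEq fun u => ?_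
  obtain ⟨fr⟩ := exists_localFrame (EM := EM) (F := F) (E := E) u.proj
  have hf := fr.contMDiff_coeff hσ
  refine ⟨_, (isSmoothPullbackSection_sum_smul hf (fun i => A.bracket η (fr.s i))).add
    (isSmoothPullbackSection_sum_smul
      (fun i => A.contMDiff_mvfderiv_completeLiftField η (hf i)) fr.s), ?_⟩
  filter_upwards [fr.eventually_mem fr.mem_U] with w hw
  exact A.lieAlong_eq_sum η hf (fr.eventually_eq_sum σ hw)

theorem lieAlong_add (η : Cₛ^∞⟮𝓑; F, E⟯) {σ τ : PullbackSection F E}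
    (hσ : IsSmoothPullbackSection EM σ) (hτ : IsSmoothPullbackSection EM τ) :
    A.lieAlong η (σ + τ) = A.lieAlong η σ + A.lieAlong η τ := by
  ext u
  rw [Pi.add_apply]
  simp only [lieAlong]
  rw [show componentDeriv (σ + τ) u (A.completeLiftField η u)
    = _ from componentDeriv_add hσ hτ, Pi.add_apply, map_add, map_add, baseDeriv_add_right]
  abel

theorem lieAlong_const_smul (η : Cₛ^∞⟮𝓑; F, E⟯) (c : ℝ) {σ : PullbackSection F E}
    (hσ : IsSmoothPullbackSection EM σ) : A.lieAlong η (c • σ) = c • A.lieAlong η σ := by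
  ext u
  rw [Pi.smul_apply]
  simp only [lieAlong]
  have h := componentDeriv_smul (f := fun _ => c) (z := A.completeLiftField η u)
    mdifferentiableAt_const hσ
  rw [mvfderiv_const, _root_.zero_apply, zero_smul, zero_add] at h
  rw [show componentDeriv (c • σ) u (A.completeLiftField η u) = _ from h, Pi.smul_apply, map_smul,
    map_smul, baseDeriv_smul_right, smul_sub, smul_add]

theorem lieAlong_sub (η : Cₛ^∞⟮𝓑; F, E⟯) {σ τ : PullbackSection F E}
    (hσ : IsSmoothPullbackSection EM σ) (hτ : IsSmoothPullbackSection EM τ) :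
    A.lieAlong η (σ - τ) = A.lieAlong η σ - A.lieAlong η τ := by
  rw [sub_eq_add_neg, ← neg_one_smul ℝ τ, lieAlong_add η hσ (hτ.const_smul _),
    lieAlong_const_smul η _ hτ, neg_one_smul, sub_eq_add_neg]

/-- The bracket with a complete lift commutes with `j`. -/
theorem prolongBracket_completeLift_fst {ζ : AmbientSection EM F E} {u : TotalSpace F E}
    (hζ : ζ u ∈ A.prolongation u) (η : Cₛ^∞⟮𝓑; F, E⟯) :
    (A.prolongBracket (A.completeLift η) ζ u).1 = A.lieAlong η (jMap ζ) u := by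
  rw [prolongBracket_fst]
  change _ + _ - componentDeriv (fun w : TotalSpace F E => η w.proj) u (ζ u).2 = _
  rw [componentDeriv_comp_proj]
  change _ - baseDeriv η u.proj (projDeriv u (ζ u).2) = _
  rw [← show A.anchor u.proj (ζ u).1 = projDeriv u (ζ u).2 from hζ]
  rfl

/-- The bracket with a complete lift commutes with `i`. -/
theorem prolongBracket_completeLift_iMap (A : LieAlgebroid EM F E) (η : Cₛ^∞⟮𝓑; F, E⟯)
    {σ : PullbackSection F E} (hσ : IsSmoothPullbackSection EM σ) :
    A.prolongBracket (A.completeLift η) (iMap σ) = iMap (A.lieAlong η σ) := by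
  have hη := A.isProlongationSection_completeLift η
  have hi := A.isProlongationSection_iMap hσ
  have hbr := hη.prolongBracket hi
  ext1 u
  have hfst : (A.prolongBracket (A.completeLift η) (iMap σ) u).1 = 0 := by
    rw [prolongBracket_completeLift_fst (hi.mem_prolongation u)]
    exact congrFun (A.lieAlong_zero η) u
  have hproj : projDeriv u (A.prolongBracket (A.completeLift η) (iMap σ) u).2 = 0 := by
    rw [hbr.projDeriv_snd, hfst, map_zero]
  refine Prod.ext hfst ?_
  rw [← vertLift_vertLiftInv hproj]
  change vertLift EM u _ = vertLift EM u _
  congr 1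
  obtain ⟨fr⟩ := exists_localFrame (EM := EM) (F := F) (E := E) u.proj
  have hu := fr.mem_U
  rw [fr.vertLiftInv_eq_of_vertical hu hproj, prolongBracket_snd,
    A.lieAlong_eq_sum η (fr.contMDiff_coeff hσ) (fr.eventually_eq_sum σ hu)]
  have h1 : ∀ i, (fun w => mvfderiv 𝓣 (fr.coord i) w (iMap (EM := EM) σ w).2)
      =ᶠ[𝓝 u] fr.coeff σ i := fun i =>
    (fr.eventually_mem hu).mono fun w hw => fr.mvfderiv_coord_vertLift hw σ i
  simp only [mvfderiv_mlieBracket hη.smooth_snd hi.smooth_snd (fr.contMDiff_coord _),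
    (h1 _).mvfderiv_eq, sub_smul, Finset.sum_sub_distrib]
  -- differentiate `∑ yᵢ [η, sᵢ] + ∑ η^c(yᵢ) sᵢ = 0` in the vertical direction `i σ`
  have h2 := componentDeriv_sum_smul (u := u) (σ := fun w : TotalSpace F E => (0 : E w.proj))
    (f := Sum.elim fr.coord
      fun i w => mvfderiv 𝓣 (fr.coord i) w (A.completeLiftField η w))
    (by
      rintro (i | i)
      · exact fr.contMDiff_coord i
      · exact A.contMDiff_mvfderiv_completeLiftField η (fr.contMDiff_coord i))
    (s := Sum.elim (fun i => A.bracket η (fr.s i)) fr.s)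
    (by
      filter_upwards [fr.eventually_mem hu] with w hw
      rw [Fintype.sum_sum_type]
      exact (A.completeLiftField_coord η fr hw).symm) (vertLift EM u (σ u))
  rw [componentDeriv_zero] at h2
  change 0 = _ + ∑ i, _ • baseDerivₗ _ u.proj (projDeriv u (vertLift EM u (σ u))) at h2
  simp only [projDeriv_vertLift, map_zero, smul_zero, Finset.sum_const_zero, add_zero,
    Fintype.sum_sum_type, Sum.elim_inl, Sum.elim_inr, fr.mvfderiv_coord_vertLift hu] at h2
  rw [eq_neg_of_add_eq_zero_left h2.symm]
  exact (sub_eq_neg_add _ _)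

theorem lieDeriv_completeLift (A : LieAlgebroid EM F E) (η : Cₛ^∞⟮𝓑; F, E⟯)
    {σ : PullbackSection F E} (hσ : IsSmoothPullbackSection EM σ) :
    A.lieDeriv (A.completeLift η) σ = A.lieAlong η σ := by
  rw [lieDeriv, A.prolongBracket_completeLift_iMap η hσ]
  ext u
  exact vertLiftInv_vertLift u _

theorem prolongBracket_completeLift_verticalLift (A : LieAlgebroid EM F E)
    (η θ : Cₛ^∞⟮𝓑; F, E⟯) :
    A.prolongBracket (A.completeLift η) (verticalLift θ) = verticalLift (A.bracket η θ) := by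
  refine (A.prolongBracket_completeLift_iMap η (isSmoothPullbackSection_comp_proj θ)).trans ?_
  ext1 u
  rw [iMap, lieAlong_comp_proj]
  rfl

/-- Complete lifts form a Lie subalgebra. The fibre coordinates of both sides agree because
`lieAlong` is a representation of the Lie algebra of sections which kills the tautological
section. -/
theorem prolongBracket_completeLift_completeLift (A : LieAlgebroid EM F E)
    (η θ : Cₛ^∞⟮𝓑; F, E⟯) :
    A.prolongBracket (A.completeLift η) (A.completeLift θ) = A.completeLift (A.bracket η θ) := by
  have hη := A.isProlongationSection_completeLift η
  have hθ := A.isProlongationSection_completeLift θ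
  have hηθ := A.isProlongationSection_completeLift (A.bracket η θ)
  have hbr := hη.prolongBracket hθ
  ext1 u
  have hfst : (A.prolongBracket (A.completeLift η) (A.completeLift θ) u).1
      = A.bracket η θ u.proj := by
    rw [prolongBracket_completeLift_fst (hθ.mem_prolongation u)]
    exact A.lieAlong_comp_proj η θ u
  refine Prod.ext hfst ?_
  obtain ⟨fr⟩ := exists_localFrame (EM := EM) (F := F) (E := E) u.proj
  have hu := fr.mem_U
  refine fr.tangent_ext hu ?_ fun i => ?_
  · rw [hbr.projDeriv_snd, hηθ.projDeriv_snd, hfst]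
    rfl
  refine congrFun (fr.coeff_unique hu (c := fun i => mvfderiv 𝓣 (fr.coord i) u _)
    (d := fun i => mvfderiv 𝓣 (fr.coord i) u _) ?_) i
  rw [prolongBracket_snd]
  simp only [mvfderiv_mlieBracket hη.smooth_snd hθ.smooth_snd (fr.contMDiff_coord _)]
  -- apply `lieAlong α` to the identity `∑ yᵢ [β, sᵢ] + ∑ β^c(yᵢ) sᵢ = 0`
  have key : ∀ α β : Cₛ^∞⟮𝓑; F, E⟯,
      ∑ i, fr.coord i u • A.bracket α (A.bracket β (fr.s i)) u.proj
        + ∑ i, mvfderiv 𝓣 (fr.coord i) u (A.completeLiftField β u) • A.bracket α (fr.s i) u.proj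
        + (∑ i, mvfderiv 𝓣 (fr.coord i) u (A.completeLiftField α u) • A.bracket β (fr.s i) u.proj
        + ∑ i, mvfderiv 𝓣 (fun w => mvfderiv 𝓣 (fr.coord i) w (A.completeLiftField β w)) u
          (A.completeLiftField α u) • fr.s i u.proj) = 0 := by
    intro α β
    have h := A.lieAlong_eq_sum (u := u) (σ := 0) α
      (f := Sum.elim fr.coord
        fun i w => mvfderiv 𝓣 (fr.coord i) w (A.completeLiftField β w))
      (by
        rintro (i | i)
        · exact fr.contMDiff_coord i
        · exact A.contMDiff_mvfderiv_completeLiftField β (fr.contMDiff_coord i))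
      (s := Sum.elim (fun i => A.bracket β (fr.s i)) fr.s)
      (by
        filter_upwards [fr.eventually_mem hu] with w hw
        rw [Fintype.sum_sum_type]
        exact (A.completeLiftField_coord β fr hw).symm)
    rw [lieAlong_zero, Fintype.sum_sum_type, Fintype.sum_sum_type] at h
    exact h.symm
  -- antisymmetrize `key` and compare with the coordinate identity for `[η, θ]`
  have k1 := key η θ
  have k2 := key θ η
  have k3 := A.completeLiftField_coord (A.bracket η θ) fr hu
  have k4 : ∀ i, A.bracket η (A.bracket θ (fr.s i)) u.proj
      = A.bracket (A.bracket η θ) (fr.s i) u.proj + A.bracket θ (A.bracket η (fr.s i)) u.proj := by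
    intro i
    rw [A.jacobi]
    rfl
  simp only [k4, smul_add, Finset.sum_add_distrib] at k1
  simp only [sub_smul, Finset.sum_sub_distrib]
  rw [← sub_eq_zero]
  rw [← sub_eq_zero] at k1
  have := congrArg₂ (· - ·) (congrArg₂ (· - ·) k1 k2) k3
  simp only [sub_zero] at this
  rw [← this]
  change _ - _ - ∑ i, mvfderiv 𝓣 (fr.coord i) u (A.completeLiftField (A.bracket η θ) u)
    • fr.s i u.proj = _
  simp only [completeLift]
  abel

end LieAlgebroid

end Lifts

/-! ### The complete lift acts by derivations -/

section Derivation

set_option linter.unusedSectionVars false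

variable {EM : Type*} [NormedAddCommGroup EM] [NormedSpace ℝ EM]
  {M : Type*} [TopologicalSpace M] [ChartedSpace EM M] [IsManifold 𝓘(ℝ, EM) ∞ M]
  {F : Type*} [NormedAddCommGroup F] [NormedSpace ℝ F]
  {E : M → Type*} [TopologicalSpace (TotalSpace F E)]
  [∀ x, AddCommGroup (E x)] [∀ x, Module ℝ (E x)] [∀ x, TopologicalSpace (E x)]
  [FiberBundle F E] [VectorBundle ℝ F E] [ContMDiffVectorBundle ∞ F E 𝓘(ℝ, EM)]
  [FiniteDimensional ℝ EM] [T2Space M] [FiniteDimensional ℝ F]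

local notation "𝓑" => 𝓘(ℝ, EM)
local notation "𝓣" => ModelWithCorners.prod 𝓘(ℝ, EM) 𝓘(ℝ, F)

theorem mlieBracket_jacobi_infty {E' : Type*} [NormedAddCommGroup E'] [NormedSpace ℝ E']
    [CompleteSpace E']
    {H : Type*} [TopologicalSpace H] {I : ModelWithCorners ℝ E' H}
    {N : Type*} [TopologicalSpace N] [ChartedSpace H N] [IsManifold I ∞ N]
    {U V W : Π x : N, TangentSpace I x} (hU : CMDiff ∞ (T% U)) (hV : CMDiff ∞ (T% V))
    (hW : CMDiff ∞ (T% W)) (x : N) :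
    VectorField.mlieBracket I U (VectorField.mlieBracket I V W) x =
      VectorField.mlieBracket I (VectorField.mlieBracket I U V) W x
        + VectorField.mlieBracket I V (VectorField.mlieBracket I U W) x := by
  have : IsManifold I (minSmoothness ℝ 3) N := by
    rw [minSmoothness_of_isRCLikeNormedField]
    exact IsManifold.of_le (n := ∞) (WithTop.coe_le_coe.2 le_top)
  have hle : minSmoothness ℝ 2 ≤ ((⊤ : ℕ∞) : ℕ∞ω) := by
    rw [minSmoothness_of_isRCLikeNormedField]; exact WithTop.coe_le_coe.2 le_top
  exact VectorField.leibniz_identity_mlieBracket_apply ((hU x).of_le hle) ((hV x).of_le hle)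
    ((hW x).of_le hle)

theorem mlieBracket_sum_smul_right {E' : Type*} [NormedAddCommGroup E'] [NormedSpace ℝ E']
    [CompleteSpace E']
    {H : Type*} [TopologicalSpace H] {I : ModelWithCorners ℝ E' H}
    {N : Type*} [TopologicalSpace N] [ChartedSpace H N] [IsManifold I ∞ N]
    {ι : Type*} (t : Finset ι) (V : Π x : N, TangentSpace I x) {f : ι → N → ℝ}
    (hf : ∀ i, ContMDiff I 𝓘(ℝ, ℝ) ∞ (f i))
    {X : ι → Π x : N, TangentSpace I x} (hX : ∀ i, CMDiff ∞ (T% (X i))) (x : N) :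
    VectorField.mlieBracket I V (∑ i ∈ t, f i • X i) x
      = ∑ i ∈ t, (mvfderiv I (f i) x (V x) • X i x
        + f i x • VectorField.mlieBracket I V (X i) x) := by
  classical
  have : IsManifold I (minSmoothness ℝ 2) N := by
    rw [minSmoothness_of_isRCLikeNormedField]
    exact IsManifold.of_le (n := ∞) (WithTop.coe_le_coe.2 le_top)
  have : IsManifold I 1 N := IsManifold.of_le (n := ∞) (by simp)
  have hs : ∀ t : Finset ι, CMDiff ∞ (T% (∑ i ∈ t, f i • X i)) := by
    intro t
    have := ContMDiff.sum_section (s := t) (fun i _ => (hf i).smul_section (hX i))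
    convert this using 2 with y
    simp
  induction t using Finset.induction_on with
  | empty => simp [VectorField.mlieBracket_zero_right]
  | insert a t ha ih =>
    rw [Finset.sum_insert ha, Finset.sum_insert ha, ← ih, VectorField.mlieBracket_add_right
      (((hf a).smul_section (hX a)).mdiffAt_vectorField x) ((hs t).mdiffAt_vectorField x),
      VectorField.mlieBracket_smul_right ((hf a x).mdifferentiableAt (by simp))
        ((hX a).mdiffAt_vectorField x)]

namespace LieAlgebroid

variable {A : LieAlgebroid EM F E}

theorem prolongBracket_swap (A : LieAlgebroid EM F E) (ξ ζ : AmbientSection EM F E) :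
    A.prolongBracket ξ ζ = -A.prolongBracket ζ ξ := by
  ext1 u
  refine Prod.ext ?_ ?_
  · rw [Pi.neg_apply, Prod.fst_neg, prolongBracket_fst, prolongBracket_fst, A.constBracket_swap]
    abel
  · rw [Pi.neg_apply, Prod.snd_neg, prolongBracket_snd, prolongBracket_snd,
      VectorField.mlieBracket_swap_apply]

/-- The derivation property of the bracket with a complete lift. In the second components this is
the Jacobi identity for vector fields; in the first components it reduces, for sections expanded in
a local frame, to the Jacobi identity of the algebroid. -/
theorem prolongBracket_completeLift_prolongBracket (A : LieAlgebroid EM F E)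
    (η : Cₛ^∞⟮𝓑; F, E⟯) {ξ ζ : AmbientSection EM F E}
    (hξ : A.IsProlongationSection ξ) (hζ : A.IsProlongationSection ζ) :
    A.prolongBracket (A.completeLift η) (A.prolongBracket ξ ζ)
      = A.prolongBracket (A.prolongBracket (A.completeLift η) ξ) ζ
        + A.prolongBracket ξ (A.prolongBracket (A.completeLift η) ζ) := by
  have hη := A.isProlongationSection_completeLift η
  have hηξ := hη.prolongBracket hξ
  have hηζ := hη.prolongBracket hζ
  have hξζ := hξ.prolongBracket hζ
  ext1 u
  refine Prod.ext ?_ ?_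
  · obtain ⟨fr⟩ := exists_localFrame (EM := EM) (F := F) (E := E) u.proj
    have hu := fr.mem_U
    rw [Pi.add_apply, Prod.fst_add, prolongBracket_completeLift_fst (hξζ.mem_prolongation u)]
    set f := fr.coeff (fun w => (ξ w).1) with hf_def
    set g := fr.coeff (fun w => (ζ w).1) with hg_def
    have hf : ∀ i, ContMDiff 𝓣 𝓘(ℝ, ℝ) ∞ (f i) := fr.contMDiff_coeff hξ.smooth_fst
    have hg : ∀ i, ContMDiff 𝓣 𝓘(ℝ, ℝ) ∞ (g i) := fr.contMDiff_coeff hζ.smooth_fst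
    have hηf : ∀ i, ContMDiff 𝓣 𝓘(ℝ, ℝ) ∞ (fun w => mvfderiv 𝓣 (f i) w (A.completeLiftField η w)) :=
      fun i => A.contMDiff_mvfderiv_completeLiftField η (hf i)
    have hηg : ∀ i, ContMDiff 𝓣 𝓘(ℝ, ℝ) ∞ (fun w => mvfderiv 𝓣 (g i) w (A.completeLiftField η w)) :=
      fun i => A.contMDiff_mvfderiv_completeLiftField η (hg i)
    have hζf : ∀ i, ContMDiff 𝓣 𝓘(ℝ, ℝ) ∞ (fun w => mvfderiv 𝓣 (f i) w (ζ w).2) :=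
      fun i => (hf i).mvfderiv_apply hζ.smooth_snd
    have hξg : ∀ i, ContMDiff 𝓣 𝓘(ℝ, ℝ) ∞ (fun w => mvfderiv 𝓣 (g i) w (ξ w).2) :=
      fun i => (hg i).mvfderiv_apply hξ.smooth_snd
    have eξ : ∀ᶠ w in 𝓝 u, (ξ w).1 = ∑ i, f i w • fr.s i w.proj := fr.eventually_eq_sum _ hu
    have eζ : ∀ᶠ w in 𝓝 u, (ζ w).1 = ∑ i, g i w • fr.s i w.proj := fr.eventually_eq_sum _ hu
    -- expand the three brackets in the frame sections and their brackets; the index types are sums,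
    -- one summand for each kind of term
    have e1 := A.lieAlong_eq_sum η (σ := jMap (A.prolongBracket ξ ζ)) (u := u)
      (f := Sum.elim (fun (p : Fin (Module.finrank ℝ F) × Fin (Module.finrank ℝ F)) w =>
          f p.1 w * g p.2 w)
        (fun i w => mvfderiv 𝓣 (g i) w (ξ w).2 - mvfderiv 𝓣 (f i) w (ζ w).2))
      (by
        rintro (p | i)
        · exact (hf p.1).mul (hg p.2)
        · exact (hξg i).sub (hζf i))
      (s := Sum.elim (fun p => A.bracket (fr.s p.1) (fr.s p.2)) fr.s)
      (by
        filter_upwards [fr.eventually_mem hu] with w hw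
        refine (hξ.prolongBracket_fst_eq_frame hζ fr hw).trans ?_
        simp only [Fintype.sum_sum_type, Sum.elim_inl, Sum.elim_inr, Fintype.sum_prod_type,
          sub_smul, Finset.sum_sub_distrib]
        rw [add_sub_assoc])
    have eηξ : ∀ᶠ w in 𝓝 u, (A.prolongBracket (A.completeLift η) ξ w).1
        = ∑ k, (Sum.elim f fun i w => mvfderiv 𝓣 (f i) w (A.completeLiftField η w)) k w
          • (Sum.elim (fun i => A.bracket η (fr.s i)) fr.s) k w.proj := by
      filter_upwards [eξ.eventually_nhds] with w hw
      rw [prolongBracket_completeLift_fst (hξ.mem_prolongation w),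
        A.lieAlong_eq_sum η (σ := jMap ξ) hf hw,
        Fintype.sum_sum_type]
      rfl
    have eηζ : ∀ᶠ w in 𝓝 u, (A.prolongBracket (A.completeLift η) ζ w).1
        = ∑ k, (Sum.elim g fun i w => mvfderiv 𝓣 (g i) w (A.completeLiftField η w)) k w
          • (Sum.elim (fun i => A.bracket η (fr.s i)) fr.s) k w.proj := by
      filter_upwards [eζ.eventually_nhds] with w hw
      rw [prolongBracket_completeLift_fst (hζ.mem_prolongation w),
        A.lieAlong_eq_sum η (σ := jMap ζ) hg hw,
        Fintype.sum_sum_type]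
      rfl
    have e2 := A.prolongBracket_fst_eq_sum (hηξ.mem_prolongation u) (hζ.mem_prolongation u)
      (by
        rintro (i | i)
        · exact hf i
        · exact hηf i) eηξ hg eζ
    have e3 := A.prolongBracket_fst_eq_sum (hξ.mem_prolongation u) (hηζ.mem_prolongation u)
      hf eξ (by
        rintro (i | i)
        · exact hg i
        · exact hηg i) eηζ
    rw [e1, e2, e3]
    have dmul : ∀ i j, mvfderiv 𝓣 (fun w => f i w * g j w) u (A.completeLiftField η u)
        = f i u * mvfderiv 𝓣 (g j) u (A.completeLiftField η u)
          + mvfderiv 𝓣 (f i) u (A.completeLiftField η u) * g j u := by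
      intro i j
      refine Eq.trans (DFunLike.congr_fun (mvfderiv_mul ((hf i u).mdifferentiableAt (by simp))
        ((hg j u).mdifferentiableAt (by simp))) (A.completeLiftField η u)) ?_
      simp only [_root_.add_apply, _root_.smul_apply, smul_eq_mul]
      ring
    have dsub : ∀ i, mvfderiv 𝓣 (fun w => mvfderiv 𝓣 (g i) w (ξ w).2 - mvfderiv 𝓣 (f i) w (ζ w).2) u
          (A.completeLiftField η u)
        = mvfderiv 𝓣 (fun w => mvfderiv 𝓣 (g i) w (ξ w).2) u (A.completeLiftField η u)
          - mvfderiv 𝓣 (fun w => mvfderiv 𝓣 (f i) w (ζ w).2) u (A.completeLiftField η u) := by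
      intro i
      exact DFunLike.congr_fun (mvfderiv_sub ((hξg i u).mdifferentiableAt (by simp))
        ((hζf i u).mdifferentiableAt (by simp))) (A.completeLiftField η u)
    have dξ : ∀ i, mvfderiv 𝓣 (g i) u (A.prolongBracket (A.completeLift η) ξ u).2
        = mvfderiv 𝓣 (fun w => mvfderiv 𝓣 (g i) w (ξ w).2) u (A.completeLiftField η u)
          - mvfderiv 𝓣 (fun w => mvfderiv 𝓣 (g i) w (A.completeLiftField η w)) u (ξ u).2 :=
      fun i => mvfderiv_mlieBracket hη.smooth_snd hξ.smooth_snd (hg i) u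
    have dζ : ∀ i, mvfderiv 𝓣 (f i) u (A.prolongBracket (A.completeLift η) ζ u).2
        = mvfderiv 𝓣 (fun w => mvfderiv 𝓣 (f i) w (ζ w).2) u (A.completeLiftField η u)
          - mvfderiv 𝓣 (fun w => mvfderiv 𝓣 (f i) w (A.completeLiftField η w)) u (ζ u).2 :=
      fun i => mvfderiv_mlieBracket hη.smooth_snd hζ.smooth_snd (hf i) u
    have jac : ∀ i j, A.bracket η (A.bracket (fr.s i) (fr.s j)) u.proj
        = A.bracket (A.bracket η (fr.s i)) (fr.s j) u.proj
          + A.bracket (fr.s i) (A.bracket η (fr.s j)) u.proj := by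
      intro i j
      rw [A.jacobi]
      rfl
    simp only [Fintype.sum_sum_type, Sum.elim_inl, Sum.elim_inr, Fintype.sum_prod_type, dmul, dsub,
      dξ, dζ, jac, smul_add, add_smul, sub_smul, Finset.sum_add_distrib, Finset.sum_sub_distrib]
    abel
  · rw [Pi.add_apply, Prod.snd_add]
    exact mlieBracket_jacobi_infty hη.smooth_snd hξ.smooth_snd hζ.smooth_snd u

namespace IsProlongationSection

variable {ξ ζ : AmbientSection EM F E}

theorem add (hξ : A.IsProlongationSection ξ) (hζ : A.IsProlongationSection ζ) :
    A.IsProlongationSection (ξ + ζ) where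
  mem_prolongation u := by
    change A.anchor u.proj ((ξ u).1 + (ζ u).1) = projDeriv u ((ξ u).2 + (ζ u).2)
    rw [map_add, map_add, hξ.projDeriv_snd, hζ.projDeriv_snd]
  smooth_fst := hξ.smooth_fst.add hζ.smooth_fst
  smooth_snd := hξ.smooth_snd.add_section hζ.smooth_snd

theorem smul {f : TotalSpace F E → ℝ} (hf : ContMDiff 𝓣 𝓘(ℝ, ℝ) ∞ f)
    (hξ : A.IsProlongationSection ξ) : A.IsProlongationSection (f • ξ) where
  mem_prolongation u := by
    change A.anchor u.proj (f u • (ξ u).1) = projDeriv u (f u • (ξ u).2)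
    rw [map_smul, map_smul, hξ.projDeriv_snd]
  smooth_fst := hξ.smooth_fst.smul hf
  smooth_snd := hf.smul_section hξ.smooth_snd

theorem const_smul (c : ℝ) (hξ : A.IsProlongationSection ξ) : A.IsProlongationSection (c • ξ) :=
  hξ.smul (f := fun _ => c) contMDiff_const

theorem sub (hξ : A.IsProlongationSection ξ) (hζ : A.IsProlongationSection ζ) :
    A.IsProlongationSection (ξ - ζ) := by
  have := hξ.add (hζ.const_smul (-1))
  rwa [neg_one_smul, ← sub_eq_add_neg] at this

theorem zero : A.IsProlongationSection (0 : AmbientSection EM F E) := by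
  simpa using (A.isProlongationSection_completeLift 0).const_smul 0

theorem sum {ι : Type*} (t : Finset ι) {ξ : ι → AmbientSection EM F E}
    (hξ : ∀ i ∈ t, A.IsProlongationSection (ξ i)) : A.IsProlongationSection (∑ i ∈ t, ξ i) :=
  Finset.sum_induction _ A.IsProlongationSection (fun _ _ => .add) .zero hξ

theorem of_eventuallyEq (h : ∀ u, ∃ ζ, A.IsProlongationSection ζ ∧ ∀ᶠ w in 𝓝 u, ξ w = ζ w) :
    A.IsProlongationSection ξ where
  mem_prolongation u := by
    obtain ⟨ζ, hζ, he⟩ := h u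
    rw [he.self_of_nhds]
    exact hζ.mem_prolongation u
  smooth_fst := isSmoothPullbackSection_of_eventuallyEq fun u => by
    obtain ⟨ζ, hζ, he⟩ := h u
    exact ⟨_, hζ.smooth_fst, he.mono fun w hw => by rw [hw]⟩
  smooth_snd u := by
    obtain ⟨ζ, hζ, he⟩ := h u
    exact (hζ.smooth_snd u).congr_of_eventuallyEq (he.mono fun w hw => by simp only [hw])

theorem prolongBracket_add_right {ζ' : AmbientSection EM F E} (ξ : AmbientSection EM F E)
    (hζ : A.IsProlongationSection ζ) (hζ' : A.IsProlongationSection ζ') :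
    A.prolongBracket ξ (ζ + ζ') = A.prolongBracket ξ ζ + A.prolongBracket ξ ζ' := by
  ext1 u
  refine Prod.ext ?_ ?_
  · rw [Pi.add_apply, Prod.fst_add, prolongBracket_fst, prolongBracket_fst, prolongBracket_fst,
      Pi.add_apply, Prod.fst_add, Prod.snd_add, map_add, componentDeriv_add_right]
    have h := componentDeriv_add (u := u) (z := (ξ u).2) hζ.smooth_fst hζ'.smooth_fst
    rw [show componentDeriv (fun w => ((ζ + ζ') w).1) u (ξ u).2 = _ from h]
    abel
  · rw [Pi.add_apply, Prod.snd_add]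
    have : IsManifold 𝓣 (minSmoothness ℝ 2) (TotalSpace F E) := by
      rw [minSmoothness_of_isRCLikeNormedField]
      exact IsManifold.of_le (n := ∞) (WithTop.coe_le_coe.2 le_top)
    exact VectorField.mlieBracket_add_right (hζ.smooth_snd.mdiffAt_vectorField u)
      (hζ'.smooth_snd.mdiffAt_vectorField u)

theorem prolongBracket_const_smul_right (ξ : AmbientSection EM F E) (c : ℝ)
    (hζ : A.IsProlongationSection ζ) :
    A.prolongBracket ξ (c • ζ) = c • A.prolongBracket ξ ζ := by
  ext1 u
  refine Prod.ext ?_ ?_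
  · rw [Pi.smul_apply, Prod.smul_fst, prolongBracket_fst, prolongBracket_fst,
      Pi.smul_apply, Prod.smul_fst, Prod.smul_snd, map_smul, componentDeriv_smul_right]
    have h := componentDeriv_smul (f := fun _ => c) (u := u) (z := (ξ u).2)
      mdifferentiableAt_const hζ.smooth_fst
    rw [mvfderiv_const, _root_.zero_apply, zero_smul, zero_add] at h
    rw [show componentDeriv (fun w => ((c • ζ) w).1) u (ξ u).2 = _ from h, smul_sub, smul_add]
  · rw [Pi.smul_apply, Prod.smul_snd]
    have : IsManifold 𝓣 (minSmoothness ℝ 2) (TotalSpace F E) := by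
      rw [minSmoothness_of_isRCLikeNormedField]
      exact IsManifold.of_le (n := ∞) (WithTop.coe_le_coe.2 le_top)
    exact VectorField.mlieBracket_const_smul_right (hζ.smooth_snd.mdiffAt_vectorField u)

theorem prolongBracket_sub_right {ζ' : AmbientSection EM F E} (ξ : AmbientSection EM F E)
    (hζ : A.IsProlongationSection ζ) (hζ' : A.IsProlongationSection ζ') :
    A.prolongBracket ξ (ζ - ζ') = A.prolongBracket ξ ζ - A.prolongBracket ξ ζ' := by
  rw [sub_eq_add_neg, ← neg_one_smul ℝ ζ', prolongBracket_add_right ξ hζ (hζ'.const_smul _),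
    prolongBracket_const_smul_right ξ _ hζ', neg_one_smul, sub_eq_add_neg]

theorem prolongBracket_zero_right (A : LieAlgebroid EM F E) (ξ : AmbientSection EM F E) :
    A.prolongBracket ξ 0 = 0 := by
  simpa using prolongBracket_const_smul_right (A := A) ξ 0 zero

end IsProlongationSection

end LieAlgebroid

end Derivation

/-! ### The Berwald connection of a spray -/

section Berwald

set_option linter.unusedSectionVars false

variable {EM : Type*} [NormedAddCommGroup EM] [NormedSpace ℝ EM]
  {M : Type*} [TopologicalSpace M] [ChartedSpace EM M] [IsManifold 𝓘(ℝ, EM) ∞ M]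
  {F : Type*} [NormedAddCommGroup F] [NormedSpace ℝ F]
  {E : M → Type*} [TopologicalSpace (TotalSpace F E)]
  [∀ x, AddCommGroup (E x)] [∀ x, Module ℝ (E x)] [∀ x, TopologicalSpace (E x)]
  [FiberBundle F E] [VectorBundle ℝ F E] [ContMDiffVectorBundle ∞ F E 𝓘(ℝ, EM)]
  [FiniteDimensional ℝ EM] [T2Space M] [FiniteDimensional ℝ F]

local notation "𝓑" => 𝓘(ℝ, EM)
local notation "𝓣" => ModelWithCorners.prod 𝓘(ℝ, EM) 𝓘(ℝ, F)

theorem vertLift_zero (u : TotalSpace F E) : vertLift EM u 0 = 0 := by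
  simpa using vertLift_smul (EM := EM) u 0 0

namespace LieAlgebroid

variable {A : LieAlgebroid EM F E}

theorem isProlongationSection_verticalLift (A : LieAlgebroid EM F E) (s : Cₛ^∞⟮𝓑; F, E⟯) :
    A.IsProlongationSection (verticalLift s) :=
  A.isProlongationSection_iMap (isSmoothPullbackSection_comp_proj s)

theorem completeLift_add (s t : Cₛ^∞⟮𝓑; F, E⟯) :
    A.completeLift (s + t) = A.completeLift s + A.completeLift t := by
  ext1 u
  refine Prod.ext rfl (totalSpace_tangent_ext ?_ ?_)
  · change projDeriv u (A.completeLiftField _ u)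
      = projDeriv u (A.completeLiftField s u + A.completeLiftField t u)
    rw [map_add]
    simp only [projDeriv_completeLiftField]
    exact map_add (A.anchor u.proj) _ _
  · change vertLiftInv u (A.completeLiftField _ u)
      = vertLiftInv u (A.completeLiftField s u + A.completeLiftField t u)
    simp only [vertLiftInv_add, vertLiftInv_completeLiftField, map_add]
    rfl

theorem completeLift_smul (c : ℝ) (s : Cₛ^∞⟮𝓑; F, E⟯) :
    A.completeLift (c • s) = c • A.completeLift s := by
  ext1 u
  refine Prod.ext rfl (totalSpace_tangent_ext ?_ ?_)
  · change projDeriv u (A.completeLiftField _ u) = projDeriv u (c • A.completeLiftField s u)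
    rw [map_smul]
    simp only [projDeriv_completeLiftField]
    exact map_smul (A.anchor u.proj) _ _
  · change vertLiftInv u (A.completeLiftField _ u) = vertLiftInv u (c • A.completeLiftField s u)
    simp only [vertLiftInv_smul, vertLiftInv_completeLiftField, map_smul]
    rfl

theorem verticalLift_add (s t : Cₛ^∞⟮𝓑; F, E⟯) :
    verticalLift (s + t) = verticalLift s + verticalLift t := by
  ext1 u
  exact Prod.ext (add_zero 0).symm (vertLift_add u _ _)

theorem verticalLift_smul (c : ℝ) (s : Cₛ^∞⟮𝓑; F, E⟯) :
    verticalLift (c • s) = c • verticalLift s := by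
  ext1 u
  exact Prod.ext (smul_zero c).symm (vertLift_smul u _ _)

/-- The section `(1/2) (s^C + ⟦s^V, S⟧)` of the prolongation, which the Berwald connection assigns
to `s ∘ π`. -/
noncomputable def berwaldLift (A : LieAlgebroid EM F E) (S : AmbientSection EM F E) :
    Cₛ^∞⟮𝓑; F, E⟯ →ₗ[ℝ] AmbientSection EM F E where
  toFun s := (1 / 2 : ℝ) • (A.completeLift s + A.prolongBracket (verticalLift s) S)
  map_add' s t := by
    rw [A.prolongBracket_swap (verticalLift (s + t)), A.prolongBracket_swap (verticalLift s),
      A.prolongBracket_swap (verticalLift t), completeLift_add, verticalLift_add,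
      IsProlongationSection.prolongBracket_add_right _ (A.isProlongationSection_verticalLift s)
        (A.isProlongationSection_verticalLift t), ← smul_add]
    congr 1
    abel
  map_smul' c s := by
    rw [A.prolongBracket_swap (verticalLift (c • s)), A.prolongBracket_swap (verticalLift s),
      completeLift_smul, verticalLift_smul, IsProlongationSection.prolongBracket_const_smul_right
        _ _ (A.isProlongationSection_verticalLift s), RingHom.id_apply, smul_comm c, ← smul_neg,
      ← smul_add]

variable {S : AmbientSection EM F E}

theorem berwaldLift_apply (s : Cₛ^∞⟮𝓑; F, E⟯) : A.berwaldLift S s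
    = (1 / 2 : ℝ) • (A.completeLift s + A.prolongBracket (verticalLift s) S) := rfl

theorem berwald_eq_berwaldLift (σ : PullbackSection F E) (u : TotalSpace F E) :
    A.berwald S σ u = A.berwaldLift S (sectionThrough (σ u)) u := rfl

theorem isProlongationSection_berwaldLift (hS : A.IsProlongationSection S)
    (s : Cₛ^∞⟮𝓑; F, E⟯) : A.IsProlongationSection (A.berwaldLift S s) :=
  ((A.isProlongationSection_completeLift s).add
    ((A.isProlongationSection_verticalLift s).prolongBracket hS)).const_smul _

namespace IsSpray

theorem fst_apply (hS : A.IsSpray S) (u : TotalSpace F E) : (S u).1 = u.snd :=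
  vertLift_injective (congrArg Prod.snd (congrFun hS.semispray u))

theorem prolongBracket_verticalLift_fst (hS : A.IsSpray S) (s : Cₛ^∞⟮𝓑; F, E⟯)
    (u : TotalSpace F E) : (A.prolongBracket (verticalLift s) S u).1 = s u.proj := by
  rw [prolongBracket_fst]
  change A.constBracket u.proj 0 _ + componentDeriv (fun w => (S w).1) u (vertLift EM u (s u.proj))
    - componentDeriv (fun w => 0) u _ = _
  rw [componentDeriv_zero, map_zero, LinearMap.zero_apply, zero_add, sub_zero]
  simp only [hS.fst_apply]
  exact vertLiftInv_vertLift u _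

theorem berwaldLift_fst (hS : A.IsSpray S) (s : Cₛ^∞⟮𝓑; F, E⟯) (u : TotalSpace F E) :
    (A.berwaldLift S s u).1 = s u.proj := by
  change (1 / 2 : ℝ) • (s u.proj + (A.prolongBracket (verticalLift s) S u).1) = _
  rw [hS.prolongBracket_verticalLift_fst, ← two_smul ℝ, smul_smul]
  norm_num

/-- The lift `(1/2) (s^C + ⟦s^V, S⟧)` is tensorial in `s`: the first derivatives of `s` in the
complete lift and in the bracket with the vertical lift cancel. -/
theorem berwaldLift_eq_zero (hS : A.IsSpray S) {s : Cₛ^∞⟮𝓑; F, E⟯} {u : TotalSpace F E}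
    (hs : s u.proj = 0) : A.berwaldLift S s u = 0 := by
  have hfst : (A.berwaldLift S s u).1 = 0 := by rw [hS.berwaldLift_fst, hs]
  have hV := A.isProlongationSection_verticalLift s
  have hP := hV.prolongBracket hS.isSection
  refine Prod.ext hfst (totalSpace_tangent_ext ?_ ?_)
  · rw [(isProlongationSection_berwaldLift hS.isSection s).projDeriv_snd, hfst, Prod.snd_zero,
      map_zero, map_zero]
  obtain ⟨fr⟩ := exists_localFrame (EM := EM) (F := F) (E := E) u.proj
  have hu := fr.mem_U
  have hproj : projDeriv u (A.prolongBracket (verticalLift s) S u).2 = 0 := by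
    rw [hP.projDeriv_snd, hS.prolongBracket_verticalLift_fst, hs, map_zero]
  have h1 : vertLiftInv u (A.completeLiftField s u)
      = baseDeriv s u.proj (A.anchor u.proj u.snd) := by
    rw [vertLiftInv_completeLiftField, A.bracket_apply, sectionThrough_apply_self, hs, map_zero,
      baseDeriv_sectionThrough, zero_add, sub_zero]
  have h2 : vertLiftInv u (A.prolongBracket (verticalLift s) S u).2
      = -baseDeriv s u.proj (A.anchor u.proj u.snd) := by
    have hc : ∀ i, (fun w => mvfderiv 𝓣 (fr.coord i) w (verticalLift (EM := EM) s w).2)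
        =ᶠ[𝓝 u] fr.coeff (fun w => s w.proj) i := fun i =>
      (fr.eventually_mem hu).mono fun w hw => fr.mvfderiv_coord_vertLift hw (fun w => s w.proj) i
    have hv : (verticalLift s u).2 = 0 := by
      change vertLift EM u (s u.proj) = 0
      rw [hs, vertLift_zero]
    -- the coefficients of `s ∘ π` vanish at `u`, so its component derivative is the sum of their
    -- derivatives
    have h3 := componentDeriv_comp_proj s u (S u).2
    rw [fr.componentDeriv_eq (isSmoothPullbackSection_comp_proj s) hu] at h3
    have h4 : ∀ i, fr.coeff (fun w => s w.proj) i u = 0 := fun i =>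
      (fr.eq_coeff (σ := fun w => s w.proj) hu (c := 0) (by simp [hs]) i).symm
    simp only [h4, zero_smul, Finset.sum_const_zero, add_zero] at h3
    change _ = baseDeriv s u.proj (projDeriv u (S u).2) at h3
    rw [hS.isSection.projDeriv_snd, hS.fst_apply] at h3
    rw [fr.vertLiftInv_eq_of_vertical hu hproj, prolongBracket_snd, ← h3,
      ← Finset.sum_neg_distrib]
    refine Finset.sum_congr rfl fun i _ => ?_
    rw [mvfderiv_mlieBracket hV.smooth_snd hS.isSection.smooth_snd (fr.contMDiff_coord i),
      (hc i).mvfderiv_eq, hv, map_zero, zero_sub, neg_smul]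
  change vertLiftInv u ((1 / 2 : ℝ) • (A.completeLiftField s u
    + (A.prolongBracket (verticalLift s) S u).2)) = vertLiftInv u 0
  rw [vertLiftInv_smul, vertLiftInv_add, h1, h2, add_neg_cancel, smul_zero]
  exact componentDeriv_zero_right.symm

theorem berwaldLift_congr (hS : A.IsSpray S) {s t : Cₛ^∞⟮𝓑; F, E⟯} {u : TotalSpace F E}
    (h : s u.proj = t u.proj) : A.berwaldLift S s u = A.berwaldLift S t u := by
  rw [← sub_eq_zero, ← Pi.sub_apply, ← map_sub]
  exact hS.berwaldLift_eq_zero (sub_eq_zero.2 h)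

theorem berwald_eq_of_apply_eq (hS : A.IsSpray S) {σ : PullbackSection F E}
    {s : Cₛ^∞⟮𝓑; F, E⟯} {u : TotalSpace F E} (h : σ u = s u.proj) :
    A.berwald S σ u = A.berwaldLift S s u :=
  hS.berwaldLift_congr ((sectionThrough_apply_self _).trans h)

theorem berwald_add (hS : A.IsSpray S) (σ τ : PullbackSection F E) :
    A.berwald S (σ + τ) = A.berwald S σ + A.berwald S τ := by
  ext1 u
  rw [Pi.add_apply, berwald_eq_berwaldLift σ, berwald_eq_berwaldLift τ, ← Pi.add_apply, ← map_add]
  refine hS.berwald_eq_of_apply_eq ?_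
  rw [ContMDiffSection.coe_add, Pi.add_apply, Pi.add_apply, sectionThrough_apply_self,
    sectionThrough_apply_self]

theorem berwald_eq_sum_smul (hS : A.IsSpray S) {ι : Type*} [Fintype ι] {σ : PullbackSection F E}
    {u : TotalSpace F E} {c : ι → ℝ} {s : ι → Cₛ^∞⟮𝓑; F, E⟯}
    (h : σ u = ∑ i, c i • s i u.proj) :
    A.berwald S σ u = ∑ i, c i • A.berwaldLift S (s i) u := by
  rw [hS.berwald_eq_of_apply_eq (s := ∑ i, c i • s i) (by rw [h, section_sum_apply]; rfl), map_sum,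
    Finset.sum_apply]
  exact Finset.sum_congr rfl fun i _ => by rw [map_smul, Pi.smul_apply]

theorem jMap_berwald (hS : A.IsSpray S) (σ : PullbackSection F E) :
    jMap (A.berwald S σ) = σ := by
  ext u
  exact (hS.berwaldLift_fst _ u).trans (sectionThrough_apply_self _)

theorem isProlongationSection_sum_smul_berwaldLift (hS : A.IsSpray S) {ι : Type*} [Fintype ι]
    {f : ι → TotalSpace F E → ℝ} (hf : ∀ i, ContMDiff 𝓣 𝓘(ℝ, ℝ) ∞ (f i))
    (s : ι → Cₛ^∞⟮𝓑; F, E⟯) :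
    A.IsProlongationSection (∑ i, f i • A.berwaldLift S (s i)) :=
  .sum _ fun i _ => (isProlongationSection_berwaldLift hS.isSection (s i)).smul (hf i)

theorem isProlongationSection_berwald (hS : A.IsSpray S) {σ : PullbackSection F E}
    (hσ : IsSmoothPullbackSection EM σ) : A.IsProlongationSection (A.berwald S σ) := by
  refine .of_eventuallyEq fun u => ?_
  obtain ⟨fr⟩ := exists_localFrame (EM := EM) (F := F) (E := E) u.proj
  refine ⟨_, hS.isProlongationSection_sum_smul_berwaldLift (fr.contMDiff_coeff hσ) fr.s, ?_⟩
  filter_upwards [fr.eventually_mem fr.mem_U] with w hw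
  rw [hS.berwald_eq_sum_smul (fr.eq_sum σ hw), Finset.sum_apply]
  rfl

theorem prolongBracket_completeLift_self (hη : A.IsLieSymmetry S η) :
    A.prolongBracket (A.completeLift η) S = 0 := by
  rw [prolongBracket_swap, hη, neg_zero]

/-- A Lie symmetry commutes with the lift `s ↦ (1/2) (s^C + ⟦s^V, S⟧)`, since it preserves complete
lifts, vertical lifts and the spray. -/
theorem prolongBracket_completeLift_berwaldLift (hS : A.IsSpray S) {η : Cₛ^∞⟮𝓑; F, E⟯}
    (hη : A.IsLieSymmetry S η) (s : Cₛ^∞⟮𝓑; F, E⟯) :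
    A.prolongBracket (A.completeLift η) (A.berwaldLift S s)
      = A.berwaldLift S (A.bracket η s) := by
  have hC := A.isProlongationSection_completeLift s
  have hV := A.isProlongationSection_verticalLift s
  have hP := hV.prolongBracket hS.isSection
  rw [berwaldLift_apply, IsProlongationSection.prolongBracket_const_smul_right _ _ (hC.add hP),
    IsProlongationSection.prolongBracket_add_right _ hC hP,
    prolongBracket_completeLift_completeLift,
    A.prolongBracket_completeLift_prolongBracket η hV hS.isSection,
    prolongBracket_completeLift_verticalLift, A.prolongBracket_swap (A.completeLift η) S, hη,
    neg_zero, IsProlongationSection.prolongBracket_zero_right, add_zero]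
  rfl

/-- A Lie symmetry of a spray commutes with the Berwald connection. -/
theorem prolongBracket_completeLift_berwald (hS : A.IsSpray S) {η : Cₛ^∞⟮𝓑; F, E⟯}
    (hη : A.IsLieSymmetry S η) {σ : PullbackSection F E} (hσ : IsSmoothPullbackSection EM σ) :
    A.prolongBracket (A.completeLift η) (A.berwald S σ) = A.berwald S (A.lieAlong η σ) := by
  have hH := hS.isProlongationSection_berwald hσ
  ext1 u
  refine Prod.ext ?_ ?_
  · rw [prolongBracket_completeLift_fst (hH.mem_prolongation u), hS.jMap_berwald]
    exact (congrFun (hS.jMap_berwald _) u).symm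
  obtain ⟨fr⟩ := exists_localFrame (EM := EM) (F := F) (E := E) u.proj
  have hf := fr.contMDiff_coeff hσ
  have hu := fr.mem_U
  let X : Fin (Module.finrank ℝ F) → Π w : TotalSpace F E, TangentSpace 𝓣 w :=
    fun i w => (A.berwaldLift S (fr.s i) w).2
  have hX : ∀ i, CMDiff ∞ (T% (X i)) := fun i =>
    (isProlongationSection_berwaldLift hS.isSection (fr.s i)).smooth_snd
  have h1 : ∀ᶠ w in 𝓝 u, (A.berwald S σ w).2 = (∑ i, fr.coeff σ i • X i) w := by
    filter_upwards [fr.eventually_mem hu] with w hw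
    rw [hS.berwald_eq_sum_smul (fr.eq_sum σ hw), Prod.snd_sum]
    exact (Finset.sum_apply w Finset.univ fun i => fr.coeff σ i • X i).symm
  rw [prolongBracket_snd]
  refine (Filter.EventuallyEq.rfl.mlieBracket_vectorField_eq h1).trans
    ((mlieBracket_sum_smul_right Finset.univ _ hf hX u).trans ?_)
  have h2 := A.lieAlong_eq_sum η hf (fr.eventually_eq_sum σ hu)
  rw [hS.berwald_eq_sum_smul (s := Sum.elim (fun i => A.bracket η (fr.s i)) fr.s)
    (c := Sum.elim (fun i => fr.coeff σ i u)
      fun i => mvfderiv 𝓣 (fr.coeff σ i) u (A.completeLiftField η u))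
    (by rw [h2, Fintype.sum_sum_type]; rfl), Fintype.sum_sum_type, Prod.snd_add, Prod.snd_sum,
    Prod.snd_sum, Finset.sum_add_distrib, add_comm]
  congr 1
  refine Finset.sum_congr rfl fun i _ => ?_
  rw [Sum.elim_inl, Sum.elim_inl, ← hS.prolongBracket_completeLift_berwaldLift hη]
  rfl

end IsSpray

end LieAlgebroid

end Berwald

/-! ### Tensor fields invariant under a Lie symmetry -/

section Invariance

set_option linter.unusedSectionVars false

variable {EM : Type*} [NormedAddCommGroup EM] [NormedSpace ℝ EM]
  {M : Type*} [TopologicalSpace M] [ChartedSpace EM M] [IsManifold 𝓘(ℝ, EM) ∞ M]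
  {F : Type*} [NormedAddCommGroup F] [NormedSpace ℝ F]
  {E : M → Type*} [TopologicalSpace (TotalSpace F E)]
  [∀ x, AddCommGroup (E x)] [∀ x, Module ℝ (E x)] [∀ x, TopologicalSpace (E x)]
  [FiberBundle F E] [VectorBundle ℝ F E] [ContMDiffVectorBundle ∞ F E 𝓘(ℝ, EM)]
  [FiniteDimensional ℝ EM] [T2Space M] [FiniteDimensional ℝ F]

local notation "𝓑" => 𝓘(ℝ, EM)
local notation "𝓣" => ModelWithCorners.prod 𝓘(ℝ, EM) 𝓘(ℝ, F)

namespace LieAlgebroid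

variable {A : LieAlgebroid EM F E} {S : AmbientSection EM F E}

theorem prolongBracket_add_left {ξ ξ' : AmbientSection EM F E} (hξ : A.IsProlongationSection ξ)
    (hξ' : A.IsProlongationSection ξ') (ζ : AmbientSection EM F E) :
    A.prolongBracket (ξ + ξ') ζ = A.prolongBracket ξ ζ + A.prolongBracket ξ' ζ := by
  rw [A.prolongBracket_swap (ξ + ξ'), A.prolongBracket_swap ξ, A.prolongBracket_swap ξ',
    IsProlongationSection.prolongBracket_add_right ζ hξ hξ']
  abel

theorem iMap_add (σ τ : PullbackSection F E) :
    iMap (EM := EM) (σ + τ) = iMap σ + iMap τ := by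
  ext1 u
  exact Prod.ext (add_zero 0).symm (vertLift_add u _ _)

theorem iMap_injective : Function.Injective (iMap (EM := EM) (F := F) (E := E)) :=
  fun _ _ h => funext fun u => vertLift_injective (congrArg Prod.snd (congrFun h u))

theorem isSmoothPullbackSection_iInv {ζ : AmbientSection EM F E}
    (hζ : A.IsProlongationSection ζ) (h0 : ∀ u, (ζ u).1 = 0) :
    IsSmoothPullbackSection EM (iInv ζ) := by
  refine isSmoothPullbackSection_of_eventuallyEq fun u => ?_
  obtain ⟨fr⟩ := exists_localFrame (EM := EM) (F := F) (E := E) u.proj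
  refine ⟨_, isSmoothPullbackSection_sum_smul
    (fun i => (fr.contMDiff_coord i).mvfderiv_apply hζ.smooth_snd) fr.s, ?_⟩
  filter_upwards [fr.eventually_mem fr.mem_U] with w hw
  exact fr.vertLiftInv_eq_of_vertical hw (by rw [hζ.projDeriv_snd, h0, map_zero])

theorem lieAlong_jMap (η : Cₛ^∞⟮𝓑; F, E⟯) {ζ : AmbientSection EM F E}
    (hζ : A.IsProlongationSection ζ) :
    A.lieAlong η (jMap ζ) = jMap (A.prolongBracket (A.completeLift η) ζ) := by
  ext u
  exact (prolongBracket_completeLift_fst (hζ.mem_prolongation u) η).symm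

theorem lieAlong_sum (η : Cₛ^∞⟮𝓑; F, E⟯) {ι : Type*} (t : Finset ι) {σ : ι → PullbackSection F E}
    (hσ : ∀ i, IsSmoothPullbackSection EM (σ i)) :
    A.lieAlong η (∑ i ∈ t, σ i) = ∑ i ∈ t, A.lieAlong η (σ i) := by
  classical
  induction t using Finset.induction_on with
  | empty => exact A.lieAlong_zero η
  | insert i t hi ih =>
    rw [Finset.sum_insert hi, Finset.sum_insert hi, ← ih,
      A.lieAlong_add η (hσ i) (isSmoothPullbackSection_sum t fun i _ => hσ i)]

namespace IsSpray

/-! #### The vertical map and the vertical derivative -/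

theorem sub_berwald_fst (hS : A.IsSpray S) (ζ : AmbientSection EM F E) (u : TotalSpace F E) :
    ((ζ - A.berwald S (jMap ζ)) u).1 = 0 := by
  rw [Pi.sub_apply, Prod.fst_sub]
  exact sub_eq_zero.2 (congrFun (hS.jMap_berwald (jMap ζ)) u).symm

theorem isProlongationSection_sub_berwald (hS : A.IsSpray S) {ζ : AmbientSection EM F E}
    (hζ : A.IsProlongationSection ζ) :
    A.IsProlongationSection (ζ - A.berwald S (jMap ζ)) :=
  hζ.sub (hS.isProlongationSection_berwald hζ.smooth_fst)

theorem iMap_vertMap (hS : A.IsSpray S) {ζ : AmbientSection EM F E}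
    (hζ : A.IsProlongationSection ζ) :
    iMap (A.vertMap S ζ) = ζ - A.berwald S (jMap ζ) := by
  ext1 u
  refine Prod.ext (hS.sub_berwald_fst ζ u).symm (vertLift_vertLiftInv ?_)
  rw [(hS.isProlongationSection_sub_berwald hζ).projDeriv_snd, hS.sub_berwald_fst, map_zero]

theorem isSmoothPullbackSection_vertMap (hS : A.IsSpray S) {ζ : AmbientSection EM F E}
    (hζ : A.IsProlongationSection ζ) : IsSmoothPullbackSection EM (A.vertMap S ζ) :=
  isSmoothPullbackSection_iInv (hS.isProlongationSection_sub_berwald hζ) (hS.sub_berwald_fst ζ)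

theorem vertMap_add (hS : A.IsSpray S) (ξ ζ : AmbientSection EM F E) :
    A.vertMap S (ξ + ζ) = A.vertMap S ξ + A.vertMap S ζ := by
  have h : ξ + ζ - A.berwald S (jMap (ξ + ζ))
      = (ξ - A.berwald S (jMap ξ)) + (ζ - A.berwald S (jMap ζ)) := by
    rw [show jMap (ξ + ζ) = jMap ξ + jMap ζ from rfl, hS.berwald_add]
    abel
  ext u
  rw [vertMap, h]
  exact vertLiftInv_add _ _

/-- A Lie symmetry commutes with the vertical map of the Berwald connection. -/
theorem lieAlong_vertMap {η : Cₛ^∞⟮𝓑; F, E⟯} (hS : A.IsSpray S) (hη : A.IsLieSymmetry S η)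
    {ζ : AmbientSection EM F E} (hζ : A.IsProlongationSection ζ) :
    A.lieAlong η (A.vertMap S ζ) = A.vertMap S (A.prolongBracket (A.completeLift η) ζ) := by
  have hηζ := (A.isProlongationSection_completeLift η).prolongBracket hζ
  refine iMap_injective (EM := EM) ?_
  rw [← A.prolongBracket_completeLift_iMap η (hS.isSmoothPullbackSection_vertMap hζ),
    hS.iMap_vertMap hζ, hS.iMap_vertMap hηζ, IsProlongationSection.prolongBracket_sub_right _ hζ
      (hS.isProlongationSection_berwald (σ := jMap ζ) hζ.smooth_fst),
    hS.prolongBracket_completeLift_berwald hη (σ := jMap ζ) hζ.smooth_fst,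
    lieAlong_jMap η hζ]

variable {σ τ : PullbackSection F E}

theorem isSmoothPullbackSection_vertDeriv (hS : A.IsSpray S) (hσ : IsSmoothPullbackSection EM σ)
    (hτ : IsSmoothPullbackSection EM τ) : IsSmoothPullbackSection EM (A.vertDeriv S σ τ) :=
  ((A.isProlongationSection_iMap hσ).prolongBracket
    (hS.isProlongationSection_berwald hτ)).smooth_fst

theorem vertDeriv_add_left {σ' : PullbackSection F E} (hσ : IsSmoothPullbackSection EM σ)
    (hσ' : IsSmoothPullbackSection EM σ') (τ : PullbackSection F E) :
    A.vertDeriv S (σ + σ') τ = A.vertDeriv S σ τ + A.vertDeriv S σ' τ := by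
  rw [vertDeriv, iMap_add, prolongBracket_add_left (A.isProlongationSection_iMap hσ)
    (A.isProlongationSection_iMap hσ')]
  rfl

theorem vertDeriv_add_right (hS : A.IsSpray S) {τ' : PullbackSection F E}
    (σ : PullbackSection F E) (hτ : IsSmoothPullbackSection EM τ)
    (hτ' : IsSmoothPullbackSection EM τ') :
    A.vertDeriv S σ (τ + τ') = A.vertDeriv S σ τ + A.vertDeriv S σ τ' := by
  rw [vertDeriv, hS.berwald_add, IsProlongationSection.prolongBracket_add_right _
    (hS.isProlongationSection_berwald hτ) (hS.isProlongationSection_berwald hτ')]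
  rfl

theorem vertDeriv_zero_right (hS : A.IsSpray S) (σ : PullbackSection F E) :
    A.vertDeriv S σ 0 = 0 := by
  have h := hS.vertDeriv_add_right σ (isSmoothPullbackSection_zero (EM := EM) (F := F) (E := E))
    isSmoothPullbackSection_zero
  rwa [add_zero, left_eq_add] at h

theorem vertDeriv_sum_right (hS : A.IsSpray S) (σ : PullbackSection F E) {ι : Type*}
    (t : Finset ι) {τ : ι → PullbackSection F E} (hτ : ∀ i, IsSmoothPullbackSection EM (τ i)) :
    A.vertDeriv S σ (∑ i ∈ t, τ i) = ∑ i ∈ t, A.vertDeriv S σ (τ i) := by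
  classical
  induction t using Finset.induction_on with
  | empty => exact hS.vertDeriv_zero_right σ
  | insert i t hi ih =>
    rw [Finset.sum_insert hi, Finset.sum_insert hi, ← ih,
      hS.vertDeriv_add_right σ (hτ i) (isSmoothPullbackSection_sum t fun i _ => hτ i)]

/-- A Lie symmetry acts on the vertical derivative by the Leibniz rule. -/
theorem lieAlong_vertDeriv {η : Cₛ^∞⟮𝓑; F, E⟯} (hS : A.IsSpray S) (hη : A.IsLieSymmetry S η)
    (hσ : IsSmoothPullbackSection EM σ) (hτ : IsSmoothPullbackSection EM τ) :
    A.lieAlong η (A.vertDeriv S σ τ)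
      = A.vertDeriv S (A.lieAlong η σ) τ + A.vertDeriv S σ (A.lieAlong η τ) := by
  have hi := A.isProlongationSection_iMap hσ
  have hH := hS.isProlongationSection_berwald hτ
  rw [vertDeriv, lieAlong_jMap η (hi.prolongBracket hH),
    A.prolongBracket_completeLift_prolongBracket η hi hH, A.prolongBracket_completeLift_iMap η hσ,
    hS.prolongBracket_completeLift_berwald hη hτ]
  rfl

end IsSpray

/-! #### Invariant multi-additive operators -/

/-- An operator on the smooth sections of `π^*E` which is additive in each argument and on which
the Lie derivative along `η` acts by the Leibniz rule. For tensor fields the last condition says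
that the Lie derivative vanishes; linearity over functions plays no role in it. -/
structure IsInvariant (A : LieAlgebroid EM F E) (η : Cₛ^∞⟮𝓑; F, E⟯) {k : ℕ}
    (T : (Fin k → PullbackSection F E) → PullbackSection F E) : Prop where
  smooth : ∀ a, (∀ i, IsSmoothPullbackSection EM (a i)) → IsSmoothPullbackSection EM (T a)
  map_update_add : ∀ a, (∀ i, IsSmoothPullbackSection EM (a i)) → ∀ i σ τ,
    IsSmoothPullbackSection EM σ → IsSmoothPullbackSection EM τ →
    T (Function.update a i (σ + τ)) = T (Function.update a i σ) + T (Function.update a i τ)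
  lieAlong_apply : ∀ a, (∀ i, IsSmoothPullbackSection EM (a i)) →
    A.lieAlong η (T a) = ∑ i, T (Function.update a i (A.lieAlong η (a i)))

theorem isSmoothPullbackSection_update {k : ℕ} {a : Fin k → PullbackSection F E}
    (ha : ∀ i, IsSmoothPullbackSection EM (a i)) {σ : PullbackSection F E}
    (hσ : IsSmoothPullbackSection EM σ) (i j : Fin k) :
    IsSmoothPullbackSection EM (Function.update a i σ j) := by
  by_cases h : j = i
  · rw [h, Function.update_self]; exact hσ
  · rw [Function.update_of_ne h]; exact ha j

namespace IsInvariant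

variable {k : ℕ} {T T' : (Fin k → PullbackSection F E) → PullbackSection F E}

theorem sub {η : Cₛ^∞⟮𝓑; F, E⟯} (hT : A.IsInvariant η T) (hT' : A.IsInvariant η T') :
    A.IsInvariant η (fun a => T a - T' a) where
  smooth a ha := (hT.smooth a ha).sub (hT'.smooth a ha)
  map_update_add a ha i σ τ hσ hτ := by
    rw [hT.map_update_add a ha i σ τ hσ hτ, hT'.map_update_add a ha i σ τ hσ hτ, add_sub_add_comm]
  lieAlong_apply a ha := by
    rw [A.lieAlong_sub η (hT.smooth a ha) (hT'.smooth a ha), hT.lieAlong_apply a ha,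
      hT'.lieAlong_apply a ha, Finset.sum_sub_distrib]

theorem const_smul {η : Cₛ^∞⟮𝓑; F, E⟯} (c : ℝ)
    (hT : A.IsInvariant η T) : A.IsInvariant η (fun a => c • T a) where
  smooth a ha := (hT.smooth a ha).const_smul c
  map_update_add a ha i σ τ hσ hτ := by rw [hT.map_update_add a ha i σ τ hσ hτ, smul_add]
  lieAlong_apply a ha := by
    rw [A.lieAlong_const_smul η c (hT.smooth a ha), hT.lieAlong_apply a ha, Finset.smul_sum]

theorem comp_perm {η : Cₛ^∞⟮𝓑; F, E⟯} (hT : A.IsInvariant η T) (e : Equiv.Perm (Fin k)) :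
    A.IsInvariant η (fun a => T (a ∘ e)) where
  smooth a ha := hT.smooth _ fun i => ha (e i)
  map_update_add a ha i σ τ hσ hτ := by
    simp only [Function.update_comp_equiv]
    exact hT.map_update_add (a ∘ e) (fun i => ha (e i)) _ σ τ hσ hτ
  lieAlong_apply a ha := by
    rw [hT.lieAlong_apply (a ∘ e) fun i => ha (e i), ← Equiv.sum_comp e.symm]
    refine Finset.sum_congr rfl fun i _ => ?_
    rw [Function.update_comp_equiv, Function.comp_apply, Equiv.apply_symm_apply]

theorem vertDifferential {η : Cₛ^∞⟮𝓑; F, E⟯}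
    (hS : A.IsSpray S) (hη : A.IsLieSymmetry S η) (hT : A.IsInvariant η T) :
    A.IsInvariant η (A.vertDifferential S T) where
  smooth a ha := by
    have hb : ∀ i, IsSmoothPullbackSection EM (Fin.tail a i) := fun i => ha i.succ
    exact (hS.isSmoothPullbackSection_vertDeriv (ha 0) (hT.smooth _ hb)).sub
      (isSmoothPullbackSection_sum _ fun i _ => hT.smooth _ (isSmoothPullbackSection_update hb
        (hS.isSmoothPullbackSection_vertDeriv (ha 0) (hb i)) i))
  map_update_add a ha m σ τ hσ hτ := by
    have hb : ∀ i, IsSmoothPullbackSection EM (Fin.tail a i) := fun i => ha i.succ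
    refine Fin.cases ?_ (fun j => ?_) m
    · simp only [LieAlgebroid.vertDifferential, Fin.tail_update_zero, Function.update_self,
        IsSpray.vertDeriv_add_left hσ hτ]
      simp only [fun i => hT.map_update_add _ hb i _ _
        (hS.isSmoothPullbackSection_vertDeriv hσ (hb i))
        (hS.isSmoothPullbackSection_vertDeriv hτ (hb i)), Finset.sum_add_distrib]
      abel
    · have h0 : ∀ θ, Function.update a j.succ θ 0 = a 0 := fun θ =>
        Function.update_of_ne (Fin.succ_ne_zero j).symm _ _
      simp only [LieAlgebroid.vertDifferential, Fin.tail_update_succ, h0]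
      set b := Fin.tail a
      rw [hT.map_update_add b hb j σ τ hσ hτ, hS.vertDeriv_add_right _
        (hT.smooth _ (isSmoothPullbackSection_update hb hσ j))
        (hT.smooth _ (isSmoothPullbackSection_update hb hτ j))]
      have hsum : ∀ i, T (Function.update (Function.update b j (σ + τ)) i
            (A.vertDeriv S (a 0) (Function.update b j (σ + τ) i)))
          = T (Function.update (Function.update b j σ) i
              (A.vertDeriv S (a 0) (Function.update b j σ i)))
            + T (Function.update (Function.update b j τ) i
              (A.vertDeriv S (a 0) (Function.update b j τ i))) := by
        intro i
        by_cases hij : i = j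
        · subst hij
          simp only [Function.update_self, Function.update_idem]
          rw [hS.vertDeriv_add_right _ hσ hτ, hT.map_update_add b hb i _ _
            (hS.isSmoothPullbackSection_vertDeriv (ha 0) hσ)
            (hS.isSmoothPullbackSection_vertDeriv (ha 0) hτ)]
        · simp only [Function.update_of_ne hij, Function.update_comm (Ne.symm hij)]
          exact hT.map_update_add _ (isSmoothPullbackSection_update hb
            (hS.isSmoothPullbackSection_vertDeriv (ha 0) (hb i)) i) j σ τ hσ hτ
      rw [Finset.sum_congr rfl fun i _ => hsum i, Finset.sum_add_distrib]
      abel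
  lieAlong_apply a ha := by
    have hb : ∀ i, IsSmoothPullbackSection EM (Fin.tail a i) := fun i => ha i.succ
    have hL := fun {σ : PullbackSection F E} (hσ : IsSmoothPullbackSection EM σ) =>
      A.isSmoothPullbackSection_lieAlong η hσ
    have h0 : ∀ (j : Fin k) θ, Function.update a j.succ θ 0 = a 0 := fun j θ =>
      Function.update_of_ne (Fin.succ_ne_zero j).symm _ _
    have ht : ∀ j, a (Fin.succ j) = Fin.tail a j := fun j => rfl
    rw [Fin.sum_univ_succ]
    simp only [LieAlgebroid.vertDifferential, Fin.tail_update_zero, Fin.tail_update_succ, h0,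
      Function.update_self, ht]
    set b := Fin.tail a
    have hD : ∀ i, IsSmoothPullbackSection EM (A.vertDeriv S (a 0) (b i)) := fun i =>
      hS.isSmoothPullbackSection_vertDeriv (ha 0) (hb i)
    have hc : ∀ i j, IsSmoothPullbackSection EM
        (Function.update b i (A.vertDeriv S (a 0) (b i)) j) := fun i =>
      isSmoothPullbackSection_update hb (hD i) i
    rw [A.lieAlong_sub η (hS.isSmoothPullbackSection_vertDeriv (ha 0) (hT.smooth b hb))
        (isSmoothPullbackSection_sum _ fun i _ => hT.smooth _ (hc i)),
      hS.lieAlong_vertDeriv hη (ha 0) (hT.smooth b hb), hT.lieAlong_apply b hb,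
      hS.vertDeriv_sum_right _ _ fun j =>
        hT.smooth _ (isSmoothPullbackSection_update hb (hL (hb j)) j),
      A.lieAlong_sum η _ fun i => hT.smooth _ (hc i)]
    simp only [fun i => hT.lieAlong_apply _ (hc i)]
    -- replacing the argument `i` by its vertical derivative and the argument `j` by its Lie
    -- derivative commute, except for `i = j`, where the Leibniz rule of the vertical derivative
    -- contributes the term with the derivative in the direction `lieAlong η (a 0)`
    have key : ∀ i j, T (Function.update (Function.update b i (A.vertDeriv S (a 0) (b i))) j
          (A.lieAlong η (Function.update b i (A.vertDeriv S (a 0) (b i)) j)))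
        = T (Function.update (Function.update b j (A.lieAlong η (b j))) i
            (A.vertDeriv S (a 0) (Function.update b j (A.lieAlong η (b j)) i)))
          + if i = j then T (Function.update b i (A.vertDeriv S (A.lieAlong η (a 0)) (b i)))
            else 0 := by
      intro i j
      by_cases hij : i = j
      · subst hij
        simp only [Function.update_self, Function.update_idem, if_true]
        rw [hS.lieAlong_vertDeriv hη (ha 0) (hb i), hT.map_update_add b hb i _ _
          (hS.isSmoothPullbackSection_vertDeriv (hL (ha 0)) (hb i))
          (hS.isSmoothPullbackSection_vertDeriv (ha 0) (hL (hb i))), add_comm]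
      · rw [if_neg hij, add_zero, Function.update_of_ne hij, Function.update_of_ne (Ne.symm hij),
          Function.update_comm hij]
    simp only [key, Finset.sum_add_distrib, Finset.sum_ite_eq, Finset.mem_univ, if_true,
      Finset.sum_sub_distrib]
    rw [Finset.sum_comm]
    abel

theorem isCurvatureCollineation {η : Cₛ^∞⟮𝓑; F, E⟯} (hT : A.IsInvariant η T) :
    A.IsCurvatureCollineation (A.completeLift η) T := by
  refine ⟨A.isProjectable_completeLift η, fun a ha => ?_⟩
  rw [lieDerivTensor, A.lieDeriv_completeLift η (hT.smooth a ha), hT.lieAlong_apply a ha,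
    sub_eq_zero]
  exact Finset.sum_congr rfl fun i _ => by rw [A.lieDeriv_completeLift η (ha i)]

end IsInvariant

/-! #### The curvature tensors -/

theorem isInvariant_jacobiEndomorphism {η : Cₛ^∞⟮𝓑; F, E⟯}
    (hS : A.IsSpray S) (hη : A.IsLieSymmetry S η) :
    A.IsInvariant η (A.jacobiEndomorphism S) where
  smooth a ha := hS.isSmoothPullbackSection_vertMap
    (hS.isSection.prolongBracket (hS.isProlongationSection_berwald (ha 0)))
  map_update_add a ha i σ τ hσ hτ := by
    rw [Subsingleton.elim i 0]
    simp only [jacobiEndomorphism, Function.update_self]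
    rw [hS.berwald_add, IsProlongationSection.prolongBracket_add_right _
      (hS.isProlongationSection_berwald hσ) (hS.isProlongationSection_berwald hτ), hS.vertMap_add]
  lieAlong_apply a ha := by
    have hH := hS.isProlongationSection_berwald (ha 0)
    simp only [jacobiEndomorphism, Fin.sum_univ_one, Function.update_self]
    rw [hS.lieAlong_vertMap hη (hS.isSection.prolongBracket hH),
      A.prolongBracket_completeLift_prolongBracket η hS.isSection hH,
      IsSpray.prolongBracket_completeLift_self hη, A.prolongBracket_swap 0,
      IsProlongationSection.prolongBracket_zero_right, neg_zero, zero_add,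
      hS.prolongBracket_completeLift_berwald hη (ha 0)]

theorem isInvariant_fundamentalAffineCurvature {η : Cₛ^∞⟮𝓑; F, E⟯}
    (hS : A.IsSpray S) (hη : A.IsLieSymmetry S η) :
    A.IsInvariant η (A.fundamentalAffineCurvature S) := by
  have h := (isInvariant_jacobiEndomorphism hS hη).vertDifferential hS hη
  convert ((h.comp_perm (Equiv.swap 0 1)).sub h).const_smul (1 / 3) using 2 with a
  rw [fundamentalAffineCurvature]
  congr 3 <;> ext i : 1 <;> fin_cases i <;> rfl

theorem isInvariant_affineCurvature {η : Cₛ^∞⟮𝓑; F, E⟯}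
    (hS : A.IsSpray S) (hη : A.IsLieSymmetry S η) :
    A.IsInvariant η (A.affineCurvature S) := by
  have h := (isInvariant_fundamentalAffineCurvature hS hη).vertDifferential hS hη
  convert h.comp_perm (finRotate 3).symm using 2 with a
  rw [affineCurvature]
  congr 1
  ext i : 1
  fin_cases i <;> rfl

end LieAlgebroid

end Invariance

theorem mainTheorem1
    {EM : Type*} [NormedAddCommGroup EM] [NormedSpace ℝ EM] [FiniteDimensional ℝ EM]
    {M : Type*} [TopologicalSpace M] [T2Space M] [ChartedSpace EM M] [IsManifold 𝓘(ℝ, EM) ∞ M]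
    {F : Type*} [NormedAddCommGroup F] [NormedSpace ℝ F] [FiniteDimensional ℝ F]
    {E : M → Type*} [TopologicalSpace (TotalSpace F E)]
    [∀ x, AddCommGroup (E x)] [∀ x, Module ℝ (E x)] [∀ x, TopologicalSpace (E x)]
    [FiberBundle F E] [VectorBundle ℝ F E] [ContMDiffVectorBundle ∞ F E 𝓘(ℝ, EM)]
    (A : LieAlgebroid EM F E) (S : AmbientSection EM F E) (hS : A.IsSpray S)
    (η : Cₛ^∞⟮𝓘(ℝ, EM); F, E⟯) (hη : A.IsLieSymmetry S η) :
    A.IsCurvatureCollineation (A.completeLift η) (A.jacobiEndomorphism S) ∧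
      A.IsCurvatureCollineation (A.completeLift η) (A.fundamentalAffineCurvature S) ∧
      A.IsCurvatureCollineation (A.completeLift η) (A.affineCurvature S) :=
  ⟨(LieAlgebroid.isInvariant_jacobiEndomorphism hS hη).isCurvatureCollineation,
    (LieAlgebroid.isInvariant_fundamentalAffineCurvature hS hη).isCurvatureCollineation,
    (LieAlgebroid.isInvariant_affineCurvature hS hη).isCurvatureCollineation⟩
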